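/- Let $p$ be a prime, and let $A$ be a commutative ring which is $p$-normal ($p$-torsion-free and integrally closed in $R := A[p^{-1}]$), $p$-adically complete and separated, and Witt-perfect at $p$: writing $W_{p^n}$ for $p$-typical Witt vectors with components indexed by $1,p,\dots,p^n$, the Witt vector Frobenius $F\colon W_{p^{n+1}}(A)\to W_{p^n}(A)$ is surjective for all $n\ge 1$. Equip $R$ with the $p$-adic seminorm: $|x|$ is the infimum of $p^{-c/d}$ over all $c,d\in\mathbb{Z}$ with $d>0$ and $p^{-c}x^d\in A$. Let $A'$ be the inverse limit of $A/(p)$ under the $p$-power Frobenius. Let $R'$ be the inverse limit of $R$ under the $p$-power map, i.e. the set of sequences $x=(x_{p^{-m}})_{m\ge0}$ in $R$ with $x_{p^{-m-1}}^p=x_{p^{-m}}$, with componentwise multiplication, addition $(x+y)_{p^{-m}}=\lim_{l\to\infty}(x_{p^{-m-l}}+y_{p^{-m-l}})^{p^l}$, and seminorm $|x|:=|x_1|$. For a ring $B$ let $\underleftarrow{W}(B)$ be the inverse limit of the rings $W_{p^n}(B)$, $n\ge0$, along the maps $F$. If $B$ carries a submultiplicative nonarchimedean seminorm, put $|(x_{p^i})_{0\le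 i\le n}|_W=\max_i|x_{p^i}|^{1/p^i}$ on $W_{p^n}(B)$; for $b>0$ let $\underleftarrow{W}^b(B)$ be the set of $\underline{x}=(\underline{x}_{p^{-n}})\in\underleftarrow{W}(B)$ with $p^{-bn}|\underline{x}_{p^{-n}}|_W^{p^n}\to0$ as $n\to\infty$, and put $|\underline{x}|_{W,b}=\sup_n p^{-bn}|\underline{x}_{p^{-n}}|_W^{p^n}$. Then: 1. There is a ring homomorphism $\iota\colon A'\to R'$ such that for every $a\in A'$ all components of $\iota(a)$ lie in (the image of) $A$ and reduce modulo $p$ to the corresponding components of $a$; and there is a ring isomorphism $\theta\colon\underleftarrow{W}(A')\cong\underleftarrow{W}(A)$ compatible with the maps of both sides to $\underleftarrow{W}(A/(p))$ induced by the projection of $A'$ onto its last term $A/(p)$ and by the reduction $A\to A/(p)$. 2. For every $b>0$, $\underleftarrow{W}^b(R')$ is a subring of $\underleftarrow{W}(R')$, and $\underleftarrow{W}(\iota)$ is an injective ring homomorphism from $\underleftarrow{W}(A')$ into $\underleftarrow{W}^b(R')$. 3. For $0<b\le1$, $\underleftarrow{W}^b(R')$ and $\underleftarrow{W}^b(R)$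 are subrings of $\underleftarrow{W}(R')$ and $\underleftarrow{W}(R)$, and there is a ring isomorphism $\underleftarrow{W}^b(R')\cong\underleftarrow{W}^b(R)$, isometric for $|\cdot|_{W,b}$, which extends $\theta$: it sends $\underleftarrow{W}(\iota)(\underline{x})$ to the image of $\theta(\underline{x})$ in $\underleftarrow{W}(R)$ for all $\underline{x}\in\underleftarrow{W}(A')$. -/

import Mathlib

open Filter Topology

namespace OverconvergentWitt

/-- The facts about the `p`-adic norm which make the ring of `p`-power-compatible sequences well
defined: it is nonarchimedean, complete, power-multiplicative, and `|p| ≤ p⁻¹`. -/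
class IsPAdicNormed (p : ℕ) (R : Type*) [NormedCommRing R] : Prop where
  ultra : ∀ x y : R, ‖x + y‖ ≤ max ‖x‖ ‖y‖
  pow : ∀ (x : R) (n : ℕ), 0 < n → ‖x ^ n‖ = ‖x‖ ^ n
  norm_p : ‖(p : R)‖ ≤ (p : ℝ)⁻¹
  complete : CompleteSpace R

/-- The inverse limit of `R` under the `p`-power map, as a set. -/
@[ext]
structure PowSeq (p : ℕ) (R : Type*) [Monoid R] where
  coeff : ℕ → R
  pow_coeff : ∀ n, coeff (n + 1) ^ p = coeff n

set_option linter.unusedSectionVars false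
set_option linter.style.haveILetI false

namespace PowSeq

section Generic

variable {p : ℕ} [hp : Fact p.Prime] {R : Type*} [NormedCommRing R]

lemma norm_nsmul_le (h : IsPAdicNormed p R) (n : ℕ) (x : R) : ‖(n : R) * x‖ ≤ ‖x‖ := by
  induction n with
  | zero => simp
  | succ n ih =>
    rw [Nat.cast_succ, add_mul, one_mul]
    exact (h.ultra _ _).trans (max_le ih le_rfl)

lemma norm_sum_le (h : IsPAdicNormed p R) {ι : Type*} (s : Finset ι) (f : ι → R) {C : ℝ}
    (hC : 0 ≤ C) (hf : ∀ i ∈ s, ‖f i‖ ≤ C) : ‖∑ i ∈ s, f i‖ ≤ C := by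
  classical
  induction s using Finset.induction_on with
  | empty => simpa
  | insert a s ha ih =>
    rw [Finset.sum_insert ha]
    exact (h.ultra _ _).trans (max_le (hf a (by simp)) (ih fun i hi => hf i (by simp [hi])))

lemma norm_p_mul_le (h : IsPAdicNormed p R) (x : R) : ‖(p : R) * x‖ ≤ (p : ℝ)⁻¹ * ‖x‖ :=
  (norm_mul_le _ _).trans (mul_le_mul_of_nonneg_right h.norm_p (norm_nonneg _))

lemma inv_p_pos (p : ℕ) [hp : Fact p.Prime] : (0 : ℝ) < (p : ℝ)⁻¹ := by
  have := hp.out.pos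
  positivity

lemma inv_p_lt_one (p : ℕ) [hp : Fact p.Prime] : (p : ℝ)⁻¹ < 1 :=
  inv_lt_one_of_one_lt₀ (by exact_mod_cast hp.out.one_lt)

/-- The mixed terms of `(x + y) ^ p`. -/
lemma norm_cross_le (h : IsPAdicNormed p R) (x y : R) {a b C : ℝ} (ha : ‖x‖ ≤ a) (hb : ‖y‖ ≤ b)
    (hC : ∀ k ∈ Finset.Ioo 0 p, a ^ k * b ^ (p - k) ≤ C) (hC0 : 0 ≤ C) :
    ‖(x + y) ^ p - x ^ p - y ^ p‖ ≤ (p : ℝ)⁻¹ * C := by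
  rw [add_pow_prime_eq' hp.out]
  have e : ∀ S : R, x ^ p + y ^ p + p * S - x ^ p - y ^ p = p * S := fun S => by ring
  rw [e]
  refine (norm_p_mul_le h _).trans (mul_le_mul_of_nonneg_left ?_ (inv_p_pos p).le)
  refine norm_sum_le h _ _ hC0 fun k hk => ?_
  rw [mul_comm]
  refine (norm_nsmul_le h _ _).trans ((norm_mul_le _ _).trans (le_trans ?_ (hC k hk)))
  rw [Finset.mem_Ioo] at hk
  refine mul_le_mul ((norm_pow_le' _ hk.1).trans (pow_le_pow_left₀ (norm_nonneg _) ha _))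
    ((norm_pow_le' _ (by omega)).trans (pow_le_pow_left₀ (norm_nonneg _) hb _))
    (norm_nonneg _) (pow_nonneg ((norm_nonneg _).trans ha) _)

lemma norm_pow_sub_pow_le (h : IsPAdicNormed p R) {x y : R} {C : ℝ} (k : ℕ) (hk : 1 ≤ k)
    (hy : ‖y‖ ≤ C) (hxy : ‖x - y‖ ≤ ((p : ℝ)⁻¹) ^ k * C) :
    ‖x ^ p - y ^ p‖ ≤ ((p : ℝ)⁻¹) ^ (k + 1) * C ^ p := by
  have hC : 0 ≤ C := (norm_nonneg _).trans hy
  have h0 := (inv_p_pos p).le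
  have h1 := (inv_p_lt_one p).le
  have h2 := hp.out.two_le
  obtain ⟨d, rfl⟩ : ∃ d, x = y + d := ⟨x - y, by ring⟩
  rw [add_sub_cancel_left] at hxy
  have e : (y + d) ^ p - y ^ p = ((y + d) ^ p - y ^ p - d ^ p) + d ^ p := by ring
  rw [e]
  refine (h.ultra _ _).trans (max_le ?_ ?_)
  · rw [pow_succ', mul_assoc]
    refine norm_cross_le h y d hy hxy (fun j hj => ?_) (by positivity)
    rw [Finset.mem_Ioo] at hj
    have e2 : C ^ j * (((p : ℝ)⁻¹) ^ k * C) ^ (p - j) = ((p : ℝ)⁻¹) ^ (k * (p - j)) * C ^ p := by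
      rw [mul_pow, ← pow_mul, mul_left_comm, ← pow_add]
      congr 2
      omega
    rw [e2]
    refine mul_le_mul_of_nonneg_right (pow_le_pow_of_le_one h0 h1 ?_) (by positivity)
    exact Nat.le_mul_of_pos_right _ (by omega)
  · rw [h.pow _ _ hp.out.pos]
    refine (pow_le_pow_left₀ (norm_nonneg _) hxy _).trans ?_
    rw [mul_pow, ← pow_mul]
    refine mul_le_mul_of_nonneg_right (pow_le_pow_of_le_one h0 h1 ?_) (by positivity)
    nlinarith

lemma norm_pow_pow_sub_le (h : IsPAdicNormed p R) {x y : R} {C : ℝ} (hy : ‖y‖ ≤ C)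
    (hxy : ‖x - y‖ ≤ (p : ℝ)⁻¹ * C) (l : ℕ) :
    ‖x ^ p ^ l - y ^ p ^ l‖ ≤ ((p : ℝ)⁻¹) ^ (l + 1) * C ^ p ^ l := by
  induction l with
  | zero => simpa using hxy
  | succ l ih =>
    have hy' : ‖y ^ p ^ l‖ ≤ C ^ p ^ l :=
      (norm_pow_le' _ (pow_pos hp.out.pos _)).trans (pow_le_pow_left₀ (norm_nonneg _) hy _)
    have := norm_pow_sub_pow_le h (l + 1) (by omega) hy' ih
    rwa [← pow_mul, ← pow_mul, ← pow_mul, ← pow_succ] at this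

/-- The sequence whose limit is the `m`-th entry of `x + y`. -/
def addSeq (x y : PowSeq p R) (m l : ℕ) : R := (x.coeff (m + l) + y.coeff (m + l)) ^ p ^ l

/-- A common bound for the entries of `x` and `y`. -/
def bd (x y : PowSeq p R) (m : ℕ) : ℝ := max ‖x.coeff m‖ ‖y.coeff m‖

lemma norm_succ (h : IsPAdicNormed p R) (x : PowSeq p R) (m : ℕ) :
    ‖x.coeff (m + 1)‖ ^ p = ‖x.coeff m‖ := by
  rw [← h.pow _ _ hp.out.pos, x.pow_coeff]

lemma bd_succ (h : IsPAdicNormed p R) (x y : PowSeq p R) (m : ℕ) :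
    bd x y (m + 1) ^ p = bd x y m := by
  unfold bd
  rw [← norm_succ h x m, ← norm_succ h y m]
  rcases le_total ‖x.coeff (m + 1)‖ ‖y.coeff (m + 1)‖ with hh | hh
  · rw [max_eq_right hh, max_eq_right (pow_le_pow_left₀ (norm_nonneg _) hh _)]
  · rw [max_eq_left hh, max_eq_left (pow_le_pow_left₀ (norm_nonneg _) hh _)]

lemma bd_nonneg (x y : PowSeq p R) (m : ℕ) : 0 ≤ bd x y m :=
  (norm_nonneg _).trans (le_max_left _ _)

lemma bd_add (h : IsPAdicNormed p R) (x y : PowSeq p R) (m l : ℕ) :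
    bd x y (m + l) ^ p ^ l = bd x y m := by
  induction l with
  | zero => simp
  | succ l ih => rw [pow_succ', pow_mul, ← add_assoc, bd_succ h, ih]

lemma addSeq_succ_sub (h : IsPAdicNormed p R) (x y : PowSeq p R) (m l : ℕ) :
    ‖addSeq x y m (l + 1) - addSeq x y m l‖ ≤ ((p : ℝ)⁻¹) ^ (l + 1) * bd x y m := by
  have hb := bd_nonneg x y (m + l + 1)
  have key : ‖(x.coeff (m + l + 1) + y.coeff (m + l + 1)) ^ p - (x.coeff (m + l) + y.coeff (m + l))‖
      ≤ (p : ℝ)⁻¹ * bd x y (m + l) := by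
    have := norm_cross_le h (x.coeff (m + l + 1)) (y.coeff (m + l + 1)) (a := bd x y (m + l + 1))
      (b := bd x y (m + l + 1)) (C := bd x y (m + l)) (le_max_left _ _) (le_max_right _ _)
      (fun k hk => by
        rw [Finset.mem_Ioo] at hk
        rw [← pow_add, Nat.add_sub_cancel' hk.2.le, bd_succ h]) (bd_nonneg _ _ _)
    rwa [x.pow_coeff, y.pow_coeff, sub_sub] at this
  have := norm_pow_pow_sub_le h (h.ultra _ _) key l
  rw [← bd, bd_add h, ← pow_mul, ← pow_succ'] at this
  exact this

lemma addSeq_sub_zero (h : IsPAdicNormed p R) (x y : PowSeq p R) (m l : ℕ) :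
    ‖addSeq x y m l - (x.coeff m + y.coeff m)‖ ≤ (p : ℝ)⁻¹ * bd x y m := by
  induction l with
  | zero =>
    simp only [addSeq, add_zero, pow_zero, pow_one, sub_self, norm_zero]
    exact mul_nonneg (inv_p_pos p).le (bd_nonneg _ _ _)
  | succ l ih =>
    have e : addSeq x y m (l + 1) - (x.coeff m + y.coeff m) =
      (addSeq x y m (l + 1) - addSeq x y m l) + (addSeq x y m l - (x.coeff m + y.coeff m)) := by ring
    rw [e]
    refine (h.ultra _ _).trans (max_le ((addSeq_succ_sub h x y m l).trans ?_) ih)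
    refine mul_le_mul_of_nonneg_right ?_ (bd_nonneg _ _ _)
    exact pow_le_of_le_one (inv_p_pos p).le (inv_p_lt_one p).le (by omega)

lemma tendsto_addSeq (h : IsPAdicNormed p R) (x y : PowSeq p R) (m : ℕ) :
    Tendsto (addSeq x y m) atTop (𝓝 (limUnder atTop (addSeq x y m))) := by
  have := h.complete
  apply CauchySeq.tendsto_limUnder
  refine cauchySeq_of_le_geometric (p : ℝ)⁻¹ ((p : ℝ)⁻¹ * bd x y m) (inv_p_lt_one p) fun l => ?_
  rw [dist_comm, dist_eq_norm]
  refine (addSeq_succ_sub h x y m l).trans (le_of_eq ?_)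
  ring

variable [hR : IsPAdicNormed p R]

/-- The sum of two sequences: `(x + y)_m = lim_l (x_{m+l} + y_{m+l}) ^ (p ^ l)`. -/
noncomputable instance : Add (PowSeq p R) where
  add x y := ⟨fun m => limUnder atTop fun l : ℕ => (x.coeff (m + l) + y.coeff (m + l)) ^ p ^ l, fun m => by
    have h1 := (tendsto_addSeq hR x y (m + 1)).pow p
    have h2 := (tendsto_addSeq hR x y m).comp (tendsto_add_atTop_nat 1)
    refine tendsto_nhds_unique h1 (h2.congr fun l => ?_)
    simp only [Function.comp, addSeq]
    rw [← pow_mul, ← pow_succ, show m + (l + 1) = m + 1 + l by ring]⟩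

instance : Zero (PowSeq p R) := ⟨⟨fun _ => 0, fun _ => zero_pow hp.out.ne_zero⟩⟩

instance : One (PowSeq p R) := ⟨⟨fun _ => 1, fun _ => one_pow p⟩⟩

instance : Mul (PowSeq p R) :=
  ⟨fun x y => ⟨fun n => x.coeff n * y.coeff n, fun n => by rw [mul_pow, x.pow_coeff, y.pow_coeff]⟩⟩

/-- The additive inverse: `-x` if `p` is odd, and `x` itself if `p = 2`. -/
instance : Neg (PowSeq p R) :=
  ⟨fun x => ⟨fun n => (-1) ^ p * x.coeff n, fun n => by
    rw [mul_pow, x.pow_coeff]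
    congr 1
    rcases hp.out.eq_two_or_odd' with rfl | ho
    · norm_num
    · rw [ho.neg_one_pow, ho.neg_one_pow]⟩⟩

@[simp] lemma zero_val (n : ℕ) : (0 : PowSeq p R).coeff n = 0 := rfl
@[simp] lemma one_val (n : ℕ) : (1 : PowSeq p R).coeff n = 1 := rfl
@[simp] lemma mul_val (x y : PowSeq p R) (n : ℕ) : (x * y).coeff n = x.coeff n * y.coeff n := rfl
lemma neg_val (x : PowSeq p R) (n : ℕ) : (-x).coeff n = (-1) ^ p * x.coeff n := rfl

/-- Sequences which are negligible modulo `p`, relative to a `p`-power-compatible bound. -/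
def Small (p : ℕ) (d : ℕ → R) : Prop :=
  ∃ C : ℕ → ℝ, (∀ n, 0 ≤ C n) ∧ (∀ n, C (n + 1) ^ p = C n) ∧ ∀ n, ‖d n‖ ≤ (p : ℝ)⁻¹ * C n

lemma Small.add (h : IsPAdicNormed p R) {d e : ℕ → R} (hd : Small p d) (he : Small p e) :
    Small p (fun n => d n + e n) := by
  obtain ⟨C, hC0, hC, hd⟩ := hd
  obtain ⟨D, hD0, hD, he⟩ := he
  refine ⟨fun n => max (C n) (D n), fun n => (hC0 n).trans (le_max_left _ _), fun n => ?_,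
    fun n => ?_⟩
  · simp only []
    rw [← hC n, ← hD n]
    rcases le_total (C (n + 1)) (D (n + 1)) with hh | hh
    · rw [max_eq_right hh, max_eq_right (pow_le_pow_left₀ (hC0 _) hh _)]
    · rw [max_eq_left hh, max_eq_left (pow_le_pow_left₀ (hD0 _) hh _)]
  · refine (h.ultra _ _).trans (max_le ((hd n).trans ?_) ((he n).trans ?_))
    · exact mul_le_mul_of_nonneg_left (le_max_left _ _) (inv_p_pos p).le
    · exact mul_le_mul_of_nonneg_left (le_max_right _ _) (inv_p_pos p).le

lemma Small.neg {d : ℕ → R} (hd : Small p d) : Small p (fun n => -d n) := by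
  obtain ⟨C, hC0, hC, hd⟩ := hd
  exact ⟨C, hC0, hC, fun n => by rw [norm_neg]; exact hd n⟩

lemma Small.mul (h : IsPAdicNormed p R) {d : ℕ → R} (hd : Small p d) (x : PowSeq p R) :
    Small p (fun n => x.coeff n * d n) := by
  obtain ⟨C, hC0, hC, hd⟩ := hd
  refine ⟨fun n => ‖x.coeff n‖ * C n, fun n => mul_nonneg (norm_nonneg _) (hC0 n), fun n => ?_,
    fun n => ?_⟩
  · simp only []
    rw [mul_pow, hC, norm_succ h]
  · refine (norm_mul_le _ _).trans ?_
    rw [mul_left_comm]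
    exact mul_le_mul_of_nonneg_left (hd n) (norm_nonneg _)

lemma small_add (h : IsPAdicNormed p R) (x y : PowSeq p R) :
    Small p (fun n => (x + y).coeff n - (x.coeff n + y.coeff n)) := by
  refine ⟨bd x y, bd_nonneg x y, bd_succ h x y, fun n => ?_⟩
  exact le_of_tendsto ((tendsto_addSeq h x y n).sub_const _).norm
    (Eventually.of_forall fun l => addSeq_sub_zero h x y n l)

lemma eq_of_small (h : IsPAdicNormed p R) {x y : PowSeq p R}
    (hs : Small p (fun n => x.coeff n - y.coeff n)) : x = y := by
  obtain ⟨C, hC0, hC, hd⟩ := hs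
  have hD := bd_succ h x y
  set E : ℕ → ℝ := fun n => max (C n) (bd x y n) with hE
  have hE0 : ∀ n, 0 ≤ E n := fun n => (hC0 n).trans (le_max_left _ _)
  have hEs : ∀ n, E (n + 1) ^ p = E n := fun n => by
    simp only [hE]
    rw [← hC n, ← hD n]
    rcases le_total (C (n + 1)) (bd x y (n + 1)) with hh | hh
    · rw [max_eq_right hh, max_eq_right (pow_le_pow_left₀ (hC0 _) hh _)]
    · rw [max_eq_left hh, max_eq_left (pow_le_pow_left₀ (bd_nonneg _ _ _) hh _)]
  have hEl : ∀ m l, E (m + l) ^ p ^ l = E m := fun m l => by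
    induction l with
    | zero => simp
    | succ l ih => rw [pow_succ', pow_mul, ← add_assoc, hEs, ih]
  have hx : ∀ (z : PowSeq p R) (m l : ℕ), z.coeff (m + l) ^ p ^ l = z.coeff m := fun z m l => by
    induction l with
    | zero => simp
    | succ l ih => rw [pow_succ', pow_mul, ← add_assoc, z.pow_coeff, ih]
  refine PowSeq.ext (funext fun m => ?_)
  have key : ∀ l, ‖x.coeff m - y.coeff m‖ ≤ ((p : ℝ)⁻¹) ^ (l + 1) * E m := fun l => by
    have := norm_pow_pow_sub_le h (x := x.coeff (m + l)) (y := y.coeff (m + l)) (C := E (m + l))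
      ((le_max_right _ _).trans (le_max_right _ _))
      ((hd _).trans (mul_le_mul_of_nonneg_left (le_max_left _ _) (inv_p_pos p).le)) l
    rwa [hx, hx, hEl] at this
  have lim : Tendsto (fun l : ℕ => ((p : ℝ)⁻¹) ^ (l + 1) * E m) atTop (𝓝 0) := by
    have := ((tendsto_pow_atTop_nhds_zero_of_lt_one (inv_p_pos p).le (inv_p_lt_one p)).comp
      (tendsto_add_atTop_nat 1)).mul_const (E m)
    simpa using this
  exact sub_eq_zero.mp (norm_le_zero_iff.mp (ge_of_tendsto' lim key))

/-- Two sequences agree as soon as their difference is a sum of negligible sequences. -/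
lemma ext_small (h : IsPAdicNormed p R) {x y : PowSeq p R} (d : ℕ → R) (hd : Small p d)
    (e : ∀ n, x.coeff n - y.coeff n = d n) : x = y :=
  eq_of_small h (by simpa only [e] using hd)

lemma small_neg (h : IsPAdicNormed p R) (x : PowSeq p R) :
    Small p (fun n => (-x).coeff n + x.coeff n) := by
  refine ⟨fun n => ‖x.coeff n‖, fun n => norm_nonneg _, norm_succ h x, fun n => ?_⟩
  change ‖(-1) ^ p * x.coeff n + x.coeff n‖ ≤ (p : ℝ)⁻¹ * ‖x.coeff n‖
  rcases hp.out.eq_two_or_odd' with rfl | ho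
  · have e : (-1) ^ 2 * x.coeff n + x.coeff n = ((2 : ℕ) : R) * x.coeff n := by push_cast; ring
    rw [e]
    exact norm_p_mul_le h _
  · rw [ho.neg_one_pow]
    simpa using mul_nonneg (inv_p_pos p).le (norm_nonneg _)

/-- The ring structure: multiplication is entrywise, and addition is given by the limit formula. -/
noncomputable instance instCommRing : CommRing (PowSeq p R) where
  add_assoc x y z := by
    refine ext_small hR _ (((small_add hR (x + y) z).add hR (small_add hR x y)).add hR
      (((small_add hR x (y + z)).add hR (small_add hR y z)).neg)) fun n => ?_
    ring
  zero_add x := ext_small hR _ (small_add hR 0 x) fun n => by simp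
  add_zero x := ext_small hR _ (small_add hR x 0) fun n => by simp
  add_comm x y := by
    refine ext_small hR _ ((small_add hR x y).add hR (small_add hR y x).neg) fun n => ?_
    ring
  nsmul := nsmulRec
  zsmul := zsmulRec
  neg_add_cancel x := by
    refine ext_small hR _ ((small_add hR (-x) x).add hR (small_neg hR x)) fun n => ?_
    simp
  mul_assoc x y z := PowSeq.ext (funext fun n => mul_assoc _ _ _)
  mul_comm x y := PowSeq.ext (funext fun n => mul_comm _ _)
  one_mul x := PowSeq.ext (funext fun n => one_mul _)
  mul_one x := PowSeq.ext (funext fun n => mul_one _)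
  zero_mul x := PowSeq.ext (funext fun n => zero_mul _)
  mul_zero x := PowSeq.ext (funext fun n => mul_zero _)
  left_distrib x y z := by
    refine ext_small hR _ (((small_add hR y z).mul hR x).add hR
      (small_add hR (x * y) (x * z)).neg) fun n => ?_
    simp only [mul_val]
    ring
  right_distrib x y z := by
    refine ext_small hR _ (((small_add hR x y).mul hR z).add hR
      (small_add hR (x * z) (y * z)).neg) fun n => ?_
    simp only [mul_val]
    ring

end Generic

end PowSeq

section PAdic

/-- `A_p = A[1/p]`. -/
abbrev Loc (p : ℕ) (A : Type*) [CommRing A] : Type _ := Localization.Away (p : A)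

/-- A ring `A` is `p`-normal if it is `p`-torsion-free and integrally closed in `A[1/p]`. -/
class IsPNormal (p : ℕ) (A : Type*) [CommRing A] : Prop where
  torsionFree : ∀ a : A, (p : A) * a = 0 → a = 0
  integrallyClosed : ∀ x : Loc p A, IsIntegral A x → x ∈ (algebraMap A (Loc p A)).range

/-- `p` as a unit of `A[1/p]`. -/
noncomputable def pUnit (p : ℕ) (A : Type*) [CommRing A] : (Loc p A)ˣ :=
  (IsLocalization.Away.algebraMap_isUnit (S := Loc p A) (p : A)).unit

/-- The condition `p ^ (-c) * x ^ d ∈ A` on an element `x` of `A[1/p]`. -/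
def HasVal (p : ℕ) (A : Type*) [CommRing A] (c : ℤ) (d : ℕ) (x : Loc p A) : Prop :=
  ((pUnit p A ^ (-c) : (Loc p A)ˣ) : Loc p A) * x ^ d ∈ (algebraMap A (Loc p A)).range

/-- The `p`-adic seminorm on `A[1/p]`: the infimum of `p ^ (-c/d)` over all integers `c, d` with
`d > 0` and `p ^ (-c) * x ^ d ∈ A`. -/
noncomputable def padicSeminorm (p : ℕ) (A : Type*) [CommRing A] (x : Loc p A) : ℝ :=
  sInf {r : ℝ | ∃ (c : ℤ) (d : ℕ), 0 < d ∧ HasVal p A c d x ∧ r = (p : ℝ) ^ (-((c : ℝ) / d))}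

variable {p : ℕ} [hp : Fact p.Prime] {A : Type*} [CommRing A]

lemma pUnit_val (p : ℕ) (A : Type*) [CommRing A] : (pUnit p A : Loc p A) = (p : Loc p A) := by
  simp [pUnit]

lemma pUnit_pow_mem (n : ℕ) :
    ((pUnit p A ^ (n : ℤ) : (Loc p A)ˣ) : Loc p A) ∈ (algebraMap A (Loc p A)).range :=
  ⟨(p : A) ^ n, by simp [pUnit_val]⟩

lemma algebraMap_injective (h : IsPNormal p A) : Function.Injective (algebraMap A (Loc p A)) := by
  refine IsLocalization.injective (Loc p A) (M := Submonoid.powers (p : A)) ?_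
  rintro _ ⟨n, rfl⟩
  refine pow_mem ?_ n
  rw [mem_nonZeroDivisors_iff_right]
  intro a ha
  exact h.torsionFree a (by rwa [mul_comm])

lemma mem_of_pow_mem (h : IsPNormal p A) {x : Loc p A} {n : ℕ} (hn : 0 < n)
    (hx : x ^ n ∈ (algebraMap A (Loc p A)).range) : x ∈ (algebraMap A (Loc p A)).range := by
  obtain ⟨a, ha⟩ := hx
  exact h.integrallyClosed x (IsIntegral.of_pow hn (ha ▸ isIntegral_algebraMap))

lemma HasVal.mono (h : IsPNormal p A) {c c' : ℤ} {d d' : ℕ} {x : Loc p A} (hd : 0 < d)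
    (hx : HasVal p A c d x) (hle : c' * d ≤ c * d') : HasVal p A c' d' x := by
  refine mem_of_pow_mem h hd ?_
  obtain ⟨n, hn⟩ := Int.eq_ofNat_of_zero_le (sub_nonneg.mpr hle)
  have e : (((pUnit p A ^ (-c') : (Loc p A)ˣ) : Loc p A) * x ^ d') ^ d =
      ((pUnit p A ^ (n : ℤ) : (Loc p A)ˣ) : Loc p A) *
        (((pUnit p A ^ (-c) : (Loc p A)ˣ) : Loc p A) * x ^ d) ^ d' := by
    rw [mul_pow, mul_pow, ← pow_mul, ← pow_mul, mul_comm d' d, ← mul_assoc]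
    congr 1
    rw [← Units.val_pow_eq_pow_val, ← Units.val_pow_eq_pow_val, ← Units.val_mul, ← zpow_natCast,
      ← zpow_mul, ← zpow_natCast, ← zpow_mul, ← zpow_add, ← hn]
    congr 2
    ring
  rw [e]
  exact Subring.mul_mem _ (pUnit_pow_mem n) (Subring.pow_mem _ hx _)

lemma HasVal.mul {c c' : ℤ} {d : ℕ} {x y : Loc p A}
    (hx : HasVal p A c d x) (hy : HasVal p A c' d y) : HasVal p A (c + c') d (x * y) := by
  have := Subring.mul_mem _ hx hy
  unfold HasVal
  convert this using 1
  rw [neg_add, zpow_add, Units.val_mul, mul_pow]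
  ring

lemma HasVal.add (h : IsPNormal p A) {c : ℤ} {d : ℕ} (hd : 0 < d) {x y : Loc p A}
    (hx : HasVal p A c d x) (hy : HasVal p A c d y) : HasVal p A c d (x + y) := by
  unfold HasVal
  rw [add_pow, Finset.mul_sum]
  refine Subring.sum_mem _ fun i hi => ?_
  rw [← mul_assoc]
  refine Subring.mul_mem _ ?_ (natCast_mem _ _)
  have hi' : i ≤ d := by simpa [Nat.lt_succ_iff] using hi
  refine mem_of_pow_mem h hd ?_
  have e : (((pUnit p A ^ (-c) : (Loc p A)ˣ) : Loc p A) * (x ^ i * y ^ (d - i))) ^ d =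
      (((pUnit p A ^ (-c) : (Loc p A)ˣ) : Loc p A) * x ^ d) ^ i *
      (((pUnit p A ^ (-c) : (Loc p A)ˣ) : Loc p A) * y ^ d) ^ (d - i) := by
    have e2 : (((pUnit p A ^ (-c) : (Loc p A)ˣ) : Loc p A)) ^ d =
        (((pUnit p A ^ (-c) : (Loc p A)ˣ) : Loc p A)) ^ i *
        (((pUnit p A ^ (-c) : (Loc p A)ˣ) : Loc p A)) ^ (d - i) := by
      rw [← pow_add, Nat.add_sub_cancel' hi']
    rw [mul_pow, mul_pow, mul_pow, mul_pow, e2]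
    ring
  rw [e]
  exact Subring.mul_mem _ (Subring.pow_mem _ hx _) (Subring.pow_mem _ hy _)

lemma one_lt_p (p : ℕ) [hp : Fact p.Prime] : (1 : ℝ) < p := by exact_mod_cast hp.out.one_lt

lemma padicSeminorm_nonneg (x : Loc p A) : 0 ≤ padicSeminorm p A x := by
  refine Real.sInf_nonneg ?_
  rintro r ⟨c, d, -, -, rfl⟩
  positivity

lemma padicSeminorm_le {c : ℤ} {d : ℕ} {x : Loc p A} (hd : 0 < d) (hx : HasVal p A c d x) :
    padicSeminorm p A x ≤ (p : ℝ) ^ (-((c : ℝ) / d)) := by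
  refine csInf_le ⟨0, ?_⟩ ⟨c, d, hd, hx, rfl⟩
  rintro r ⟨c, d, -, -, rfl⟩
  positivity

lemma exists_hasVal (x : Loc p A) : ∃ c : ℤ, HasVal p A c 1 x := by
  obtain ⟨⟨a, ⟨_, n, rfl⟩⟩, ha⟩ := IsLocalization.surj (Submonoid.powers (p : A)) x
  refine ⟨-n, a, ?_⟩
  rw [← ha, neg_neg, zpow_natCast, Units.val_pow_eq_pow_val, pUnit_val]
  simp [mul_comm]

lemma exists_of_lt {x : Loc p A} {r : ℝ} (hr : padicSeminorm p A x < r) :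
    ∃ (c : ℤ) (d : ℕ), 0 < d ∧ HasVal p A c d x ∧ (p : ℝ) ^ (-((c : ℝ) / d)) < r := by
  obtain ⟨c, hc⟩ := exists_hasVal x
  obtain ⟨_, ⟨c, d, hd, hx, rfl⟩, h⟩ := exists_lt_of_csInf_lt
    (s := {r : ℝ | ∃ (c : ℤ) (d : ℕ), 0 < d ∧ HasVal p A c d x ∧ r = (p : ℝ) ^ (-((c : ℝ) / d))})
    ⟨_, c, 1, one_pos, hc, rfl⟩ hr
  exact ⟨c, d, hd, hx, h⟩

lemma padicSeminorm_add (h : IsPNormal p A) (x y : Loc p A) :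
    padicSeminorm p A (x + y) ≤ max (padicSeminorm p A x) (padicSeminorm p A y) := by
  refine le_of_forall_gt fun r hr => ?_
  obtain ⟨c, d, hd, hx, h1⟩ := exists_of_lt ((le_max_left _ _).trans_lt hr)
  obtain ⟨c', d', hd', hy, h2⟩ := exists_of_lt ((le_max_right _ _).trans_lt hr)
  rcases le_total (c * d') (c' * d) with hh | hh
  · exact (padicSeminorm_le hd (hx.add h hd (hy.mono h hd' hh))).trans_lt h1
  · exact (padicSeminorm_le hd' ((hx.mono h hd hh).add h hd' hy)).trans_lt h2

lemma padicSeminorm_mul (h : IsPNormal p A) (x y : Loc p A) :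
    padicSeminorm p A (x * y) ≤ padicSeminorm p A x * padicSeminorm p A y := by
  refine le_mul_of_forall_lt₀ fun a ha b hb => ?_
  obtain ⟨c, d, hd, hx, h1⟩ := exists_of_lt ha
  obtain ⟨c', d', hd', hy, h2⟩ := exists_of_lt hb
  have hx' : HasVal p A (c * d') (d * d') x := hx.mono h hd (by push_cast; nlinarith)
  have hy' : HasVal p A (c' * d) (d * d') y := hy.mono h hd' (by push_cast; nlinarith)
  refine (padicSeminorm_le (Nat.mul_pos hd hd') (hx'.mul hy')).trans ?_
  have hd0 : (d : ℝ) ≠ 0 := by exact_mod_cast hd.ne'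
  have hd0' : (d' : ℝ) ≠ 0 := by exact_mod_cast hd'.ne'
  have hp0 : (0 : ℝ) < p := by linarith [one_lt_p p]
  have e : -(((c * d' + c' * d : ℤ) : ℝ) / ((d * d' : ℕ) : ℝ)) =
      -((c : ℝ) / d) + -((c' : ℝ) / d') := by
    push_cast
    field_simp
    ring
  rw [e, Real.rpow_add hp0]
  exact mul_le_mul h1.le h2.le (by positivity) ((padicSeminorm_nonneg x).trans ha.le)

lemma padicSeminorm_pow_le (x : Loc p A) {n : ℕ} (hn : 0 < n) :
    padicSeminorm p A x ^ n ≤ padicSeminorm p A (x ^ n) := by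
  refine le_of_forall_gt fun r hr => ?_
  obtain ⟨c, d, hd, hx, h1⟩ := exists_of_lt hr
  refine lt_of_le_of_lt ?_ h1
  have hx' : HasVal p A c (n * d) x := by
    unfold HasVal at hx ⊢
    rwa [← pow_mul] at hx
  refine (pow_le_pow_left₀ (padicSeminorm_nonneg x)
    (padicSeminorm_le (Nat.mul_pos hn hd) hx') n).trans (le_of_eq ?_)
  have hd0 : (d : ℝ) ≠ 0 := by exact_mod_cast hd.ne'
  have hn0 : (n : ℝ) ≠ 0 := by exact_mod_cast hn.ne'
  have hp0 : (0 : ℝ) ≤ p := by linarith [one_lt_p p]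
  rw [← Real.rpow_mul_natCast hp0]
  congr 1
  push_cast
  field_simp

lemma padicSeminorm_pow (h : IsPNormal p A) (x : Loc p A) {n : ℕ} (hn : 0 < n) :
    padicSeminorm p A (x ^ n) = padicSeminorm p A x ^ n := by
  refine le_antisymm ?_ (padicSeminorm_pow_le x hn)
  induction n, hn using Nat.le_induction with
  | base => simp
  | succ n hn ih =>
    rw [pow_succ, pow_succ]
    exact (padicSeminorm_mul h _ _).trans
      (mul_le_mul_of_nonneg_right ih (padicSeminorm_nonneg _))

lemma padicSeminorm_neg_le (x : Loc p A) : padicSeminorm p A (-x) ≤ padicSeminorm p A x := by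
  refine le_of_forall_gt fun r hr => ?_
  obtain ⟨c, d, hd, hx, h1⟩ := exists_of_lt hr
  refine (padicSeminorm_le hd (c := c) ?_).trans_lt h1
  unfold HasVal at hx ⊢
  rw [neg_pow, mul_left_comm]
  exact Subring.mul_mem _ (Subring.pow_mem _ (Subring.neg_mem _ (Subring.one_mem _)) _) hx

lemma padicSeminorm_neg (x : Loc p A) : padicSeminorm p A (-x) = padicSeminorm p A x :=
  le_antisymm (padicSeminorm_neg_le x) (by simpa using padicSeminorm_neg_le (-x))

lemma hasVal_of_lt (h : IsPNormal p A) {x : Loc p A} {k : ℕ}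
    (hx : padicSeminorm p A x < ((p : ℝ)⁻¹) ^ k) : HasVal p A k 1 x := by
  obtain ⟨c, d, hd, hv, h1⟩ := exists_of_lt hx
  refine hv.mono h hd ?_
  have hp0 : (0 : ℝ) ≤ p := by linarith [one_lt_p p]
  have e : ((p : ℝ)⁻¹) ^ k = (p : ℝ) ^ (-(k : ℝ)) := by
    rw [Real.rpow_neg hp0, Real.rpow_natCast, inv_pow]
  rw [e, Real.rpow_lt_rpow_left_iff (one_lt_p p), neg_lt_neg_iff,
    lt_div_iff₀ (by exact_mod_cast hd)] at h1
  have : (k : ℤ) * d < c := by exact_mod_cast h1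
  push_cast
  linarith

lemma padicSeminorm_le_of_hasVal {x : Loc p A} {k : ℕ} (hx : HasVal p A k 1 x) :
    padicSeminorm p A x ≤ ((p : ℝ)⁻¹) ^ k := by
  have hp0 : (0 : ℝ) ≤ p := by linarith [one_lt_p p]
  refine (padicSeminorm_le one_pos hx).trans (le_of_eq ?_)
  simp [Real.rpow_neg hp0]

lemma hasVal_algebraMap (h : IsPNormal p A) {a : A} {k : ℕ} :
    HasVal p A k 1 (algebraMap A (Loc p A) a) ↔ a ∈ Ideal.span {(p : A)} ^ k := by
  rw [Ideal.span_singleton_pow, Ideal.mem_span_singleton]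
  unfold HasVal
  rw [pow_one, zpow_neg, zpow_natCast]
  constructor
  · rintro ⟨b, hb⟩
    refine ⟨b, algebraMap_injective h ?_⟩
    rw [map_mul, hb, map_pow, map_natCast, ← pUnit_val, ← Units.val_pow_eq_pow_val,
      Units.mul_inv_cancel_left]
  · rintro ⟨b, rfl⟩
    refine ⟨b, ?_⟩
    rw [map_mul, map_pow, map_natCast, ← pUnit_val, ← Units.val_pow_eq_pow_val,
      Units.inv_mul_cancel_left]

lemma mem_of_lt_one (h : IsPNormal p A) {x : Loc p A} (hx : padicSeminorm p A x < 1) :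
    ∃ a : A, algebraMap A (Loc p A) a = x := by
  have := hasVal_of_lt (k := 0) h (by simpa using hx)
  simpa [HasVal] using this

lemma padicSeminorm_zero : padicSeminorm p A 0 = 0 := by
  have hz : ∀ k : ℕ, padicSeminorm p A 0 ≤ ((p : ℝ)⁻¹) ^ k := fun k =>
    padicSeminorm_le_of_hasVal (by simp [HasVal])
  have hp0 : (0 : ℝ) ≤ (p : ℝ)⁻¹ := inv_nonneg.mpr (by linarith [one_lt_p p])
  exact le_antisymm (ge_of_tendsto' (tendsto_pow_atTop_nhds_zero_of_lt_one hp0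
    (inv_lt_one_of_one_lt₀ (one_lt_p p))) hz) (padicSeminorm_nonneg _)

lemma eq_zero_of_padicSeminorm (h : IsPNormal p A) (hc : IsHausdorff (Ideal.span {(p : A)}) A)
    {x : Loc p A} (hx : padicSeminorm p A x = 0) : x = 0 := by
  have hp0 : (0 : ℝ) < (p : ℝ)⁻¹ := inv_pos.mpr (by linarith [one_lt_p p])
  obtain ⟨a, rfl⟩ := mem_of_lt_one h (x := x) (by rw [hx]; exact one_pos)
  rw [hc.haus a fun n => ?_, map_zero]
  rw [SModEq.zero, smul_eq_mul, Ideal.mul_top, ← hasVal_algebraMap h]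
  exact hasVal_of_lt h (by rw [hx]; positivity)

/-- The `p`-adic seminorm is a norm when `A` is `p`-normal and `p`-adically complete. -/
noncomputable abbrev padicNormedCommRing (p : ℕ) [Fact p.Prime] (A : Type*) [CommRing A]
    [h : IsPNormal p A] [hc : IsAdicComplete (Ideal.span {(p : A)}) A] :
    NormedCommRing (Loc p A) :=
  { RingNorm.toNormedRing (R := Loc p A)
      { toFun := padicSeminorm p A
        map_zero' := padicSeminorm_zero
        add_le' := fun x y => (padicSeminorm_add h x y).trans
          (max_le_add_of_nonneg (padicSeminorm_nonneg x) (padicSeminorm_nonneg y))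
        neg' := padicSeminorm_neg
        mul_le' := padicSeminorm_mul h
        eq_zero_of_map_eq_zero' := fun _ => eq_zero_of_padicSeminorm h hc.toIsHausdorff },
    (inferInstance : CommRing (Loc p A)) with }

lemma padic_complete (p : ℕ) [Fact p.Prime] (A : Type*) [CommRing A]
    [h : IsPNormal p A] [hc : IsAdicComplete (Ideal.span {(p : A)}) A] :
    letI := padicNormedCommRing p A
    CompleteSpace (Loc p A) := by
  letI := padicNormedCommRing p A
  have hnorm : ∀ x : Loc p A, ‖x‖ = padicSeminorm p A x := fun _ => rfl
  have hp0 : (0 : ℝ) < (p : ℝ)⁻¹ := inv_pos.mpr (by linarith [one_lt_p p])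
  refine Metric.complete_of_cauchySeq_tendsto fun f hf => ?_
  rw [Metric.cauchySeq_iff] at hf
  have hf' : ∀ k : ℕ, ∃ N, ∀ m ≥ N, ∀ n ≥ N, padicSeminorm p A (f m - f n) < ((p : ℝ)⁻¹) ^ k :=
    fun k => by
      obtain ⟨N, hN⟩ := hf _ (pow_pos hp0 k)
      refine ⟨N, fun m hm n hn => ?_⟩
      rw [← hnorm, ← dist_eq_norm]
      exact hN m hm n hn
  choose N hN using hf'
  set M : ℕ → ℕ := fun k => ∑ i ∈ Finset.range (k + 1), N i with hM
  have hMN : ∀ k, N k ≤ M k := fun k =>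
    Finset.single_le_sum (f := N) (fun _ _ => Nat.zero_le _) (Finset.self_mem_range_succ k)
  have hMm : Monotone M := fun i j hij =>
    Finset.sum_le_sum_of_subset (Finset.range_mono (Nat.succ_le_succ hij))
  have ha : ∀ n, ∃ a : A, algebraMap A (Loc p A) a = f (M n) - f (M 0) := fun n =>
    mem_of_lt_one h (by
      simpa using hN 0 (M n) ((hMN 0).trans (hMm (Nat.zero_le n))) (M 0) (hMN 0))
  choose a ha using ha
  obtain ⟨L, hL⟩ := hc.toIsPrecomplete.prec' a fun {m n} hmn => by
    rw [SModEq.sub_mem, smul_eq_mul, Ideal.mul_top, ← hasVal_algebraMap h]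
    refine hasVal_of_lt h ?_
    rw [map_sub, ha, ha, sub_sub_sub_cancel_right]
    exact hN m _ (hMN m) _ ((hMN m).trans (hMm hmn))
  refine ⟨f (M 0) + algebraMap A (Loc p A) L, ?_⟩
  rw [Metric.tendsto_atTop]
  intro ε hε
  obtain ⟨k, hk⟩ := exists_pow_lt_of_lt_one hε (inv_lt_one_of_one_lt₀ (one_lt_p p))
  refine ⟨M k, fun n hn => lt_of_le_of_lt ?_ hk⟩
  rw [dist_eq_norm, hnorm]
  have e : f n - (f (M 0) + algebraMap A (Loc p A) L) =
      (f n - f (M k)) + algebraMap A (Loc p A) (a k - L) := by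
    rw [map_sub, ha]
    ring
  rw [e]
  refine (padicSeminorm_add h _ _).trans (max_le ?_ ?_)
  · exact (hN k n ((hMN k).trans hn) (M k) (hMN k)).le
  · refine padicSeminorm_le_of_hasVal ((hasVal_algebraMap h).mpr ?_)
    have := hL k
    rwa [SModEq.sub_mem, smul_eq_mul, Ideal.mul_top] at this

lemma isPAdicNormed (p : ℕ) [hp : Fact p.Prime] (A : Type*) [CommRing A]
    [h : IsPNormal p A] [hc : IsAdicComplete (Ideal.span {(p : A)}) A] :
    letI := padicNormedCommRing p A
    IsPAdicNormed p (Loc p A) := by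
  letI := padicNormedCommRing p A
  refine ⟨padicSeminorm_add h, fun x n hn => padicSeminorm_pow h x hn, ?_, padic_complete p A⟩
  have := padicSeminorm_le_of_hasVal (x := (p : Loc p A)) (k := 1) (A := A) (by
    unfold HasVal
    rw [pow_one, ← pUnit_val, ← Units.val_mul]
    exact ⟨1, by simp⟩)
  rw [pow_one] at this
  exact this

end PAdic

section Witt

variable {p : ℕ} [hp : Fact p.Prime]

open WittVector

/-- The Frobenius of a Witt vector whose entries of index `≤ n` vanish has vanishing entries of
index `< n`. -/
lemma ker_truncate_le_frobenius (n : ℕ) (R : Type*) [CommRing R] :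
    RingHom.ker (truncate (p := p) (n + 1) (R := R)) ≤
      RingHom.ker ((truncate (p := p) n).comp (frobenius (p := p) (R := R))) := by
  intro x hx
  rw [mem_ker_truncate] at hx
  rw [RingHom.mem_ker, RingHom.comp_apply, eq_iterate_verschiebung hx, Function.iterate_succ_apply',
    frobenius_verschiebung, map_mul]
  have : truncate n (verschiebung^[n] (x.shift (n + 1))) = 0 := by
    rw [← RingHom.mem_ker, mem_ker_truncate]
    intro i hi
    exact iterate_verschiebung_coeff_eq_zero _ hi
  rw [this, zero_mul]

lemma ker_truncate_le_map (n : ℕ) {R S : Type*} [CommRing R] [CommRing S] (f : R →+* S) :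
    RingHom.ker (truncate (p := p) n (R := R)) ≤
      RingHom.ker ((truncate (p := p) n).comp (WittVector.map f)) := by
  intro x hx
  rw [mem_ker_truncate] at hx
  rw [RingHom.mem_ker, RingHom.comp_apply, ← RingHom.mem_ker, mem_ker_truncate]
  intro i hi
  rw [map_coeff, hx i hi, map_zero]

/-- The Frobenius `F : W_{p^n}(R) → W_{p^(n-1)}(R)` on truncated Witt vectors, where `W_{p^n}(R)`
consists of the Witt vectors of length `n + 1`. -/
noncomputable def truncFrobenius (p : ℕ) [Fact p.Prime] (n : ℕ) (R : Type*) [CommRing R] :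
    TruncatedWittVector p (n + 1) R →+* TruncatedWittVector p n R :=
  (truncate (n + 1)).liftOfRightInverse TruncatedWittVector.out TruncatedWittVector.truncateFun_out
    ⟨(truncate n).comp frobenius, ker_truncate_le_frobenius n R⟩

lemma truncFrobenius_truncate (n : ℕ) {R : Type*} [CommRing R] (x : WittVector p R) :
    truncFrobenius p n R (truncate (n + 1) x) = truncate n (frobenius x) :=
  RingHom.liftOfRightInverse_comp_apply _ _ _ _ x

/-- Functoriality of truncated Witt vectors. -/
noncomputable def truncMap (p : ℕ) [Fact p.Prime] (n : ℕ) {R S : Type*} [CommRing R] [CommRing S]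
    (f : R →+* S) : TruncatedWittVector p n R →+* TruncatedWittVector p n S :=
  (truncate n).liftOfRightInverse TruncatedWittVector.out TruncatedWittVector.truncateFun_out
    ⟨(truncate n).comp (WittVector.map f), ker_truncate_le_map n f⟩

lemma truncMap_truncate (n : ℕ) {R S : Type*} [CommRing R] [CommRing S] (f : R →+* S)
    (x : WittVector p R) : truncMap p n f (truncate n x) = truncate n (WittVector.map f x) :=
  RingHom.liftOfRightInverse_comp_apply _ _ _ _ x

lemma truncMap_coeff (n : ℕ) {R S : Type*} [CommRing R] [CommRing S] (f : R →+* S)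
    (x : TruncatedWittVector p n R) (i : Fin n) : (truncMap p n f x).coeff i = f (x.coeff i) := by
  obtain ⟨x, rfl⟩ := truncate_surjective p n R x
  rw [truncMap_truncate, coeff_truncate, coeff_truncate, map_coeff]

lemma truncMap_truncFrobenius (n : ℕ) {R S : Type*} [CommRing R] [CommRing S] (f : R →+* S)
    (x : TruncatedWittVector p (n + 1) R) :
    truncFrobenius p n S (truncMap p (n + 1) f x) = truncMap p n f (truncFrobenius p n R x) := by
  obtain ⟨x, rfl⟩ := truncate_surjective p (n + 1) R x
  rw [truncMap_truncate, truncFrobenius_truncate, truncFrobenius_truncate, truncMap_truncate]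
  congr 1
  ext k
  rw [map_coeff, coeff_frobenius, coeff_frobenius, MvPolynomial.map_aeval,
    MvPolynomial.aeval_eq_eval₂Hom]
  congr 2
  exact RingHom.ext_int _ _

/-- A ring `A` is Witt-perfect at `p` if `F : W_{p^(n+1)}(A) → W_{p^n}(A)` is surjective for all
positive integers `n`. -/
def IsWittPerfect (p : ℕ) [Fact p.Prime] (A : Type*) [CommRing A] : Prop :=
  ∀ n : ℕ, 0 < n → Function.Surjective (truncFrobenius p (n + 1) A)

/-- The inverse limit of the rings `W_{p^n}(R)` along the Frobenius maps. -/
def Warrow (p : ℕ) [Fact p.Prime] (R : Type*) [CommRing R] :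
    Subring (∀ n : ℕ, TruncatedWittVector p (n + 1) R) where
  carrier := {x | ∀ n, truncFrobenius p (n + 1) R (x (n + 1)) = x n}
  mul_mem' hx hy n := by rw [Pi.mul_apply, map_mul, hx n, hy n, Pi.mul_apply]
  one_mem' n := by rw [Pi.one_apply, map_one, Pi.one_apply]
  add_mem' hx hy n := by rw [Pi.add_apply, map_add, hx n, hy n, Pi.add_apply]
  zero_mem' n := by rw [Pi.zero_apply, map_zero, Pi.zero_apply]
  neg_mem' hx n := by rw [Pi.neg_apply, map_neg, hx n, Pi.neg_apply]

/-- Functoriality of the inverse limit of Witt vectors along Frobenius. -/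
noncomputable def Warrow.map (p : ℕ) [Fact p.Prime] {R S : Type*} [CommRing R] [CommRing S]
    (f : R →+* S) : Warrow p R →+* Warrow p S where
  toFun x := ⟨fun n => truncMap p (n + 1) f (x.1 n), fun n => by
    rw [truncMap_truncFrobenius, x.2 n]⟩
  map_one' := Subtype.ext (funext fun n => map_one (truncMap p (n + 1) f))
  map_mul' x y := Subtype.ext (funext fun n => map_mul (truncMap p (n + 1) f) (x.1 n) (y.1 n))
  map_zero' := Subtype.ext (funext fun n => map_zero (truncMap p (n + 1) f))
  map_add' x y := Subtype.ext (funext fun n => map_add (truncMap p (n + 1) f) (x.1 n) (y.1 n))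

/-- For a seminorm `ν` on `R`, the function
`|x|_W = sup_i ν(x_{p^i}) ^ (1 / p ^ i)` on Witt vectors of finite length. -/
noncomputable def wittSup {n : ℕ} {R : Type*} (ν : R → ℝ) (x : TruncatedWittVector p n R) : ℝ :=
  ⨆ i : Fin n, ν (x.coeff i) ^ (1 / (p : ℝ) ^ (i : ℕ))

/-- The quantity `p ^ (-bn) * |x_{p^(-n)}|_W ^ (p ^ n)`. -/
noncomputable def levelNorm {R : Type*} [CommRing R] (ν : R → ℝ) (b : ℝ) (x : Warrow p R) (n : ℕ) :
    ℝ :=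
  (p : ℝ) ^ (-(b * n)) * wittSup ν (x.1 n) ^ p ^ n

/-- The set of overconvergent elements of radius `b`. -/
def overconvergent {R : Type*} [CommRing R] (ν : R → ℝ) (b : ℝ) : Set (Warrow p R) :=
  {x | Tendsto (levelNorm ν b x) atTop (𝓝 0)}

/-- The norm `|x|_{W,b} = sup_n p ^ (-bn) * |x_{p^(-n)}|_W ^ (p ^ n)`. -/
noncomputable def overconvergentNorm {R : Type*} [CommRing R] (ν : R → ℝ) (b : ℝ)
    (x : Warrow p R) : ℝ :=
  ⨆ n, levelNorm ν b x n

end Witt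

section Tilt

variable (p : ℕ) [hp : Fact p.Prime] (A : Type*) [CommRing A]

/-- The inverse limit of `A/p` under the `p`-power Frobenius endomorphism. -/
def IntegralTilt : Subring (ℕ → A ⧸ Ideal.span {(p : A)}) where
  carrier := {x | ∀ n, x (n + 1) ^ p = x n}
  mul_mem' hx hy n := by rw [Pi.mul_apply, mul_pow, hx n, hy n, Pi.mul_apply]
  one_mem' n := one_pow p
  add_mem' {x y} hx hy n := by
    have h0 : (p : A ⧸ Ideal.span {(p : A)}) = 0 := by
      rw [← map_natCast (Ideal.Quotient.mk (Ideal.span {(p : A)})), Ideal.Quotient.eq_zero_iff_mem]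
      exact Ideal.mem_span_singleton_self _
    rw [Pi.add_apply, add_pow_prime_eq' hp.out, hx n, hy n, h0, zero_mul, add_zero, Pi.add_apply]
  zero_mem' n := zero_pow hp.out.ne_zero
  neg_mem' {x} hx n := by
    have h0 : (p : A ⧸ Ideal.span {(p : A)}) = 0 := by
      rw [← map_natCast (Ideal.Quotient.mk (Ideal.span {(p : A)})), Ideal.Quotient.eq_zero_iff_mem]
      exact Ideal.mem_span_singleton_self _
    have h1 := add_pow_prime_eq' hp.out (-x (n + 1)) (x (n + 1))
    rw [neg_add_cancel, zero_pow hp.out.ne_zero, hx n, h0, zero_mul, add_zero] at h1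
    exact eq_neg_of_add_eq_zero_left h1.symm

/-- The projection from the inverse limit of `A/p` under Frobenius onto its last term `A/p`. -/
def IntegralTilt.proj : IntegralTilt p A →+* A ⧸ Ideal.span {(p : A)} :=
  (Pi.evalRingHom (fun _ : ℕ => A ⧸ Ideal.span {(p : A)}) 0).comp (IntegralTilt p A).subtype

variable [IsPNormal p A] [IsAdicComplete (Ideal.span {(p : A)}) A]

/-- The inverse limit of `A[1/p]` under the `p`-power map. -/
abbrev Tilt : Type _ := PowSeq p (Loc p A)

/-- The ring structure on the inverse limit of `A[1/p]` under the `p`-power map, with limits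
taken for the `p`-adic norm. -/
noncomputable instance Tilt.instCommRing : CommRing (Tilt p A) :=
  letI := padicNormedCommRing p A
  haveI := isPAdicNormed p A
  PowSeq.instCommRing (p := p) (R := Loc p A)

/-- The seminorm `|x| = |x_1|` on the tilt, where `x_1` is the entry of index `0`. -/
noncomputable def tiltSeminorm {p : ℕ} [Fact p.Prime] {A : Type*} [CommRing A] (x : Tilt p A) : ℝ :=
  padicSeminorm p A (x.coeff 0)

/-- Addition in the tilt is given by the limit formula. -/
lemma Tilt.tendsto_add (x y : Tilt p A) (m : ℕ) :
    Tendsto (fun l : ℕ => padicSeminorm p A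
      ((x.coeff (m + l) + y.coeff (m + l)) ^ p ^ l - (x + y).coeff m)) atTop (𝓝 0) := by
  letI := padicNormedCommRing p A
  have h := PowSeq.tendsto_addSeq (isPAdicNormed p A) x y m
  exact tendsto_iff_norm_sub_tendsto_zero.mp h

lemma Tilt.mul_coeff (x y : Tilt p A) (m : ℕ) : (x * y).coeff m = x.coeff m * y.coeff m := rfl

lemma Tilt.one_coeff (m : ℕ) : (1 : Tilt p A).coeff m = 1 := rfl

lemma Tilt.zero_coeff (m : ℕ) : (0 : Tilt p A).coeff m = 0 := rfl

end Tilt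

end OverconvergentWitt

open OverconvergentWitt

/-!
Write `R = A[1/p]` and let `R'` be its tilt, a perfect ring of characteristic `p`. Since `p` is
invertible in `R`, an element of the inverse limit of Witt vectors over `R` is the same as the
sequence of leading components of its terms (`Warrow.ghostEquiv`). Since Frobenius is bijective on
`R'`, an element over `R'` is the same as a sequence of digits `c_i` in `R'`, standing for
`∑ p ^ i [c_i]` (`Warrow.ext_digit`, `Warrow.ofDigits`), and overconvergence of radius `b` means that
`p ^ (-b i) * |c_i| → 0` (`mem_overconvergent_iff_digitsVanish`).

The comparison map `Warrow.untiltHom` takes the element with digits `c_i` to the one with leading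
components `∑ p ^ i (c_i)_m`. It is a ring homomorphism as soon as these series converge:

* The Witt vector addition polynomials are homogeneous if the component of index `p ^ i` has weight
  `p ^ i` (`isWeightedHomogeneous_wittAdd`). Applied to the graded ring `PowSeq.approx` of pairs
  whose entries agree modulo `p`, this shows that leading entries of Witt vector components are
  additive modulo `p`, relative to the size of the digits. Congruences modulo `p` between components
  become congruences modulo high powers of `p` between ghost components, which gives additivity in
  the limit (`Warrow.untilt_add`). The same homogeneity bounds the digits of a sum, and so the
  overconvergent elements form a subring.
* Multiplicativity follows from `x = [c_0] + p x'` by iteration (`Warrow.untilt_mul`), and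
  injectivity holds because multiplication by `p` shrinks norms too much for an element
  of the kernel to have a nonzero leading digit (`Warrow.untiltHom_injective`).

For `b ≤ 1` the map is isometric onto the overconvergent elements over `R`. It does not increase
norms, because it does not do so on the terms `p ^ i [c_i]` (`Warrow.level_untiltHom_le`).
Conversely, if `y` is overconvergent, then the powers `y_{n, i} ^ (p ^ l)` of the components of index
`p ^ i` converge because Frobenius is the `p`-power map modulo `p`, and the limits are digits of a
preimage of no larger norm (`Warrow.exists_digits`, `Warrow.untilt_eq_entry`,
`Warrow.digitNorm_le_of_level_le`).

Finally, `A'` embeds into `R'` by lifting compatible sequences along `A → A/p`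
(`IsIntegralModel.tiltHom`). The comparison map and its inverse are given by limits, and `A` is closed
in `R`, so they exchange the elements with components in `A'` and in `A`
(`IsIntegralModel.range_integralUntilt`).
-/

namespace OverconvergentWitt

set_option linter.unusedSectionVars false

open WittVector MvPolynomial

/-! ### Homogeneity of the Witt vector addition polynomials -/

section Homogeneity

variable {p : ℕ}

lemma isWeightedHomogeneous_rename_wittPolynomial {idx : Type*} (b : idx) (n : ℕ) :
    IsWeightedHomogeneous (fun v : idx × ℕ => p ^ v.2)
      (rename (fun i => (b, i)) (wittPolynomial p ℚ n)) (p ^ n) := by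
  rw [wittPolynomial_eq_sum_C_mul_X_pow, map_sum]
  refine IsWeightedHomogeneous.sum _ _ _ fun i hi => ?_
  simp only [map_mul, map_pow, rename_C, rename_X]
  have h := ((isWeightedHomogeneous_X ℚ (fun v : idx × ℕ => p ^ v.2) (b, i)).pow
    (p ^ (n - i))).C_mul ((p : ℚ) ^ i)
  have e : p ^ (n - i) • p ^ i = p ^ n := by
    rw [smul_eq_mul, ← pow_add, Nat.sub_add_cancel (by simpa [Nat.lt_succ_iff] using hi)]
  rwa [e, map_pow] at h

variable [hp : Fact p.Prime]

/-- Give the `i`-th component of each Witt vector the weight `p ^ i`. An operation which is linear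
on ghost components is described by polynomials which are homogeneous for these weights. -/
lemma isWeightedHomogeneous_wittStructureInt {idx : Type*} (Φ : MvPolynomial idx ℤ)
    (hΦ : ∀ n, IsWeightedHomogeneous (fun v : idx × ℕ => p ^ v.2)
      (bind₁ (fun b => rename (fun i => (b, i)) (wittPolynomial p ℚ n))
        (MvPolynomial.map (Int.castRingHom ℚ) Φ)) (p ^ n)) (n : ℕ) :
    IsWeightedHomogeneous (fun v : idx × ℕ => p ^ v.2) (wittStructureInt p Φ n) (p ^ n) := by
  have hrat : IsWeightedHomogeneous (fun v : idx × ℕ => p ^ v.2)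
      (wittStructureRat p (MvPolynomial.map (Int.castRingHom ℚ) Φ) n) (p ^ n) := by
    induction n using Nat.strong_induction_on with
    | _ n ih =>
      rw [wittStructureRat_rec]
      refine ((hΦ n).sub (IsWeightedHomogeneous.sum _ _ _ fun i hi => ?_)).C_mul _
      rw [Finset.mem_range] at hi
      have h := ((ih i hi).pow (p ^ (n - i))).C_mul ((p : ℚ) ^ i)
      rwa [smul_eq_mul, ← pow_add, Nat.sub_add_cancel hi.le] at h
  intro m hm
  refine hrat ?_
  rw [← map_wittStructureInt, coeff_map]
  simpa using hm

lemma isWeightedHomogeneous_wittAdd (n : ℕ) :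
    IsWeightedHomogeneous (fun v : Fin 2 × ℕ => p ^ v.2) (wittAdd p n) (p ^ n) := by
  refine isWeightedHomogeneous_wittStructureInt _ (fun n => ?_) n
  simp only [map_add, map_X, bind₁_X_right]
  exact (isWeightedHomogeneous_rename_wittPolynomial 0 n).add
    (isWeightedHomogeneous_rename_wittPolynomial 1 n)

lemma isWeightedHomogeneous_wittNeg (n : ℕ) :
    IsWeightedHomogeneous (fun v : Fin 1 × ℕ => p ^ v.2) (wittNeg p n) (p ^ n) := by
  refine isWeightedHomogeneous_wittStructureInt _ (fun n => ?_) n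
  simp only [map_neg, map_X, bind₁_X_right]
  exact (isWeightedHomogeneous_rename_wittPolynomial 0 n).neg

variable {S : Type*} [CommRing S] (G : ℕ → AddSubgroup S) [SetLike.GradedMonoid G]

/-- A weighted homogeneous polynomial of degree `d` maps elements of a graded family `G`, each of
degree equal to its weight, to an element of `G d`. -/
lemma aeval_mem_of_isWeightedHomogeneous {σ : Type*} {w : σ → ℕ} {P : MvPolynomial σ ℤ} {d : ℕ}
    (hP : IsWeightedHomogeneous w P d) {f : σ → S} (hf : ∀ v ∈ P.vars, f v ∈ G (w v)) :
    aeval f P ∈ G d := by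
  rw [aeval_def, eval₂_eq]
  refine sum_mem fun m hm => ?_
  rw [algebraMap_int_eq, eq_intCast, ← zsmul_eq_mul]
  refine zsmul_mem ?_ _
  have h := SetLike.prod_pow_mem_graded (F := m.support) G w f m fun v hv =>
    hf v ((mem_vars_iff_mem_support v).mpr ⟨m, hm, hv⟩)
  have e : ∑ v ∈ m.support, m v • w v = d := by
    rw [← hP (mem_support_iff.mp hm), Finsupp.weight_apply, Finsupp.sum]
  rwa [e] at h

lemma coeff_add_mem {x y : WittVector p S} {n : ℕ} (hx : ∀ i ≤ n, x.coeff i ∈ G (p ^ i))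
    (hy : ∀ i ≤ n, y.coeff i ∈ G (p ^ i)) : (x + y).coeff n ∈ G (p ^ n) := by
  rw [WittVector.add_coeff]
  refine aeval_mem_of_isWeightedHomogeneous G (isWeightedHomogeneous_wittAdd n) fun v hv => ?_
  have hv' := wittAdd_vars p n hv
  simp only [Finset.mem_product, Finset.mem_univ, Finset.mem_range, true_and,
    Nat.lt_succ_iff] at hv'
  obtain ⟨b, i⟩ := v
  fin_cases b
  · exact hx i hv'
  · exact hy i hv'

lemma coeff_neg_mem {x : WittVector p S} {n : ℕ} (hx : ∀ i ≤ n, x.coeff i ∈ G (p ^ i)) :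
    (-x).coeff n ∈ G (p ^ n) := by
  rw [WittVector.neg_coeff]
  refine aeval_mem_of_isWeightedHomogeneous G (isWeightedHomogeneous_wittNeg n) fun v hv => ?_
  have hv' := wittNeg_vars p n hv
  simp only [Finset.mem_product, Finset.mem_univ, Finset.mem_range, true_and,
    Nat.lt_succ_iff] at hv'
  obtain ⟨b, i⟩ := v
  fin_cases b
  exact hx i hv'

end Homogeneity

/-! ### Components and ghost components in the inverse limit along Frobenius -/

namespace Warrow

section CommRing

variable {p : ℕ} [hp : Fact p.Prime] {R S : Type*} [CommRing R] [CommRing S]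

/-- The component `x_{n, i}` of index `p ^ i` of the term `x_{p^(-n)}` of `x`; it is zero for
`i > n`. -/
noncomputable def entry (x : Warrow p R) (n i : ℕ) : R := (x.1 n).out.coeff i

lemma truncate_out (x : Warrow p R) (n : ℕ) : truncate (n + 1) (x.1 n).out = x.1 n :=
  TruncatedWittVector.truncateFun_out _

lemma entry_eq_coeff (x : Warrow p R) {n i : ℕ} (hi : i ≤ n) :
    entry x n i = (x.1 n).coeff ⟨i, Nat.lt_succ_of_le hi⟩ :=
  TruncatedWittVector.coeff_out _ ⟨i, Nat.lt_succ_of_le hi⟩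

lemma entry_of_truncate {x : Warrow p R} {n i : ℕ} {z : WittVector p R}
    (h : truncate (n + 1) z = x.1 n) (hi : i ≤ n) : entry x n i = z.coeff i := by
  rw [entry_eq_coeff x hi, ← h, coeff_truncate]

lemma ext_entry {x y : Warrow p R} (h : ∀ n, ∀ i ≤ n, entry x n i = entry y n i) : x = y := by
  refine Subtype.ext (funext fun n => TruncatedWittVector.ext fun i => ?_)
  have := h n i (Nat.lt_succ_iff.mp i.2)
  rwa [entry_eq_coeff _ (Nat.lt_succ_iff.mp i.2), entry_eq_coeff _ (Nat.lt_succ_iff.mp i.2)] at this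

lemma entry_map (f : R →+* S) (x : Warrow p R) {n i : ℕ} (hi : i ≤ n) :
    entry (Warrow.map p f x) n i = f (entry x n i) := by
  rw [entry_eq_coeff _ hi, entry_eq_coeff _ hi]
  exact truncMap_coeff _ _ _ _

lemma truncate_frobenius_out (x : Warrow p R) (n : ℕ) :
    truncate (n + 1) (frobenius (x.1 (n + 1)).out) = x.1 n := by
  rw [← truncFrobenius_truncate, truncate_out, x.2]

/-- The Frobenius is the `p`-power map on components modulo `p`. -/
lemma entry_frobenius (x : Warrow p R) {n i : ℕ} (hi : i ≤ n) :
    ∃ c, entry x n i = entry x (n + 1) i ^ p + p * c := by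
  rw [entry_of_truncate (truncate_frobenius_out x n) hi, coeff_frobenius, frobeniusPoly]
  exact ⟨_, by simp [entry]; rfl⟩

lemma entry_zero_of_truncate (x : Warrow p R) (n j : ℕ) {z : WittVector p R}
    (hz : truncate (n + j + 1) z = x.1 (n + j)) : entry x n 0 = ghostComponent j z := by
  induction j generalizing z with
  | zero =>
    rw [entry_of_truncate hz (Nat.zero_le _), ghostComponent_apply, aeval_wittPolynomial]
    simp
  | succ j ih =>
    rw [← ghostComponent_frobenius]
    refine ih ?_
    rw [← truncFrobenius_truncate]
    exact (congrArg (truncFrobenius p (n + j + 1) R) hz).trans (x.2 (n + j))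

/-- The ghost components of `x_{p^(-n)}` are the leading components of the terms
`x_{p^(-n)}, ..., x_1`. -/
lemma entry_zero_eq_sum (x : Warrow p R) (n j : ℕ) :
    entry x n 0 = ∑ i ∈ Finset.range (j + 1), (p : R) ^ i * entry x (n + j) i ^ p ^ (j - i) := by
  rw [entry_zero_of_truncate x n j (truncate_out x (n + j)), ghostComponent_apply,
    aeval_wittPolynomial]
  rfl

lemma entry_add (x y : Warrow p R) {n i : ℕ} (hi : i ≤ n) :
    entry (x + y) n i = ((x.1 n).out + (y.1 n).out).coeff i :=
  entry_of_truncate (by rw [map_add, truncate_out, truncate_out]; rfl) hi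

lemma entry_neg (x : Warrow p R) {n i : ℕ} (hi : i ≤ n) :
    entry (-x) n i = (-(x.1 n).out).coeff i :=
  entry_of_truncate (by rw [map_neg, truncate_out]; rfl) hi

lemma entry_mul (x y : Warrow p R) {n i : ℕ} (hi : i ≤ n) :
    entry (x * y) n i = ((x.1 n).out * (y.1 n).out).coeff i :=
  entry_of_truncate (by rw [map_mul, truncate_out, truncate_out]; rfl) hi

lemma entry_zero (n : ℕ) {i : ℕ} (hi : i ≤ n) : entry (0 : Warrow p R) n i = 0 := by
  rw [entry_of_truncate (z := 0) (by rw [map_zero]; rfl) hi, WittVector.zero_coeff]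

lemma entry_one_zero (n : ℕ) : entry (1 : Warrow p R) n 0 = 1 := by
  rw [entry_of_truncate (z := 1) (by rw [map_one]; rfl) (Nat.zero_le n), WittVector.one_coeff_zero]

/-- The ring homomorphism taking `x` to the sequence of leading components of its terms. -/
noncomputable def ghost : Warrow p R →+* (ℕ → R) where
  toFun x m := entry x m 0
  map_zero' := funext fun m => entry_zero m (Nat.zero_le m)
  map_one' := funext fun m => entry_one_zero m
  map_add' x y := funext fun m => by
    rw [entry_add _ _ (Nat.zero_le m), WittVector.add_coeff_zero]; rfl
  map_mul' x y := funext fun m => by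
    rw [entry_mul _ _ (Nat.zero_le m), WittVector.mul_coeff_zero]; rfl

lemma ghost_apply (x : Warrow p R) (m : ℕ) : ghost x m = entry x m 0 := rfl

/-- If `p` is invertible, the ghost components of a term determine its components, and these ghost
components are among the leading components of all terms. -/
lemma ghost_injective (hpR : IsUnit (p : R)) : Function.Injective (ghost (p := p) (R := R)) := by
  intro x y h
  refine ext_entry fun n i => ?_
  induction i using Nat.strong_induction_on with
  | _ i ih =>
    intro hi
    have h1 := congrFun h (n - i)
    rw [ghost_apply, ghost_apply, entry_zero_eq_sum _ _ i, entry_zero_eq_sum _ _ i,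
      Nat.sub_add_cancel hi, Finset.sum_range_succ, Finset.sum_range_succ,
      Finset.sum_congr rfl fun j hj => by
        rw [ih j (Finset.mem_range.mp hj) ((Finset.mem_range.mp hj).le.trans hi)],
      add_right_inj, Nat.sub_self, pow_zero, pow_one, pow_one] at h1
    exact (hpR.pow i).mul_left_cancel h1

/-- If `p` is invertible, every sequence arises from the inverse limit along Frobenius: the `n`-th
term has ghost components `g_n, g_{n-1}, ..., g_0`. -/
lemma ghost_surjective (hpR : IsUnit (p : R)) : Function.Surjective (ghost (p := p) (R := R)) := by
  intro g
  have : Invertible (p : R) := hpR.invertible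
  have hb := ghostMap.bijective_of_invertible p R
  choose z hz using fun n : ℕ => hb.2 (fun j => g (n - j))
  have hF : ∀ n, frobenius (z (n + 1)) = z n := fun n => by
    refine hb.1 (funext fun j => ?_)
    rw [ghostMap_apply, ghostComponent_frobenius, ← ghostMap_apply, hz, hz]
    exact congrArg g (by omega)
  refine ⟨⟨fun n => truncate (n + 1) (z n), fun n => ?_⟩, funext fun m => ?_⟩
  · rw [truncFrobenius_truncate, hF]
  · rw [ghost_apply, entry_of_truncate (z := z m) rfl (Nat.zero_le m)]
    have := congrFun (hz m) 0
    rw [ghostMap_apply, ghostComponent_apply, aeval_wittPolynomial] at this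
    simpa using this

/-- If `p` is invertible, the inverse limit along Frobenius is the ring of all sequences. -/
noncomputable def ghostEquiv (hpR : IsUnit (p : R)) : Warrow p R ≃+* (ℕ → R) :=
  RingEquiv.ofBijective ghost ⟨ghost_injective hpR, ghost_surjective hpR⟩

lemma map_injective {f : R →+* S} (hf : Function.Injective f) :
    Function.Injective (Warrow.map p f) := by
  intro x y h
  refine ext_entry fun n i hi => hf ?_
  rw [← entry_map f x hi, ← entry_map f y hi, h]

/-- For an injective homomorphism `R → S`, an element over `S` comes from `R` as soon as its
components do. -/
lemma mem_range_map {f : R →+* S} (hf : Function.Injective f) {y : Warrow p S}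
    (hy : ∀ n, ∀ i ≤ n, entry y n i ∈ f.range) : y ∈ (Warrow.map p f).range := by
  choose r hr using hy
  have key : ∀ n, truncMap p (n + 1) f
      (TruncatedWittVector.mk p fun i => r n i (Nat.lt_succ_iff.mp i.2)) = y.1 n := fun n => by
    ext i
    rw [truncMap_coeff, TruncatedWittVector.coeff_mk, hr,
      entry_eq_coeff _ (Nat.lt_succ_iff.mp i.2)]
  have hinj : ∀ n, Function.Injective (truncMap p n f) := fun n x y h => by
    ext i
    refine hf ?_
    rw [← truncMap_coeff, ← truncMap_coeff, h]
  refine ⟨⟨fun n => TruncatedWittVector.mk p fun i => r n i (Nat.lt_succ_iff.mp i.2),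
    fun n => hinj _ ?_⟩, Subtype.ext (funext key)⟩
  rw [← truncMap_truncFrobenius, key, key, y.2]

end CommRing

end Warrow

/-! ### Norm estimates in a `p`-adic Banach ring in which `p` is invertible -/

/-- A power-multiplicative nonarchimedean Banach ring in which `p` is invertible and multiplication
by `p` scales the norm by `p⁻¹`. -/
class IsPAdicBanach (p : ℕ) (R : Type*) [NormedCommRing R] : Prop extends IsPAdicNormed p R where
  isUnit_p : IsUnit (p : R)
  norm_p_mul : ∀ r : R, ‖(p : R) * r‖ = (p : ℝ)⁻¹ * ‖r‖

lemma tendsto_zero_of_pow_le {a b : ℕ → ℝ} (k : ℕ) (ha : ∀ n, 0 ≤ a n) (hab : ∀ n, a n ^ k ≤ b n)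
    (hb : Tendsto b atTop (𝓝 0)) : Tendsto a atTop (𝓝 0) := by
  rw [Metric.tendsto_atTop] at hb ⊢
  intro ε hε
  obtain ⟨N, hN⟩ := hb (ε ^ k) (pow_pos hε k)
  refine ⟨N, fun n hn => ?_⟩
  have h1 := hN n hn
  rw [Real.dist_0_eq_abs] at h1 ⊢
  rw [abs_of_nonneg (ha n)]
  exact lt_of_pow_lt_pow_left₀ k hε.le (((hab n).trans (le_abs_self _)).trans_lt h1)

lemma exists_nonneg_pow_eq {k : ℕ} (hk : k ≠ 0) {B : ℝ} (hB : 0 ≤ B) : ∃ K, 0 ≤ K ∧ K ^ k = B :=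
  ⟨B ^ (k : ℝ)⁻¹, Real.rpow_nonneg hB _, Real.rpow_inv_natCast_pow hB hk⟩

/-- Bounds on `p ^ n`-th powers as bounds relative to a `p ^ n`-th root. -/
lemma pow_le_root_iff {p : ℕ} [hp : Fact p.Prime] {K a : ℝ} (hK : 0 ≤ K) (ha : 0 ≤ a) {i n : ℕ}
    (hi : i ≤ n) : a ^ p ^ (n - i) ≤ K ^ p ^ n ↔ a ≤ K ^ p ^ i := by
  have e : K ^ p ^ n = (K ^ p ^ i) ^ p ^ (n - i) := by
    rw [← pow_mul, ← pow_add, Nat.add_sub_cancel' hi]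
  rw [e]
  exact pow_le_pow_iff_left₀ ha (pow_nonneg hK _) (pow_ne_zero _ hp.out.ne_zero)

section Norm

variable {p : ℕ} [hp : Fact p.Prime] {R : Type*} [NormedCommRing R]

namespace IsPAdicNormed

lemma norm_one_le (h : IsPAdicNormed p R) : ‖(1 : R)‖ ≤ 1 := by
  have h1 := h.pow 1 2 two_pos
  rw [one_pow] at h1
  nlinarith [norm_nonneg (1 : R)]

lemma norm_sub_le_max (h : IsPAdicNormed p R) (x y : R) : ‖x - y‖ ≤ max ‖x‖ ‖y‖ := by
  rw [sub_eq_add_neg, ← norm_neg y]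
  exact h.ultra _ _

lemma norm_sub_le_of_le (h : IsPAdicNormed p R) {f : ℕ → R} {N : ℕ} {C : ℝ} (hC : 0 ≤ C)
    (hf : ∀ l, N ≤ l → ‖f (l + 1) - f l‖ ≤ C) {l : ℕ} (hl : N ≤ l) : ‖f l - f N‖ ≤ C := by
  induction l, hl using Nat.le_induction with
  | base => simpa
  | succ l hl ih =>
    rw [← sub_add_sub_cancel _ (f l)]
    exact (h.ultra _ _).trans (max_le (hf l hl) ih)

/-- A sequence converges as soon as its successive differences tend to zero. -/
lemma exists_tendsto (h : IsPAdicNormed p R) {f : ℕ → R}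
    (hf : Tendsto (fun l => ‖f (l + 1) - f l‖) atTop (𝓝 0)) : ∃ L, Tendsto f atTop (𝓝 L) := by
  have := h.complete
  refine cauchySeq_tendsto_of_complete (Metric.cauchySeq_iff'.mpr fun ε hε => ?_)
  obtain ⟨N, hN⟩ := eventually_atTop.mp (hf.eventually (gt_mem_nhds (half_pos hε)))
  refine ⟨N, fun n hn => ?_⟩
  rw [dist_eq_norm]
  exact (h.norm_sub_le_of_le (half_pos hε).le (fun l hl => (hN l hl).le) hn).trans_lt
    (half_lt_self hε)

/-- In a nonarchimedean ring the total difference is bounded by any bound on the successive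
differences. -/
lemma norm_limit_sub_le (h : IsPAdicNormed p R) {f : ℕ → R} {L : R} (hL : Tendsto f atTop (𝓝 L))
    {N : ℕ} {C : ℝ} (hC : 0 ≤ C) (hf : ∀ l, N ≤ l → ‖f (l + 1) - f l‖ ≤ C) : ‖L - f N‖ ≤ C :=
  le_of_tendsto (hL.sub_const (f N)).norm
    (eventually_atTop.mpr ⟨N, fun _ hl => h.norm_sub_le_of_le hC hf hl⟩)

/-- The balls of radius `K ^ d`. -/
def ball (h : IsPAdicNormed p R) {K : ℝ} (hK : 0 ≤ K) (d : ℕ) : AddSubgroup R where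
  carrier := {r | ‖r‖ ≤ K ^ d}
  add_mem' hx hy := (h.ultra _ _).trans (max_le hx hy)
  zero_mem' := by simpa using pow_nonneg hK d
  neg_mem' hx := by simpa using hx

instance ball_graded (h : IsPAdicNormed p R) {K : ℝ} (hK : 0 ≤ K) :
    SetLike.GradedMonoid (h.ball hK) where
  one_mem := by simpa [ball] using h.norm_one_le
  mul_mem i j x y hx hy := by
    refine (norm_mul_le _ _).trans ?_
    rw [pow_add]
    exact mul_le_mul hx hy (norm_nonneg _) (pow_nonneg hK _)

end IsPAdicNormed

namespace IsPAdicBanach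

lemma norm_p_pow_mul (h : IsPAdicBanach p R) (i : ℕ) (r : R) :
    ‖(p : R) ^ i * r‖ = ((p : ℝ)⁻¹) ^ i * ‖r‖ := by
  induction i with
  | zero => simp
  | succ i ih => rw [pow_succ', pow_succ', mul_assoc, mul_assoc, h.norm_p_mul, ih]

lemma norm_le_of_p_pow_mul (h : IsPAdicBanach p R) {i : ℕ} {r : R} {C : ℝ}
    (hr : ‖(p : R) ^ i * r‖ ≤ ((p : ℝ)⁻¹) ^ i * C) : ‖r‖ ≤ C := by
  rw [h.norm_p_pow_mul] at hr
  exact le_of_mul_le_mul_left hr (pow_pos (PowSeq.inv_p_pos p) i)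

/-- Witt vectors whose components are congruent modulo `p` have ghost components of index `j`
congruent modulo `p ^ (j + 1)`; here congruences are relative to a weighted bound. -/
lemma norm_ghost_sub_le (h : IsPAdicBanach p R) {u v : ℕ → R} {K : ℝ} (hK : 0 ≤ K) {j m : ℕ}
    (hmj : m ≤ j + 1) (hv : ∀ i < m, ‖v i‖ ≤ K ^ p ^ i)
    (huv : ∀ i < m, ‖u i - v i‖ ≤ (p : ℝ)⁻¹ * K ^ p ^ i) :
    ‖∑ i ∈ Finset.range m, (p : R) ^ i * u i ^ p ^ (j - i) -
      ∑ i ∈ Finset.range m, (p : R) ^ i * v i ^ p ^ (j - i)‖ ≤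
      ((p : ℝ)⁻¹) ^ (j + 1) * K ^ p ^ j := by
  have h0 := PowSeq.inv_p_pos p
  rw [← Finset.sum_sub_distrib]
  refine PowSeq.norm_sum_le h.toIsPAdicNormed _ _ (by positivity) fun i hi => ?_
  rw [Finset.mem_range] at hi
  have h1 := PowSeq.norm_pow_pow_sub_le h.toIsPAdicNormed (hv i hi) (huv i hi) (j - i)
  rw [← mul_sub, h.norm_p_pow_mul]
  refine (mul_le_mul_of_nonneg_left h1 (by positivity)).trans (le_of_eq ?_)
  rw [← mul_assoc, ← pow_add, ← pow_mul, ← pow_add, show i + (j - i + 1) = j + 1 by omega,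
    show i + (j - i) = j by omega]

open Warrow in
/-- The Witt vector Frobenius is congruent to the `p`-power map modulo `p`, relative to a weighted
bound on the components. -/
lemma norm_entry_sub_pow_le (h : IsPAdicBanach p R) (y : Warrow p R) {n : ℕ} {K : ℝ} (hK : 0 ≤ K)
    (hy : ∀ i ≤ n + 1, ‖entry y (n + 1) i‖ ≤ K ^ p ^ i) {i : ℕ} (hi : i ≤ n) :
    ‖entry y n i - entry y (n + 1) i ^ p‖ ≤ (p : ℝ)⁻¹ * K ^ p ^ (i + 1) := by
  have h0 := PowSeq.inv_p_pos p
  induction i using Nat.strong_induction_on with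
  | _ i ih =>
    -- Both expressions for the leading component of the term of index `n - i` are compared.
    have e1 := entry_zero_eq_sum y (n - i) i
    have e2 := entry_zero_eq_sum y (n - i) (i + 1)
    rw [Nat.sub_add_cancel hi, Finset.sum_range_succ, Nat.sub_self, pow_zero, pow_one] at e1
    rw [← add_assoc, Nat.sub_add_cancel hi, Finset.sum_range_succ, Finset.sum_range_succ,
      Nat.sub_self, pow_zero, pow_one, Nat.add_sub_cancel_left, pow_one] at e2
    have key := h.norm_ghost_sub_le (u := fun k => entry y n k)
      (v := fun k => entry y (n + 1) k ^ p) (K := K ^ p) (j := i) (m := i) (pow_nonneg hK _)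
      (Nat.le_succ i)
      (fun k hk => by
        rw [h.pow _ _ hp.out.pos, pow_right_comm]
        exact pow_le_pow_left₀ (norm_nonneg _) (hy k (by omega)) _)
      (fun k hk => by
        rw [← pow_mul, ← pow_succ']
        exact ih k hk (by omega))
    have e3 : ∑ k ∈ Finset.range i, (p : R) ^ k * (entry y (n + 1) k ^ p) ^ p ^ (i - k) =
        ∑ k ∈ Finset.range i, (p : R) ^ k * entry y (n + 1) k ^ p ^ (i + 1 - k) := by
      refine Finset.sum_congr rfl fun k hk => ?_
      rw [Finset.mem_range] at hk
      rw [← pow_mul, ← pow_succ', Nat.sub_add_comm hk.le]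
    rw [e3] at key
    refine h.norm_le_of_p_pow_mul (i := i) ?_
    have e4 : (p : R) ^ i * (entry y n i - entry y (n + 1) i ^ p) =
        (p : R) ^ (i + 1) * entry y (n + 1) (i + 1) -
        (∑ k ∈ Finset.range i, (p : R) ^ k * entry y n k ^ p ^ (i - k) -
          ∑ k ∈ Finset.range i, (p : R) ^ k * entry y (n + 1) k ^ p ^ (i + 1 - k)) := by
      linear_combination e2 - e1
    rw [e4, ← mul_assoc, ← pow_succ]
    refine (h.norm_sub_le_max _ _).trans (max_le ?_ ?_)
    · rw [h.norm_p_pow_mul]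
      exact mul_le_mul_of_nonneg_left (hy _ (by omega)) (by positivity)
    · rwa [← pow_mul, ← pow_succ'] at key

end IsPAdicBanach

end Norm

/-! ### The ring of `p`-power-compatible sequences -/

namespace PowSeq

section Monoid

variable {p : ℕ} {M : Type*} [Monoid M]

/-- The unique `p ^ k`-th root. -/
def shift (k : ℕ) (z : PowSeq p M) : PowSeq p M := ⟨fun n => z.coeff (k + n), fun _ => z.pow_coeff _⟩

@[simp] lemma shift_coeff (k : ℕ) (z : PowSeq p M) (n : ℕ) :
    (shift k z).coeff n = z.coeff (k + n) := rfl

lemma coeff_add_pow (z : PowSeq p M) (n l : ℕ) : z.coeff (n + l) ^ p ^ l = z.coeff n := by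
  induction l with
  | zero => simp
  | succ l ih => rw [pow_succ', pow_mul, ← add_assoc, z.pow_coeff, ih]

end Monoid

variable {p : ℕ} [hp : Fact p.Prime] {R : Type*} [NormedCommRing R] [h : IsPAdicNormed p R]

lemma norm_coeff_pow (z : PowSeq p R) (m : ℕ) : ‖z.coeff m‖ ^ p ^ m = ‖z.coeff 0‖ := by
  rw [← h.pow _ _ (pow_pos hp.out.pos m)]
  simpa using congrArg norm (coeff_add_pow z 0 m)

lemma pow_val (z : PowSeq p R) (k n : ℕ) : (z ^ k).coeff n = z.coeff n ^ k := by
  induction k with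
  | zero => simp
  | succ k ih => rw [pow_succ, pow_succ, mul_val, ih]

lemma pow_injective : Function.Injective fun z : PowSeq p R => z ^ p := by
  intro z w hzw
  refine PowSeq.ext (funext fun n => ?_)
  have := congrArg (fun z : PowSeq p R => z.coeff (n + 1)) hzw
  simpa only [pow_val, PowSeq.pow_coeff] using this

lemma shift_pow (k : ℕ) (z : PowSeq p R) : shift (k + 1) z ^ p = shift k z := by
  refine PowSeq.ext (funext fun n => ?_)
  rw [pow_val, shift_coeff, shift_coeff, show k + 1 + n = k + n + 1 by ring, z.pow_coeff]

lemma norm_add_sub_le (x y : PowSeq p R) (n : ℕ) :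
    ‖(x + y).coeff n - (x.coeff n + y.coeff n)‖ ≤ (p : ℝ)⁻¹ * max ‖x.coeff n‖ ‖y.coeff n‖ :=
  le_of_tendsto ((tendsto_addSeq h x y n).sub_const _).norm
    (Eventually.of_forall fun l => addSeq_sub_zero h x y n l)

lemma norm_neg_add_le (x : PowSeq p R) (n : ℕ) :
    ‖(-x).coeff n + x.coeff n‖ ≤ (p : ℝ)⁻¹ * ‖x.coeff n‖ := by
  rw [neg_val]
  rcases hp.out.eq_two_or_odd' with rfl | ho
  · have e : (-1) ^ 2 * x.coeff n + x.coeff n = ((2 : ℕ) : R) * x.coeff n := by push_cast; ring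
    rw [e]
    exact norm_p_mul_le h _
  · rw [ho.neg_one_pow]
    simpa using mul_nonneg (inv_p_pos p).le (norm_nonneg _)

/-- The ring of `p`-power-compatible sequences has characteristic `p`: the entries of a natural
number agree with that number up to small errors, and so the entries of `p` are small. -/
lemma natCast_prime_eq_zero : (p : PowSeq p R) = 0 := by
  have hk : ∀ k : ℕ, Small p (fun n => (k : PowSeq p R).coeff n - (k : R)) := fun k => by
    induction k with
    | zero =>
      refine ⟨fun _ => 0, fun _ => le_rfl, fun _ => zero_pow hp.out.ne_zero, fun n => ?_⟩
      simp
    | succ k ih =>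
      have e : (fun n => ((k + 1 : ℕ) : PowSeq p R).coeff n - ((k + 1 : ℕ) : R)) = fun n =>
          (((k : PowSeq p R) + 1).coeff n -
            ((k : PowSeq p R).coeff n + (1 : PowSeq p R).coeff n)) +
          ((k : PowSeq p R).coeff n - (k : R)) := by
        funext n
        push_cast
        rw [one_val]
        ring
      rw [e]
      exact (small_add h _ _).add h ih
  refine ext_small h _ ((hk p).add h (e := fun _ => (p : R)) ⟨fun _ => 1, fun _ => zero_le_one,
    fun _ => one_pow p, fun n => by simpa using h.norm_p⟩) fun n => ?_
  simp

/-- Pairs `(z, r)` such that `r` approximates the leading entry of `z` modulo `p`, relative to the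
bound `K ^ d`. These form a graded ring, which expresses that the map `z ↦ z_1` is additive up to
errors divisible by `p`. -/
def approx {K : ℝ} (hK : 0 ≤ K) (d : ℕ) : AddSubgroup (PowSeq p R × R) where
  carrier := {z | ‖z.1.coeff 0‖ ≤ K ^ d ∧ ‖z.1.coeff 0 - z.2‖ ≤ (p : ℝ)⁻¹ * K ^ d}
  add_mem' {x y} hx hy := by
    have h0 := (inv_p_pos p).le
    have h1 := (norm_add_sub_le x.1 y.1 0).trans
      (mul_le_mul_of_nonneg_left (max_le hx.1 hy.1) h0)
    refine ⟨?_, ?_⟩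
    · rw [Prod.fst_add, ← sub_add_cancel ((x.1 + y.1).coeff 0) (x.1.coeff 0 + y.1.coeff 0)]
      refine (h.ultra _ _).trans (max_le (h1.trans ?_) ((h.ultra _ _).trans (max_le hx.1 hy.1)))
      exact mul_le_of_le_one_left (pow_nonneg hK d) (inv_p_lt_one p).le
    · have e : (x + y).1.coeff 0 - (x + y).2 = ((x.1 + y.1).coeff 0 - (x.1.coeff 0 + y.1.coeff 0)) +
          ((x.1.coeff 0 - x.2) + (y.1.coeff 0 - y.2)) := by
        rw [Prod.fst_add, Prod.snd_add]
        ring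
      rw [e]
      exact (h.ultra _ _).trans (max_le h1 ((h.ultra _ _).trans (max_le hx.2 hy.2)))
  zero_mem' := by
    have h0 := (inv_p_pos p).le
    simp only [Set.mem_ofPred_eq, Prod.fst_zero, Prod.snd_zero, zero_val, sub_zero, norm_zero]
    exact ⟨by positivity, by positivity⟩
  neg_mem' {x} hx := by
    have h0 := (inv_p_pos p).le
    have h1 := (norm_neg_add_le x.1 0).trans (mul_le_mul_of_nonneg_left hx.1 h0)
    refine ⟨?_, ?_⟩
    · rw [Prod.fst_neg, ← add_sub_cancel_right ((-x.1).coeff 0) (x.1.coeff 0)]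
      refine (h.norm_sub_le_max _ _).trans (max_le (h1.trans ?_) hx.1)
      exact mul_le_of_le_one_left (pow_nonneg hK d) (inv_p_lt_one p).le
    · have e : (-x).1.coeff 0 - (-x).2 = ((-x.1).coeff 0 + x.1.coeff 0) - (x.1.coeff 0 - x.2) := by
        rw [Prod.fst_neg, Prod.snd_neg]
        ring
      rw [e]
      exact (h.norm_sub_le_max _ _).trans (max_le h1 hx.2)

instance approx_graded {K : ℝ} (hK : 0 ≤ K) :
    SetLike.GradedMonoid (approx (p := p) (R := R) hK) where
  one_mem := by
    refine ⟨by simpa using h.norm_one_le, ?_⟩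
    simp [(inv_p_pos p).le]
  mul_mem i j x y hx hy := by
    have h0 := (inv_p_pos p).le
    have hy2 : ‖y.2‖ ≤ K ^ j := by
      rw [← sub_sub_cancel (y.1.coeff 0) y.2]
      refine (h.norm_sub_le_max _ _).trans (max_le hy.1 (hy.2.trans ?_))
      exact mul_le_of_le_one_left (pow_nonneg hK _) (inv_p_lt_one p).le
    refine ⟨?_, ?_⟩
    · rw [Prod.fst_mul, mul_val, pow_add]
      exact (norm_mul_le _ _).trans (mul_le_mul hx.1 hy.1 (norm_nonneg _) (pow_nonneg hK _))
    · have e : (x * y).1.coeff 0 - (x * y).2 = x.1.coeff 0 * (y.1.coeff 0 - y.2) +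
          (x.1.coeff 0 - x.2) * y.2 := by
        rw [Prod.fst_mul, Prod.snd_mul, mul_val]
        ring
      rw [e, pow_add]
      refine (h.ultra _ _).trans (max_le ((norm_mul_le _ _).trans ?_) ((norm_mul_le _ _).trans ?_))
      · rw [mul_left_comm]
        exact mul_le_mul hx.1 hy.2 (norm_nonneg _) (pow_nonneg hK _)
      · rw [← mul_assoc]
        exact mul_le_mul hx.2 hy2 (norm_nonneg _) (by positivity)

end PowSeq

/-! ### Teichmüller representatives -/

section Teichmuller

open WittVector

variable {p : ℕ} [hp : Fact p.Prime]

/-- Multiplication by a Teichmüller representative scales the component of index `n` by the power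
`p ^ n`. -/
lemma teichmuller_mul_coeff {S : Type*} [CommRing S] (a : S) (z : WittVector p S) (n : ℕ) :
    (teichmuller p a * z).coeff n = a ^ p ^ n * z.coeff n := by
  -- The identity holds if `p` is invertible by comparing ghost components. It follows for
  -- polynomial rings over `ℤ`, and thus for their quotients.
  have hQ : ∀ (a : MvPolynomial S ℚ) (z : WittVector p (MvPolynomial S ℚ)) (n : ℕ),
      (teichmuller p a * z).coeff n = a ^ p ^ n * z.coeff n := fun a z n => by
    have e : teichmuller p a * z = WittVector.mk p fun n => a ^ p ^ n * z.coeff n := by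
      refine (ghostMap.bijective_of_invertible p (MvPolynomial S ℚ)).1 (funext fun j => ?_)
      rw [ghostMap_apply, ghostMap_apply, map_mul, ghostComponent_teichmuller,
        ghostComponent_apply, ghostComponent_apply, aeval_wittPolynomial, aeval_wittPolynomial,
        Finset.mul_sum]
      refine Finset.sum_congr rfl fun i hi => ?_
      rw [Finset.mem_range, Nat.lt_succ_iff] at hi
      rw [coeff_mk, mul_pow, ← pow_mul, ← pow_add, Nat.add_sub_cancel' hi]
      ring
    rw [e, coeff_mk]
  have hZ : ∀ (a : MvPolynomial S ℤ) (z : WittVector p (MvPolynomial S ℤ)) (n : ℕ),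
      (teichmuller p a * z).coeff n = a ^ p ^ n * z.coeff n := fun a z n => by
    refine MvPolynomial.map_injective (Int.castRingHom ℚ) Int.cast_injective ?_
    have := hQ (MvPolynomial.map (Int.castRingHom ℚ) a)
      (WittVector.map (MvPolynomial.map (Int.castRingHom ℚ)) z) n
    rwa [← map_teichmuller, ← map_mul, map_coeff, map_coeff, ← map_pow, ← map_mul] at this
  have hS := congrArg (MvPolynomial.aeval (R := ℤ) (id : S → S)).toRingHom
    (hZ (MvPolynomial.X a) (WittVector.mk p fun n => MvPolynomial.X (z.coeff n)) n)
  have e : WittVector.map (MvPolynomial.aeval (R := ℤ) (id : S → S)).toRingHom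
      (WittVector.mk p fun n => MvPolynomial.X (z.coeff n)) = z := by
    ext i
    rw [map_coeff, coeff_mk]
    simp
  rw [← map_coeff, map_mul, map_teichmuller, e, map_mul, map_pow, coeff_mk] at hS
  simpa using hS

end Teichmuller

/-! ### Digits -/

namespace Warrow

open WittVector

variable {p : ℕ} [hp : Fact p.Prime] {R : Type*} [NormedCommRing R] [h : IsPAdicNormed p R]

lemma entry_succ_pow (x : Warrow p (PowSeq p R)) {n i : ℕ} (hi : i ≤ n) :
    entry x (n + 1) i ^ p = entry x n i := by
  obtain ⟨c, hc⟩ := entry_frobenius x hi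
  rw [hc, PowSeq.natCast_prime_eq_zero, zero_mul, add_zero]

/-- The `i`-th digit `c_i` of an element `∑ p ^ i [c_i]`, where `[c]` has the terms `[c^(p^(-n))]`. -/
noncomputable def digit (x : Warrow p (PowSeq p R)) (i : ℕ) : PowSeq p R := entry x i i

/-- Since `p` vanishes in `PowSeq p R`, the Frobenius is the `p`-power map on components, which is
bijective. Hence the digits determine all components. -/
lemma entry_eq_shift (x : Warrow p (PowSeq p R)) (i k : ℕ) :
    entry x (i + k) i = (digit x i).shift k := by
  induction k with
  | zero => exact PowSeq.ext (funext fun n => by rw [PowSeq.shift_coeff, zero_add]; rfl)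
  | succ k ih =>
    refine PowSeq.pow_injective ?_
    simp only
    rw [← add_assoc, entry_succ_pow x (Nat.le_add_right i k), ih, PowSeq.shift_pow]

lemma entry_coeff (x : Warrow p (PowSeq p R)) {n i : ℕ} (hi : i ≤ n) (m : ℕ) :
    (entry x n i).coeff m = (digit x i).coeff (n - i + m) := by
  obtain ⟨k, rfl⟩ := Nat.exists_eq_add_of_le hi
  rw [entry_eq_shift, PowSeq.shift_coeff, Nat.add_sub_cancel_left]

lemma norm_entry_pow (x : Warrow p (PowSeq p R)) {n i : ℕ} (hi : i ≤ n) :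
    ‖(entry x n i).coeff 0‖ ^ p ^ (n - i) = ‖(digit x i).coeff 0‖ := by
  rw [entry_coeff x hi, add_zero, PowSeq.norm_coeff_pow]

lemma ext_digit {x y : Warrow p (PowSeq p R)} (hxy : ∀ i, digit x i = digit y i) : x = y := by
  refine ext_entry fun n i hi => ?_
  obtain ⟨k, rfl⟩ := Nat.exists_eq_add_of_le hi
  rw [entry_eq_shift, entry_eq_shift, hxy]

lemma truncFrobenius_coeff {S : Type*} [CommRing S] (hS : (p : S) = 0) (n : ℕ)
    (x : TruncatedWittVector p (n + 1) S) (i : Fin n) :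
    (truncFrobenius p n S x).coeff i = x.coeff i.castSucc ^ p := by
  obtain ⟨x, rfl⟩ := truncate_surjective p (n + 1) S x
  rw [truncFrobenius_truncate, coeff_truncate, coeff_truncate, coeff_frobenius, frobeniusPoly]
  simp [hS]

/-- The element with prescribed digits. -/
noncomputable def ofDigits (c : ℕ → PowSeq p R) : Warrow p (PowSeq p R) :=
  ⟨fun n => TruncatedWittVector.mk p fun i => (c i).shift (n - i), fun n => by
    ext i
    have hi : (i : ℕ) ≤ n := Nat.lt_succ_iff.mp i.2
    rw [truncFrobenius_coeff PowSeq.natCast_prime_eq_zero, TruncatedWittVector.coeff_mk,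
      TruncatedWittVector.coeff_mk, Fin.val_castSucc, Nat.sub_add_comm hi, PowSeq.shift_pow]⟩

lemma entry_ofDigits (c : ℕ → PowSeq p R) {n i : ℕ} (hi : i ≤ n) :
    entry (ofDigits c) n i = (c i).shift (n - i) := by
  rw [entry_eq_coeff _ hi]
  exact TruncatedWittVector.coeff_mk _ _

@[simp] lemma digit_ofDigits (c : ℕ → PowSeq p R) (i : ℕ) : digit (ofDigits c) i = c i := by
  rw [digit, entry_ofDigits c le_rfl, Nat.sub_self]
  exact PowSeq.ext (funext fun n => by rw [PowSeq.shift_coeff, zero_add])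

/-- The element `[c]` of the inverse limit, with terms `[c^(p^(-n))]`. -/
noncomputable def teich (c : PowSeq p R) : Warrow p (PowSeq p R) := ofDigits (Pi.single 0 c)

lemma truncate_teichmuller (c : PowSeq p R) (n : ℕ) :
    truncate (n + 1) (teichmuller p (c.shift n)) = (teich c).1 n := by
  ext i
  rw [coeff_truncate, ← entry_eq_coeff (teich c) (Nat.lt_succ_iff.mp i.2), teich,
    entry_ofDigits _ (Nat.lt_succ_iff.mp i.2)]
  rcases Nat.eq_zero_or_pos (i : ℕ) with hi | hi
  · rw [hi, teichmuller_coeff_zero, Pi.single_eq_same, Nat.sub_zero]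
  · rw [teichmuller_coeff_pos _ _ _ hi, Pi.single_eq_of_ne hi.ne']
    rfl

lemma digit_teich_mul (c : PowSeq p R) (y : Warrow p (PowSeq p R)) (i : ℕ) :
    digit (teich c * y) i = c * digit y i := by
  rw [digit, entry_of_truncate (z := teichmuller p (c.shift i) * (y.1 i).out)
    (by rw [map_mul, truncate_teichmuller, truncate_out]; rfl) le_rfl, teichmuller_mul_coeff]
  refine congrArg₂ _ (PowSeq.ext (funext fun n => ?_)) rfl
  rw [PowSeq.pow_val, PowSeq.shift_coeff, add_comm, PowSeq.coeff_add_pow]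

/-- In characteristic `p`, multiplication by `p` is the composition of Frobenius and
Verschiebung. -/
lemma mul_p_coeff (z : WittVector p (PowSeq p R)) :
    ((p : WittVector p (PowSeq p R)) * z).coeff 0 = 0 ∧
      ∀ i, ((p : WittVector p (PowSeq p R)) * z).coeff (i + 1) = z.coeff i ^ p := by
  have hF : ∀ (w : WittVector p (PowSeq p R)) (i : ℕ), (frobenius w).coeff i = w.coeff i ^ p :=
    fun w i => by
      rw [coeff_frobenius, frobeniusPoly]
      simp [PowSeq.natCast_prime_eq_zero]
  rw [mul_comm, ← frobenius_verschiebung]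
  refine ⟨?_, fun i => ?_⟩
  · rw [hF, verschiebung_coeff_zero, zero_pow hp.out.ne_zero]
  · rw [hF, verschiebung_coeff_succ]

lemma truncate_p_mul_out (x : Warrow p (PowSeq p R)) (n : ℕ) :
    truncate (n + 1) ((p : WittVector p (PowSeq p R)) * (x.1 n).out) =
      ((p : Warrow p (PowSeq p R)) * x).1 n := by
  rw [map_mul, map_natCast, truncate_out]
  rfl

lemma digit_p_mul_zero (x : Warrow p (PowSeq p R)) :
    digit ((p : Warrow p (PowSeq p R)) * x) 0 = 0 := by
  rw [digit, entry_of_truncate (truncate_p_mul_out x 0) le_rfl, (mul_p_coeff _).1]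

lemma digit_p_mul_succ (x : Warrow p (PowSeq p R)) (i : ℕ) :
    digit ((p : Warrow p (PowSeq p R)) * x) (i + 1) = digit x i := by
  rw [digit, entry_of_truncate (truncate_p_mul_out x (i + 1)) le_rfl, (mul_p_coeff _).2]
  exact entry_succ_pow x le_rfl

/-- The element `∑ p ^ i [c_{i + 1}]`. -/
noncomputable def divP (x : Warrow p (PowSeq p R)) : Warrow p (PowSeq p R) :=
  ofDigits fun i => digit x (i + 1)

@[simp] lemma digit_divP (x : Warrow p (PowSeq p R)) (i : ℕ) :
    digit (divP x) i = digit x (i + 1) := digit_ofDigits _ _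

lemma digit_divP_iterate (x : Warrow p (PowSeq p R)) (N i : ℕ) :
    digit (divP^[N] x) i = digit x (i + N) := by
  induction N generalizing i with
  | zero => rfl
  | succ N ih => rw [Function.iterate_succ_apply', digit_divP, ih, add_right_comm, add_assoc]

lemma eq_teich_add_p_mul (x : Warrow p (PowSeq p R)) :
    x = teich (digit x 0) + (p : Warrow p (PowSeq p R)) * divP x := by
  refine ext_digit fun i => ?_
  have hz : truncate (i + 1) (teichmuller p ((digit x 0).shift i) +
      (p : WittVector p (PowSeq p R)) * ((divP x).1 i).out) =
      (teich (digit x 0) + (p : Warrow p (PowSeq p R)) * divP x).1 i := by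
    rw [map_add, truncate_teichmuller, truncate_p_mul_out]
    rfl
  rw [digit, digit, entry_of_truncate hz le_rfl, coeff_add_of_disjoint]
  · rcases i with _ | i
    · rw [teichmuller_coeff_zero, (mul_p_coeff _).1, add_zero]
      exact PowSeq.ext (funext fun n => by rw [PowSeq.shift_coeff, zero_add]; rfl)
    · rw [teichmuller_coeff_pos _ _ _ i.succ_pos, (mul_p_coeff _).2, zero_add]
      exact (digit_divP x i).symm.trans (entry_succ_pow (divP x) le_rfl).symm
  · rintro (_ | n)
    · exact Or.inr (mul_p_coeff _).1
    · exact Or.inl (teichmuller_coeff_pos _ _ _ n.succ_pos)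

/-- The size of the `i`-th digit. -/
noncomputable def digitNorm (x : Warrow p (PowSeq p R)) (i : ℕ) : ℝ := ‖(digit x i).coeff 0‖

lemma digitNorm_nonneg (x : Warrow p (PowSeq p R)) (i : ℕ) : 0 ≤ digitNorm x i := norm_nonneg _

lemma norm_digit_coeff_pow (x : Warrow p (PowSeq p R)) (i m : ℕ) :
    ‖(digit x i).coeff m‖ ^ p ^ m = digitNorm x i := PowSeq.norm_coeff_pow _ _

lemma norm_entry_le_iff (x : Warrow p (PowSeq p R)) {K : ℝ} (hK : 0 ≤ K) {n i : ℕ} (hi : i ≤ n) :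
    ‖(entry x n i).coeff 0‖ ≤ K ^ p ^ i ↔ digitNorm x i ≤ K ^ p ^ n := by
  rw [← pow_le_root_iff hK (norm_nonneg _) hi, norm_entry_pow x hi, digitNorm]

/-- The leading entries of the components of `x + y` agree modulo `p` with the components of the
sum of the Witt vectors with the leading entries of the components of `x` and `y`. -/
lemma norm_entry_add_sub_le (x y : Warrow p (PowSeq p R)) {K : ℝ} (hK : 0 ≤ K) {n i : ℕ}
    (hi : i ≤ n) (hx : ∀ j ≤ i, digitNorm x j ≤ K ^ p ^ n)
    (hy : ∀ j ≤ i, digitNorm y j ≤ K ^ p ^ n) :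
    ‖(entry (x + y) n i).coeff 0‖ ≤ K ^ p ^ i ∧ ‖(entry (x + y) n i).coeff 0 -
      (WittVector.mk p (fun j => (entry x n j).coeff 0) +
        WittVector.mk p (fun j => (entry y n j).coeff 0)).coeff i‖ ≤ (p : ℝ)⁻¹ * K ^ p ^ i := by
  -- Add in `PowSeq p R × R`, where the pairs `(c, c_1)` lie in the graded ring `approx`.
  have key := coeff_add_mem (PowSeq.approx (p := p) (R := R) hK) (n := i)
    (x := WittVector.mk p fun j => (entry x n j, (entry x n j).coeff 0))
    (y := WittVector.mk p fun j => (entry y n j, (entry y n j).coeff 0))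
    (fun j hj => ⟨(norm_entry_le_iff x hK (hj.trans hi)).mpr (hx j hj), by
      simp only [coeff_mk, sub_self, norm_zero]
      exact mul_nonneg (PowSeq.inv_p_pos p).le (pow_nonneg hK _)⟩)
    (fun j hj => ⟨(norm_entry_le_iff y hK (hj.trans hi)).mpr (hy j hj), by
      simp only [coeff_mk, sub_self, norm_zero]
      exact mul_nonneg (PowSeq.inv_p_pos p).le (pow_nonneg hK _)⟩)
  have e1 : ∀ z w : WittVector p (PowSeq p R × R), ((z + w).coeff i).1 =
      (WittVector.map (RingHom.fst _ _) z + WittVector.map (RingHom.fst _ _) w).coeff i :=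
    fun z w => by rw [← map_add, map_coeff]; rfl
  have e2 : ∀ z w : WittVector p (PowSeq p R × R), ((z + w).coeff i).2 =
      (WittVector.map (RingHom.snd _ _) z + WittVector.map (RingHom.snd _ _) w).coeff i :=
    fun z w => by rw [← map_add, map_coeff]; rfl
  obtain ⟨k1, k2⟩ := key
  rw [e1] at k1 k2
  rw [e2] at k2
  rw [entry_add x y hi]
  exact ⟨k1, k2⟩

lemma digitNorm_add_le {x y : Warrow p (PowSeq p R)} {i : ℕ} {B : ℝ}
    (hx : ∀ j ≤ i, digitNorm x j ≤ B) (hy : ∀ j ≤ i, digitNorm y j ≤ B) :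
    digitNorm (x + y) i ≤ B := by
  obtain ⟨K, hK, rfl⟩ := exists_nonneg_pow_eq (pow_ne_zero i hp.out.ne_zero)
    ((digitNorm_nonneg x i).trans (hx i le_rfl))
  exact (norm_entry_add_sub_le x y hK le_rfl hx hy).1

lemma digitNorm_neg_le {x : Warrow p (PowSeq p R)} {i : ℕ} {B : ℝ}
    (hx : ∀ j ≤ i, digitNorm x j ≤ B) : digitNorm (-x) i ≤ B := by
  obtain ⟨K, hK, rfl⟩ := exists_nonneg_pow_eq (pow_ne_zero i hp.out.ne_zero)
    ((digitNorm_nonneg x i).trans (hx i le_rfl))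
  have key := coeff_neg_mem (PowSeq.approx (p := p) (R := R) hK) (n := i)
    (x := WittVector.mk p fun j => (entry x i j, (entry x i j).coeff 0))
    (fun j hj => ⟨(norm_entry_le_iff x hK hj).mpr (hx j hj), by
      simp only [coeff_mk, sub_self, norm_zero]
      exact mul_nonneg (PowSeq.inv_p_pos p).le (pow_nonneg hK _)⟩)
  have e1 : ∀ z : WittVector p (PowSeq p R × R), ((-z).coeff i).1 =
      (-WittVector.map (RingHom.fst _ _) z).coeff i :=
    fun z => by rw [← map_neg, map_coeff]; rfl
  have k1 := key.1
  rw [e1] at k1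
  rw [digitNorm, digit, entry_neg x le_rfl]
  exact k1

/-- The digits of a product satisfy the bounds satisfied by the Cauchy product. -/
lemma digitNorm_mul_le {x y : Warrow p (PowSeq p R)} {k : ℕ} {B : ℝ}
    (hxy : ∀ i j, i + j ≤ k → digitNorm x i * digitNorm y j ≤ B) : digitNorm (x * y) k ≤ B := by
  have hB : 0 ≤ B := (mul_nonneg (digitNorm_nonneg x 0) (digitNorm_nonneg y 0)).trans
    (hxy 0 0 (Nat.zero_le _))
  induction k using Nat.strong_induction_on generalizing x with
  | _ k ih =>
    have e : x * y = teich (digit x 0) * y + (p : Warrow p (PowSeq p R)) * (divP x * y) := by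
      rw [← mul_assoc, ← add_mul, ← eq_teich_add_p_mul]
    rw [e]
    refine digitNorm_add_le (fun j hj => ?_) (fun j hj => ?_)
    · rw [digitNorm, digit_teich_mul, PowSeq.mul_val]
      exact (norm_mul_le _ _).trans (hxy 0 j (by omega))
    · rcases j with _ | j
      · rw [digitNorm, digit_p_mul_zero, PowSeq.zero_val, norm_zero]
        exact hB
      · rw [digitNorm, digit_p_mul_succ]
        refine ih j (by omega) fun a b hab => ?_
        rw [digitNorm, digit_divP]
        exact hxy (a + 1) b (by omega)

end Warrow

/-! ### Overconvergence in terms of digits -/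

namespace Warrow

open WittVector

variable {p : ℕ} [hp : Fact p.Prime] {R : Type*} [NormedCommRing R]

section Subring

variable [h : IsPAdicNormed p R]

/-- The digits `c_i` of `x` satisfy `q ^ i * |c_i| → 0`. For `q = p ^ (-b)` with `b > 0` this is
overconvergence of radius `b`. -/
def DigitsVanish (q : ℝ) (x : Warrow p (PowSeq p R)) : Prop :=
  Tendsto (fun i => q ^ i * digitNorm x i) atTop (𝓝 0)

lemma DigitsVanish.exists_forall_le {q : ℝ} {x : Warrow p (PowSeq p R)} (hx : DigitsVanish q x)
    {ε : ℝ} (hε : 0 < ε) : ∃ N, ∀ i ≥ N, q ^ i * digitNorm x i ≤ ε := by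
  obtain ⟨N, hN⟩ := eventually_atTop.mp (hx.eventually (gt_mem_nhds hε))
  exact ⟨N, fun i hi => (hN i hi).le⟩

lemma DigitsVanish.exists_bound {q : ℝ} {x : Warrow p (PowSeq p R)} (hx : DigitsVanish q x) :
    ∃ M, 0 < M ∧ ∀ i, q ^ i * digitNorm x i ≤ M := by
  obtain ⟨M, hM⟩ := hx.bddAbove_range
  exact ⟨max M 1, lt_max_of_lt_right one_pos, fun i => (hM ⟨i, rfl⟩).trans (le_max_left _ _)⟩

lemma digitsVanish_of_forall_le {q : ℝ} (hq : 0 < q) {x : Warrow p (PowSeq p R)}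
    (hx : ∀ ε > 0, ∃ N, ∀ i ≥ N, q ^ i * digitNorm x i ≤ ε) : DigitsVanish q x := by
  refine Metric.tendsto_atTop.mpr fun ε hε => ?_
  obtain ⟨N, hN⟩ := hx (ε / 2) (half_pos hε)
  refine ⟨N, fun i hi => ?_⟩
  rw [Real.dist_0_eq_abs, abs_of_nonneg (mul_nonneg (pow_pos hq i).le (digitNorm_nonneg x i))]
  exact (hN i hi).trans_lt (half_lt_self hε)

lemma DigitsVanish.exists_forall_forall_le {q : ℝ} (hq : 0 < q) (hq1 : q < 1)
    {x : Warrow p (PowSeq p R)} (hx : DigitsVanish q x) {ε : ℝ} (hε : 0 < ε) :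
    ∃ N, ∀ n ≥ N, ∀ i ≤ n, q ^ n * digitNorm x i ≤ ε := by
  obtain ⟨N, hN⟩ := hx.exists_forall_le hε
  have h1 : ∀ᶠ n in atTop, ∀ i ∈ Finset.range N, q ^ n * digitNorm x i ≤ ε := by
    refine (Filter.eventually_all_finset _).mpr fun i _ => ?_
    have := (tendsto_pow_atTop_nhds_zero_of_lt_one hq.le hq1).mul_const (digitNorm x i)
    rw [zero_mul] at this
    exact (this.eventually (gt_mem_nhds hε)).mono fun n hn => hn.le
  obtain ⟨N', hN'⟩ := eventually_atTop.mp h1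
  refine ⟨N', fun n hn i hi => ?_⟩
  rcases lt_or_ge i N with hiN | hiN
  · exact hN' n hn i (Finset.mem_range.mpr hiN)
  · exact (mul_le_mul_of_nonneg_right (pow_le_pow_of_le_one hq.le hq1.le hi)
      (digitNorm_nonneg x i)).trans (hN i hiN)

lemma digitNorm_one_le (i : ℕ) : digitNorm (1 : Warrow p (PowSeq p R)) i ≤ 1 := by
  rw [digitNorm, digit, entry_of_truncate (z := 1) (by rw [map_one]; rfl) le_rfl]
  rcases i with _ | i
  · rw [WittVector.one_coeff_zero, PowSeq.one_val]
    exact h.norm_one_le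
  · rw [WittVector.one_coeff_eq_of_pos _ _ _ i.succ_pos, PowSeq.zero_val, norm_zero]
    exact zero_le_one

lemma digitNorm_zero (i : ℕ) : digitNorm (0 : Warrow p (PowSeq p R)) i = 0 := by
  rw [digitNorm, digit, entry_zero i le_rfl, PowSeq.zero_val, norm_zero]

lemma DigitsVanish.add {q : ℝ} (hq : 0 < q) (hq1 : q < 1) {x y : Warrow p (PowSeq p R)}
    (hx : DigitsVanish q x) (hy : DigitsVanish q y) : DigitsVanish q (x + y) := by
  refine digitsVanish_of_forall_le hq fun ε hε => ?_
  obtain ⟨N, hN⟩ := hx.exists_forall_forall_le hq hq1 hε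
  obtain ⟨N', hN'⟩ := hy.exists_forall_forall_le hq hq1 hε
  refine ⟨max N N', fun n hn => ?_⟩
  rw [← le_div_iff₀' (pow_pos hq n)]
  refine digitNorm_add_le (fun i hi => ?_) (fun i hi => ?_)
  · rw [le_div_iff₀' (pow_pos hq n)]
    exact hN n ((le_max_left _ _).trans hn) i hi
  · rw [le_div_iff₀' (pow_pos hq n)]
    exact hN' n ((le_max_right _ _).trans hn) i hi

lemma DigitsVanish.neg {q : ℝ} (hq : 0 < q) (hq1 : q < 1) {x : Warrow p (PowSeq p R)}
    (hx : DigitsVanish q x) : DigitsVanish q (-x) := by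
  refine digitsVanish_of_forall_le hq fun ε hε => ?_
  obtain ⟨N, hN⟩ := hx.exists_forall_forall_le hq hq1 hε
  refine ⟨N, fun n hn => ?_⟩
  rw [← le_div_iff₀' (pow_pos hq n)]
  refine digitNorm_neg_le fun i hi => ?_
  rw [le_div_iff₀' (pow_pos hq n)]
  exact hN n hn i hi

lemma DigitsVanish.mul {q : ℝ} (hq : 0 < q) (hq1 : q < 1) {x y : Warrow p (PowSeq p R)}
    (hx : DigitsVanish q x) (hy : DigitsVanish q y) : DigitsVanish q (x * y) := by
  refine digitsVanish_of_forall_le hq fun ε hε => ?_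
  obtain ⟨M, hM, hxM⟩ := hx.exists_bound
  obtain ⟨M', hM', hyM⟩ := hy.exists_bound
  obtain ⟨N, hN⟩ := hx.exists_forall_le (div_pos hε hM')
  obtain ⟨N', hN'⟩ := hy.exists_forall_le (div_pos hε hM)
  obtain ⟨L, hL⟩ := exists_pow_lt_of_lt_one (div_pos hε (mul_pos hM hM')) hq1
  refine ⟨N + N' + L, fun n hn => ?_⟩
  rw [← le_div_iff₀' (pow_pos hq n)]
  refine digitNorm_mul_le fun i j hij => ?_
  rw [le_div_iff₀' (pow_pos hq n)]
  obtain ⟨l, rfl⟩ := Nat.exists_eq_add_of_le hij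
  have hu : 0 ≤ q ^ i * digitNorm x i := mul_nonneg (pow_pos hq _).le (digitNorm_nonneg _ _)
  have hv : 0 ≤ q ^ j * digitNorm y j := mul_nonneg (pow_pos hq _).le (digitNorm_nonneg _ _)
  have e : q ^ (i + j + l) * (digitNorm x i * digitNorm y j) =
      q ^ l * ((q ^ i * digitNorm x i) * (q ^ j * digitNorm y j)) := by ring
  have hl1 : q ^ l ≤ 1 := pow_le_one₀ hq.le hq1.le
  rw [e]
  -- One of the indices `i`, `j`, `l` is large, and supplies the small factor.
  rcases le_or_gt N i with hi | hi
  · refine (mul_le_of_le_one_left (mul_nonneg hu hv) hl1).trans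
      ((mul_le_mul (hN i hi) (hyM j) hv (div_pos hε hM').le).trans ?_)
    rw [div_mul_cancel₀ _ hM'.ne']
  rcases le_or_gt N' j with hj | hj
  · refine (mul_le_of_le_one_left (mul_nonneg hu hv) hl1).trans
      ((mul_le_mul (hxM i) (hN' j hj) hv hM.le).trans ?_)
    rw [mul_div_cancel₀ _ hM.ne']
  · refine (mul_le_mul (((pow_le_pow_of_le_one hq.le hq1.le (by omega)).trans hL.le))
      (mul_le_mul (hxM i) (hyM j) hv hM.le) (mul_nonneg hu hv)
      (div_pos hε (mul_pos hM hM')).le).trans ?_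
    rw [div_mul_cancel₀ _ (mul_pos hM hM').ne']

/-- The elements whose digits `c_i` satisfy `q ^ i * ‖c_i‖ → 0` form a subring. -/
def digitsVanishSubring {q : ℝ} (hq : 0 < q) (hq1 : q < 1) : Subring (Warrow p (PowSeq p R)) where
  carrier := {x | DigitsVanish q x}
  mul_mem' hx hy := DigitsVanish.mul hq hq1 hx hy
  one_mem' := by
    refine squeeze_zero (fun i => mul_nonneg (pow_pos hq i).le (digitNorm_nonneg _ i)) (fun i => ?_)
      (tendsto_pow_atTop_nhds_zero_of_lt_one hq.le hq1)
    exact mul_le_of_le_one_right (pow_pos hq i).le (digitNorm_one_le i)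
  add_mem' hx hy := DigitsVanish.add hq hq1 hx hy
  zero_mem' := by
    refine tendsto_const_nhds.congr fun i => ?_
    rw [digitNorm_zero, mul_zero]
  neg_mem' hx := DigitsVanish.neg hq hq1 hx

lemma DigitsVanish.divP {q : ℝ} (hq : 0 < q) {x : Warrow p (PowSeq p R)} (hx : DigitsVanish q x) :
    DigitsVanish q (divP x) := by
  refine digitsVanish_of_forall_le hq fun ε hε => ?_
  obtain ⟨N, hN⟩ := hx.exists_forall_le (mul_pos hε hq)
  refine ⟨N, fun i hi => ?_⟩
  have := hN (i + 1) (by omega)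
  rw [pow_succ, mul_right_comm] at this
  rw [digitNorm, digit_divP]
  exact le_of_mul_le_mul_right this hq

lemma DigitsVanish.divP_iterate {q : ℝ} (hq : 0 < q) {x : Warrow p (PowSeq p R)}
    (hx : DigitsVanish q x) (N : ℕ) : DigitsVanish q (Warrow.divP^[N] x) := by
  induction N with
  | zero => exact hx
  | succ N ih => rw [Function.iterate_succ_apply']; exact ih.divP hq

end Subring

/-! ### The untilting homomorphism -/

section Untilt

variable [h : IsPAdicBanach p R]

/-- The sequence of sums `∑ p ^ i (c_i)_m`, where the `c_i` are the digits of `x`. The series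
converge if the digits satisfy `DigitsVanish p⁻¹`; otherwise the value has no meaning. -/
noncomputable def untilt (x : Warrow p (PowSeq p R)) (m : ℕ) : R :=
  limUnder atTop fun N : ℕ => ∑ i ∈ Finset.range N, (p : R) ^ i * (digit x i).coeff m

lemma norm_term_pow_le (x : Warrow p (PowSeq p R)) (m i : ℕ) :
    ‖(p : R) ^ i * (digit x i).coeff m‖ ^ p ^ m ≤ ((p : ℝ)⁻¹) ^ i * digitNorm x i := by
  have h0 := PowSeq.inv_p_pos p
  rw [h.norm_p_pow_mul, mul_pow, norm_digit_coeff_pow]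
  refine mul_le_mul_of_nonneg_right ?_ (digitNorm_nonneg x i)
  exact pow_le_of_le_one (pow_nonneg h0.le _) (pow_le_one₀ h0.le (PowSeq.inv_p_lt_one p).le)
    (pow_ne_zero _ hp.out.ne_zero)

lemma tendsto_untilt {x : Warrow p (PowSeq p R)} (hx : DigitsVanish (p : ℝ)⁻¹ x) (m : ℕ) :
    Tendsto (fun N : ℕ => ∑ i ∈ Finset.range N, (p : R) ^ i * (digit x i).coeff m) atTop
      (𝓝 (untilt x m)) := by
  refine tendsto_nhds_limUnder (h.exists_tendsto ?_)
  refine tendsto_zero_of_pow_le (p ^ m) (fun _ => norm_nonneg _) (fun N => ?_) hx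
  rw [Finset.sum_range_succ, add_sub_cancel_left]
  exact norm_term_pow_le x m N

lemma norm_untilt_pow_le {x : Warrow p (PowSeq p R)} (hx : DigitsVanish (p : ℝ)⁻¹ x) {B : ℝ}
    (hB : ∀ i, ((p : ℝ)⁻¹) ^ i * digitNorm x i ≤ B) (m : ℕ) : ‖untilt x m‖ ^ p ^ m ≤ B := by
  have hk := pow_ne_zero m hp.out.ne_zero
  have hB0 : 0 ≤ B := (mul_nonneg (pow_nonneg (PowSeq.inv_p_pos p).le _)
    (digitNorm_nonneg x 0)).trans (hB 0)
  obtain ⟨K, hK, rfl⟩ := exists_nonneg_pow_eq hk hB0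
  refine pow_le_pow_left₀ (norm_nonneg _) (le_of_tendsto (tendsto_untilt hx m).norm
    (Eventually.of_forall fun N => PowSeq.norm_sum_le h.toIsPAdicNormed _ _ hK fun i _ => ?_)) _
  exact (pow_le_pow_iff_left₀ (norm_nonneg _) hK hk).mp ((norm_term_pow_le x m i).trans (hB i))

lemma untilt_eq_add {x : Warrow p (PowSeq p R)} (hx : DigitsVanish (p : ℝ)⁻¹ x) (m : ℕ) :
    untilt x m = (digit x 0).coeff m + p * untilt (divP x) m := by
  have h1 := (tendsto_untilt hx m).comp (tendsto_add_atTop_nat 1)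
  have h2 := ((tendsto_untilt (hx.divP (PowSeq.inv_p_pos p)) m).const_mul (p : R)).const_add
    ((digit x 0).coeff m)
  refine tendsto_nhds_unique h1 (h2.congr fun N => ?_)
  rw [Function.comp_apply, Finset.sum_range_succ', pow_zero, one_mul, add_comm, Finset.mul_sum]
  simp only [digit_divP, pow_succ', mul_assoc]

lemma divP_p_mul (x : Warrow p (PowSeq p R)) : divP ((p : Warrow p (PowSeq p R)) * x) = x :=
  ext_digit fun i => by rw [digit_divP, digit_p_mul_succ]

lemma untilt_p_mul {x : Warrow p (PowSeq p R)}
    (hx : DigitsVanish (p : ℝ)⁻¹ ((p : Warrow p (PowSeq p R)) * x)) (m : ℕ) :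
    untilt ((p : Warrow p (PowSeq p R)) * x) m = p * untilt x m := by
  rw [untilt_eq_add hx, divP_p_mul, digit_p_mul_zero, PowSeq.zero_val, zero_add]

lemma untilt_teich_mul (c : PowSeq p R) {x : Warrow p (PowSeq p R)}
    (hx : DigitsVanish (p : ℝ)⁻¹ x) (hcx : DigitsVanish (p : ℝ)⁻¹ (teich c * x)) (m : ℕ) :
    untilt (teich c * x) m = c.coeff m * untilt x m := by
  refine tendsto_nhds_unique (tendsto_untilt hcx m)
    (((tendsto_untilt hx m).const_mul (c.coeff m)).congr fun N => ?_)
  rw [Finset.mul_sum]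
  refine Finset.sum_congr rfl fun i _ => ?_
  rw [digit_teich_mul, PowSeq.mul_val, mul_left_comm]

lemma untilt_teich (c : PowSeq p R) (m : ℕ) : untilt (teich c) m = c.coeff m := by
  refine Tendsto.limUnder_eq (tendsto_const_nhds.congr'
    (eventually_atTop.mpr ⟨1, fun N hN => ?_⟩))
  beta_reduce
  rw [Finset.sum_eq_single_of_mem 0 (Finset.mem_range.mpr hN)]
  · simp [teich]
  · intro i _ hi
    rw [teich, digit_ofDigits, Pi.single_eq_of_ne hi, PowSeq.zero_val, mul_zero]

lemma teich_one : teich (1 : PowSeq p R) = 1 := by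
  have e := ext_digit (x := teich 1 * (1 : Warrow p (PowSeq p R))) (y := 1)
    fun i => by rw [digit_teich_mul, one_mul]
  rwa [mul_one] at e

lemma eq_zero_of_pow_le {r : R} {k : ℕ} (hk : k ≠ 0) {C : ℝ} (hr : ∀ ε > 0, ‖r‖ ^ k ≤ C * ε) :
    r = 0 := by
  have h1 : Tendsto (fun n : ℕ => C * (1 / 2) ^ n) atTop (𝓝 (C * 0)) :=
    (tendsto_pow_atTop_nhds_zero_of_lt_one (by norm_num) (by norm_num)).const_mul C
  have h2 : ‖r‖ ^ k ≤ 0 := by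
    rw [mul_zero] at h1
    exact ge_of_tendsto' h1 fun n => hr _ (by positivity)
  exact norm_eq_zero.mp (pow_eq_zero_iff hk |>.mp (le_antisymm h2 (by positivity)))

/-- The partial sums defining `untilt x` are ghost components of the Witt vectors formed by the
leading entries of the components of `x`. -/
lemma sum_entry_eq (x : Warrow p (PowSeq p R)) (m j : ℕ) :
    ∑ i ∈ Finset.range (j + 1), (p : R) ^ i * (entry x (m + j) i).coeff 0 ^ p ^ (j - i) =
      ∑ i ∈ Finset.range (j + 1), (p : R) ^ i * (digit x i).coeff m := by
  refine Finset.sum_congr rfl fun i hi => ?_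
  rw [Finset.mem_range, Nat.lt_succ_iff] at hi
  rw [entry_coeff x (by omega), add_zero, Nat.add_sub_assoc hi, PowSeq.coeff_add_pow]

/-- Modulo `p`, and relative to the size of the digits, the components of `x + y` are those of the
sum of the Witt vectors of leading entries. Hence the partial sums of index `j` add up to an error of
size about `p ^ (-j)` times that size, which tends to zero. -/
lemma untilt_add {x y : Warrow p (PowSeq p R)} (hx : DigitsVanish (p : ℝ)⁻¹ x)
    (hy : DigitsVanish (p : ℝ)⁻¹ y) (m : ℕ) : untilt (x + y) m = untilt x m + untilt y m := by
  have h0 := PowSeq.inv_p_pos p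
  have h1 := PowSeq.inv_p_lt_one p
  have hp0 : (0 : ℝ) < p := by exact_mod_cast hp.out.pos
  have hxy := hx.add h0 h1 hy
  refine (sub_eq_zero.mp (eq_zero_of_pow_le (k := p ^ m) (C := (p : ℝ) ^ m)
    (pow_ne_zero m hp.out.ne_zero) fun ε hε => ?_)).symm
  have lim := ((((tendsto_untilt hx m).add (tendsto_untilt hy m)).sub
    (tendsto_untilt hxy m)).norm.pow (p ^ m)).comp (tendsto_add_atTop_nat 1)
  obtain ⟨N, hN⟩ := hx.exists_forall_forall_le h0 h1 hε
  obtain ⟨N', hN'⟩ := hy.exists_forall_forall_le h0 h1 hε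
  refine le_of_tendsto lim (eventually_atTop.mpr ⟨max N N', fun j hj => ?_⟩)
  have hjN : N ≤ m + j := (le_max_left _ _).trans (hj.trans (Nat.le_add_left _ _))
  have hjN' : N' ≤ m + j := (le_max_right _ _).trans (hj.trans (Nat.le_add_left _ _))
  obtain ⟨K, hK, hKe⟩ := exists_nonneg_pow_eq (pow_ne_zero (m + j) hp.out.ne_zero)
    (div_pos hε (pow_pos h0 (m + j))).le
  -- The constant `K` is a common bound on the `p ^ (m + j)`-th roots of the digits that occur.
  have key := fun i (hi : i < j + 1) => norm_entry_add_sub_le x y hK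
    (show i ≤ m + j by omega)
    (fun l hl => by
      rw [hKe, le_div_iff₀' (pow_pos h0 _)]
      exact hN _ hjN l (by omega))
    (fun l hl => by
      rw [hKe, le_div_iff₀' (pow_pos h0 _)]
      exact hN' _ hjN' l (by omega))
  have gh := h.norm_ghost_sub_le hK le_rfl (fun i hi => (key i hi).1)
    (fun i hi => (norm_sub_rev _ _).trans_le (key i hi).2)
  have e : ∀ z : WittVector p R, ∑ i ∈ Finset.range (j + 1), (p : R) ^ i *
      z.coeff i ^ p ^ (j - i) = ghostComponent j z := fun z => by
    rw [ghostComponent_apply, aeval_wittPolynomial]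
  rw [e, map_add, ← e, ← e, sum_entry_eq] at gh
  simp only [coeff_mk, sum_entry_eq] at gh
  refine (pow_le_pow_left₀ (norm_nonneg _) gh _).trans ?_
  have hKj : (K ^ p ^ j) ^ p ^ m = ε / ((p : ℝ)⁻¹) ^ (m + j) := by
    rw [← pow_mul, ← pow_add, add_comm j m, hKe]
  have hle : (((p : ℝ)⁻¹) ^ (j + 1)) ^ p ^ m ≤ ((p : ℝ)⁻¹) ^ j :=
    (pow_le_of_le_one (by positivity) (pow_le_one₀ h0.le h1.le)
      (pow_ne_zero _ hp.out.ne_zero)).trans (pow_le_pow_of_le_one h0.le h1.le (Nat.le_succ j))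
  rw [mul_pow, hKj]
  refine (mul_le_mul_of_nonneg_right hle (by positivity)).trans (le_of_eq ?_)
  rw [pow_add, inv_pow, inv_pow]
  field_simp

/-- Writing `x = [c_0] + p x'` shows that the defect of multiplicativity at `(x, y)` is `p` times the
defect at `(x', y)`. Iteration shows that it is arbitrarily small. -/
lemma untilt_mul {x y : Warrow p (PowSeq p R)} (hx : DigitsVanish (p : ℝ)⁻¹ x)
    (hy : DigitsVanish (p : ℝ)⁻¹ y) (m : ℕ) : untilt (x * y) m = untilt x m * untilt y m := by
  have h0 := PowSeq.inv_p_pos p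
  have h1 := PowSeq.inv_p_lt_one p
  have hk := pow_ne_zero m hp.out.ne_zero
  -- The defect of multiplicativity is divisible by `p`.
  have step : ∀ z : Warrow p (PowSeq p R), DigitsVanish (p : ℝ)⁻¹ z →
      untilt (z * y) m - untilt z m * untilt y m =
        p * (untilt (divP z * y) m - untilt (divP z) m * untilt y m) := fun z hz => by
    have e : z * y = teich (digit z 0) * y + (p : Warrow p (PowSeq p R)) * (divP z * y) := by
      rw [← mul_assoc, ← add_mul, ← eq_teich_add_p_mul]
    have ht : DigitsVanish (p : ℝ)⁻¹ (teich (digit z 0) * y) := by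
      have := hy.const_mul ‖(digit z 0).coeff 0‖
      rw [mul_zero] at this
      refine squeeze_zero (fun i => mul_nonneg (pow_pos h0 i).le (digitNorm_nonneg _ i))
        (fun i => ?_) this
      rw [mul_left_comm]
      refine mul_le_mul_of_nonneg_left ?_ (pow_pos h0 i).le
      rw [digitNorm, digit_teich_mul]
      exact norm_mul_le _ _
    have hpz : DigitsVanish (p : ℝ)⁻¹ ((p : Warrow p (PowSeq p R)) * (divP z * y)) := by
      have := (hz.mul h0 h1 hy).add h0 h1 (ht.neg h0 h1)
      rwa [e, add_neg_cancel_comm] at this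
    rw [e, untilt_add ht hpz, untilt_teich_mul _ hy ht, untilt_p_mul hpz, untilt_eq_add hz]
    ring
  have iter : ∀ N : ℕ, untilt (x * y) m - untilt x m * untilt y m =
      (p : R) ^ N * (untilt (divP^[N] x * y) m - untilt (divP^[N] x) m * untilt y m) := fun N => by
    induction N with
    | zero => simp
    | succ N ih =>
      rw [ih, step _ (hx.divP_iterate h0 N), Function.iterate_succ_apply', pow_succ, mul_assoc]
  obtain ⟨M, hM, hyM⟩ := hy.exists_bound
  refine sub_eq_zero.mp (eq_zero_of_pow_le (k := p ^ m) (C := M) hk fun ε hε => ?_)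
  obtain ⟨N, hN⟩ := hx.exists_forall_le hε
  have hxN := hx.divP_iterate h0 N
  have hb : ∀ i, ((p : ℝ)⁻¹) ^ i * digitNorm (divP^[N] x) i ≤ ε / ((p : ℝ)⁻¹) ^ N := fun i => by
    rw [le_div_iff₀ (pow_pos h0 N), digitNorm, digit_divP_iterate, mul_right_comm, ← pow_add]
    exact hN (i + N) (Nat.le_add_left _ _)
  have hb2 : ∀ i, ((p : ℝ)⁻¹) ^ i * digitNorm (divP^[N] x * y) i ≤ ε / ((p : ℝ)⁻¹) ^ N * M :=
    fun k => by
      rw [← le_div_iff₀' (pow_pos h0 k)]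
      refine digitNorm_mul_le fun i j hij => ?_
      rw [le_div_iff₀' (pow_pos h0 k)]
      have hu := mul_nonneg (pow_pos h0 i).le (digitNorm_nonneg (divP^[N] x) i)
      have hv := mul_nonneg (pow_pos h0 j).le (digitNorm_nonneg y j)
      refine le_trans ?_ (mul_le_mul (hb i) (hyM j) hv (by positivity))
      rw [mul_mul_mul_comm, ← pow_add]
      exact mul_le_mul_of_nonneg_right (pow_le_pow_of_le_one h0.le h1.le hij)
        (mul_nonneg (digitNorm_nonneg _ _) (digitNorm_nonneg _ _))
  have hd : ‖untilt (divP^[N] x * y) m - untilt (divP^[N] x) m * untilt y m‖ ^ p ^ m ≤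
      ε / ((p : ℝ)⁻¹) ^ N * M := by
    have k1 := norm_untilt_pow_le (hxN.mul h0 h1 hy) hb2 m
    have k2 : ‖untilt (divP^[N] x) m * untilt y m‖ ^ p ^ m ≤ ε / ((p : ℝ)⁻¹) ^ N * M := by
      refine (pow_le_pow_left₀ (norm_nonneg _) (norm_mul_le _ _) _).trans ?_
      rw [mul_pow]
      exact mul_le_mul (norm_untilt_pow_le hxN hb m) (norm_untilt_pow_le hy hyM m) (by positivity)
        (by positivity)
    refine (pow_le_pow_left₀ (norm_nonneg _) (h.norm_sub_le_max _ _) _).trans ?_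
    rcases le_total ‖untilt (divP^[N] x * y) m‖ ‖untilt (divP^[N] x) m * untilt y m‖ with hh | hh
    · rwa [max_eq_right hh]
    · rwa [max_eq_left hh]
  rw [iter N, h.norm_p_pow_mul, mul_pow]
  refine (mul_le_mul (pow_le_of_le_one (pow_nonneg h0.le N) (pow_le_one₀ h0.le h1.le) hk) hd
    (by positivity) (by positivity)).trans (le_of_eq ?_)
  rw [← mul_assoc, mul_div_cancel₀ _ (pow_pos h0 N).ne', mul_comm]

/-- If `untilt x = 0`, then each entry `(c_0)_m` of the leading digit is divisible by `p` with bounded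
quotient, in the sense of `p ^ m`-th powers of norms. Hence `c_0` has arbitrarily small norm. -/
lemma digit_zero_eq_zero_of_untilt {x : Warrow p (PowSeq p R)} (hx : DigitsVanish (p : ℝ)⁻¹ x)
    (h0x : ∀ m, untilt x m = 0) : digit x 0 = 0 := by
  have h0 := PowSeq.inv_p_pos p
  have h1 := PowSeq.inv_p_lt_one p
  obtain ⟨M, hM, hxM⟩ := (hx.divP h0).exists_bound
  have hm : ∀ m, digitNorm x 0 ≤ ((p : ℝ)⁻¹) ^ m * M := fun m => by
    have e : (digit x 0).coeff m = -(p * untilt (divP x) m) := by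
      rw [eq_neg_iff_add_eq_zero, ← untilt_eq_add hx, h0x]
    rw [← norm_digit_coeff_pow x 0 m, e, norm_neg, h.norm_p_mul, mul_pow]
    exact mul_le_mul (pow_le_pow_of_le_one h0.le h1.le (Nat.lt_pow_self hp.out.one_lt).le)
      (norm_untilt_pow_le (hx.divP h0) hxM m) (by positivity) (by positivity)
  have hz : digitNorm x 0 = 0 := by
    have hl := (tendsto_pow_atTop_nhds_zero_of_lt_one h0.le h1).mul_const M
    rw [zero_mul] at hl
    exact le_antisymm (ge_of_tendsto' hl hm) (digitNorm_nonneg x 0)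
  refine PowSeq.ext (funext fun m => norm_eq_zero.mp ?_)
  refine (pow_eq_zero_iff (pow_ne_zero m hp.out.ne_zero)).mp ?_
  rw [norm_digit_coeff_pow, hz]

lemma eq_zero_of_untilt {x : Warrow p (PowSeq p R)} (hx : DigitsVanish (p : ℝ)⁻¹ x)
    (h0x : ∀ m, untilt x m = 0) : x = 0 := by
  have h0 := PowSeq.inv_p_pos p
  have hN : ∀ N m, untilt (divP^[N] x) m = 0 := fun N => by
    induction N with
    | zero => exact h0x
    | succ N ih =>
      intro m
      have h1 := untilt_eq_add (hx.divP_iterate h0 N) m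
      rw [ih m, digit_zero_eq_zero_of_untilt (hx.divP_iterate h0 N) ih, PowSeq.zero_val,
        zero_add, ← mul_zero (p : R)] at h1
      rw [Function.iterate_succ_apply']
      exact (h.isUnit_p.mul_left_cancel h1).symm
  refine ext_digit fun i => ?_
  have := digit_zero_eq_zero_of_untilt (hx.divP_iterate h0 i) (hN i)
  rw [digit_divP_iterate, zero_add] at this
  rw [this]
  exact (entry_zero i le_rfl).symm

variable (p R) in
/-- The homomorphism taking `x = ∑ p ^ i [c_i]` to the element of the inverse limit over `R` whose
terms have the leading components `∑ p ^ i (c_i)_m`. -/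
noncomputable def untiltHom :
    digitsVanishSubring (p := p) (R := R) (PowSeq.inv_p_pos p) (PowSeq.inv_p_lt_one p) →+*
      Warrow p R :=
  ((ghostEquiv h.isUnit_p).symm : (ℕ → R) →+* Warrow p R).comp
    { toFun := fun x => untilt x.1
      map_one' := funext fun m => by
        rw [OneMemClass.coe_one, ← teich_one, untilt_teich]
        rfl
      map_mul' := fun x y => funext fun m => untilt_mul x.2 y.2 m
      map_zero' := funext fun m => by
        have := untilt_add (p := p) (R := R) (Subring.zero_mem (digitsVanishSubring
          (PowSeq.inv_p_pos p) (PowSeq.inv_p_lt_one p))) (Subring.zero_mem (digitsVanishSubring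
          (PowSeq.inv_p_pos p) (PowSeq.inv_p_lt_one p))) m
        rw [add_zero] at this
        exact left_eq_add.mp this
      map_add' := fun x y => funext fun m => untilt_add x.2 y.2 m }

lemma entry_untiltHom_zero (x : digitsVanishSubring (p := p) (R := R) (PowSeq.inv_p_pos p)
    (PowSeq.inv_p_lt_one p)) (m : ℕ) : entry (untiltHom p R x) m 0 = untilt x.1 m :=
  congrFun ((ghostEquiv h.isUnit_p).apply_symm_apply (untilt x.1)) m

lemma untiltHom_injective : Function.Injective (untiltHom p R) := by
  refine (injective_iff_map_eq_zero _).mpr fun x hx => Subtype.ext (eq_zero_of_untilt x.2 fun m => ?_)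
  rw [← entry_untiltHom_zero, hx]
  exact entry_zero m (Nat.zero_le m)

end Untilt

end Warrow

namespace Warrow

open WittVector

/-! ### Bounds on the image of the untilting homomorphism -/

section Level

variable {p : ℕ} [hp : Fact p.Prime] {S : Type*} [CommRing S]

/-- The elements whose `n`-th term has its component of index `p ^ i` in the part of degree `p ^ i`
of a given filtration. -/
def levelSubmonoid (G : ℕ → AddSubgroup S) [SetLike.GradedMonoid G] (n : ℕ) :
    AddSubmonoid (Warrow p S) where
  carrier := {y | ∀ i ≤ n, entry y n i ∈ G (p ^ i)}
  zero_mem' i hi := by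
    rw [entry_zero n hi]
    exact zero_mem _
  add_mem' {x y} hx hy i hi := by
    rw [entry_add x y hi]
    exact coeff_add_mem G (fun j hj => hx j (hj.trans hi)) (fun j hj => hy j (hj.trans hi))

/-- The filtration which is equal to a subring in every degree. -/
def constFiltration (A : Subring S) (_ : ℕ) : AddSubgroup S := A.toAddSubgroup

instance constFiltration_graded (A : Subring S) :
    SetLike.GradedMonoid (constFiltration A) where
  one_mem := A.one_mem
  mul_mem _ _ _ _ hx hy := A.mul_mem hx hy

end Level

section Bounds

variable {p : ℕ} [hp : Fact p.Prime] {R : Type*} [NormedCommRing R] [h : IsPAdicBanach p R]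

/-- Convergence of the leading components implies convergence of all components, as these are
continuous functions of the leading components. -/
lemma tendsto_entry {Y : ℕ → Warrow p R} {y : Warrow p R}
    (hY : ∀ m, Tendsto (fun N => entry (Y N) m 0) atTop (𝓝 (entry y m 0))) {n i : ℕ}
    (hi : i ≤ n) : Tendsto (fun N => entry (Y N) n i) atTop (𝓝 (entry y n i)) := by
  induction i using Nat.strong_induction_on with
  | _ i ih =>
    obtain ⟨v, hv⟩ := (h.isUnit_p.pow i).exists_left_inv
    have e : ∀ z : Warrow p R, entry z n i = v * (entry z (n - i) 0 -
        ∑ k ∈ Finset.range i, (p : R) ^ k * entry z n k ^ p ^ (i - k)) := fun z => by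
      have := entry_zero_eq_sum z (n - i) i
      rw [Nat.sub_add_cancel hi, Finset.sum_range_succ, Nat.sub_self, pow_zero, pow_one] at this
      rw [this, add_sub_cancel_left, ← mul_assoc, hv, one_mul]
    rw [e y]
    refine Tendsto.congr (fun N => (e (Y N)).symm) (((hY _).sub
      (tendsto_finsetSum _ fun k hk => ?_)).const_mul v)
    rw [Finset.mem_range] at hk
    exact ((ih k hk (hk.le.trans hi)).pow _).const_mul _

/-- The element of the inverse limit over `R` with terms `[c_n]`. -/
noncomputable def teichR (c : PowSeq p R) : Warrow p R := (ghostEquiv h.isUnit_p).symm c.coeff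

lemma entry_teichR_zero (c : PowSeq p R) (n : ℕ) : entry (teichR c) n 0 = c.coeff n :=
  congrFun ((ghostEquiv h.isUnit_p).apply_symm_apply c.coeff) n

lemma entry_teichR_pos (c : PowSeq p R) {n i : ℕ} (hi0 : 0 < i) (hi : i ≤ n) :
    entry (teichR c) n i = 0 := by
  induction i using Nat.strong_induction_on with
  | _ i ih =>
    have e := entry_zero_eq_sum (teichR c) (n - i) i
    rw [Nat.sub_add_cancel hi, Finset.sum_range_succ, Nat.sub_self, pow_zero, pow_one,
      Finset.sum_eq_single_of_mem 0 (Finset.mem_range.mpr hi0) fun k hk hk0 => by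
        rw [Finset.mem_range] at hk
        rw [ih k hk (Nat.pos_of_ne_zero hk0) (hk.le.trans hi),
          zero_pow (pow_ne_zero _ hp.out.ne_zero), mul_zero],
      pow_zero, one_mul, entry_teichR_zero, entry_teichR_zero, Nat.sub_zero] at e
    have e2 := PowSeq.coeff_add_pow c (n - i) i
    rw [Nat.sub_add_cancel hi] at e2
    rw [e2, left_eq_add] at e
    exact (h.isUnit_p.pow i).mul_right_eq_zero.mp e

lemma p_pow_mul_eq_nsmul (i : ℕ) (y : Warrow p R) :
    (p : Warrow p R) ^ i * y = (p ^ i) • y := by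
  rw [nsmul_eq_mul, Nat.cast_pow]

lemma entry_p_pow_mul_zero (i : ℕ) (y : Warrow p R) (m : ℕ) :
    entry ((p : Warrow p R) ^ i * y) m 0 = (p : R) ^ i * entry y m 0 := by
  rw [← ghost_apply, map_mul, map_pow, map_natCast]
  rfl

lemma norm_entry_p_pow_teichR_le (c : PowSeq p R) (i : ℕ) {n j : ℕ} (hj : j ≤ n) :
    ‖entry ((p : Warrow p R) ^ i * teichR c) n j‖ ≤ ‖c.coeff n‖ ^ p ^ j := by
  have hmem : teichR c ∈ levelSubmonoid (h.ball (norm_nonneg (c.coeff n))) n := fun k hk => by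
    rcases Nat.eq_zero_or_pos k with rfl | hk0
    · rw [entry_teichR_zero]
      exact (pow_one ‖c.coeff n‖).ge
    · rw [entry_teichR_pos c hk0 hk]
      exact zero_mem _
  rw [p_pow_mul_eq_nsmul]
  exact nsmul_mem hmem (p ^ i) j hj

/-- The component of index `p ^ j` of `p ^ i` is divisible by `p ^ (i - j)`. -/
lemma norm_entry_p_pow_teichR_le' (c : PowSeq p R) {i n j : ℕ} (hj : j ≤ n) (hji : j ≤ i) :
    ‖entry ((p : Warrow p R) ^ i * teichR c) n j‖ ≤
      ((p : ℝ)⁻¹) ^ (i - j) * ‖c.coeff n‖ ^ p ^ j := by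
  have h0 := PowSeq.inv_p_pos p
  have h1 := PowSeq.inv_p_lt_one p
  induction j using Nat.strong_induction_on with
  | _ j ih =>
    have e := entry_zero_eq_sum ((p : Warrow p R) ^ i * teichR c) (n - j) j
    rw [Nat.sub_add_cancel hj, Finset.sum_range_succ, Nat.sub_self, pow_zero, pow_one,
      entry_p_pow_mul_zero, entry_teichR_zero, ← sub_eq_iff_eq_add'] at e
    refine h.norm_le_of_p_pow_mul (i := j) ?_
    rw [← e, ← mul_assoc, ← pow_add, Nat.add_sub_cancel' hji]
    refine (h.norm_sub_le_max _ _).trans (max_le ?_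
      (PowSeq.norm_sum_le h.toIsPAdicNormed _ _ (by positivity) fun k hk => ?_))
    · have e2 := PowSeq.coeff_add_pow c (n - j) j
      rw [Nat.sub_add_cancel hj] at e2
      rw [h.norm_p_pow_mul, ← e2, h.pow _ _ (pow_pos hp.out.pos j)]
    · rw [Finset.mem_range] at hk
      rw [h.norm_p_pow_mul, h.pow _ _ (pow_pos hp.out.pos _)]
      refine (mul_le_mul_of_nonneg_left (pow_le_pow_left₀ (norm_nonneg _)
        (ih k hk (hk.le.trans hj) (hk.le.trans hji)) _) (by positivity)).trans ?_
      rw [mul_pow, ← pow_mul, ← pow_mul, ← pow_add, Nat.add_sub_cancel' hk.le, ← mul_assoc,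
        ← pow_add]
      refine mul_le_mul_of_nonneg_right (pow_le_pow_of_le_one h0.le h1.le ?_) (by positivity)
      have := Nat.le_mul_of_pos_right (i - k) (pow_pos hp.out.pos (j - k))
      omega

lemma level_p_pow_teichR_le {q : ℝ} (hq : (p : ℝ)⁻¹ ≤ q) (c : PowSeq p R) {i n : ℕ} {M : ℝ}
    (hM : q ^ max i n * ‖c.coeff 0‖ ≤ M) {j : ℕ} (hj : j ≤ n) :
    q ^ n * ‖entry ((p : Warrow p R) ^ i * teichR c) n j‖ ^ p ^ (n - j) ≤ M := by
  have h0 := PowSeq.inv_p_pos p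
  have h1 := PowSeq.inv_p_lt_one p
  have hq0 := h0.trans_le hq
  have hc : (‖c.coeff n‖ ^ p ^ j) ^ p ^ (n - j) = ‖c.coeff 0‖ := by
    rw [← pow_mul, ← pow_add, Nat.add_sub_cancel' hj, PowSeq.norm_coeff_pow]
  refine le_trans ?_ hM
  rcases le_total i n with hin | hin
  · rw [max_eq_right hin, ← hc]
    exact mul_le_mul_of_nonneg_left (pow_le_pow_left₀ (norm_nonneg _)
      (norm_entry_p_pow_teichR_le c i hj) _) (pow_pos hq0 n).le
  · rw [max_eq_left hin]
    refine (mul_le_mul_of_nonneg_left (pow_le_pow_left₀ (norm_nonneg _)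
      (norm_entry_p_pow_teichR_le' c hj (hj.trans hin)) _) (pow_pos hq0 n).le).trans ?_
    rw [mul_pow, hc, ← mul_assoc, ← pow_mul]
    refine mul_le_mul_of_nonneg_right ?_ (norm_nonneg _)
    have hle : ((p : ℝ)⁻¹) ^ ((i - j) * p ^ (n - j)) ≤ q ^ (i - n) := by
      refine (pow_le_pow_of_le_one h0.le h1.le ?_).trans (pow_le_pow_left₀ h0.le hq _)
      exact (Nat.sub_le_sub_left hj i).trans
        (Nat.le_mul_of_pos_right _ (pow_pos hp.out.pos _))
    refine (mul_le_mul_of_nonneg_left hle (pow_pos hq0 n).le).trans (le_of_eq ?_)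
    rw [← pow_add, Nat.add_sub_cancel' hin]

/-- The elements with `p ^ (-i) * |c_i| → 0`, for which the untilting homomorphism is defined. -/
noncomputable abbrev ConvergentSubring (p : ℕ) [Fact p.Prime] (R : Type*) [NormedCommRing R]
    [IsPAdicBanach p R] : Subring (Warrow p (PowSeq p R)) :=
  digitsVanishSubring (PowSeq.inv_p_pos p) (PowSeq.inv_p_lt_one p)

/-- The image of `∑ p ^ i [c_i]` is the limit of the finite partial sums. -/
lemma tendsto_entry_sum (x : ConvergentSubring p R) {n j : ℕ} (hj : j ≤ n) :
    Tendsto (fun N => entry (∑ i ∈ Finset.range N, (p : Warrow p R) ^ i * teichR (digit x.1 i)) n j)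
      atTop (𝓝 (entry (untiltHom p R x) n j)) := by
  refine tendsto_entry (fun m => ?_) hj
  rw [entry_untiltHom_zero]
  refine (tendsto_untilt x.2 m).congr fun N => ?_
  rw [← ghost_apply, map_sum, Finset.sum_apply]
  refine Finset.sum_congr rfl fun i _ => ?_
  rw [ghost_apply, entry_p_pow_mul_zero, entry_teichR_zero]

/-- The untilting homomorphism does not increase the level norms, because the terms `p ^ i [c_i]`
satisfy the bound and the elements satisfying it form a closed subgroup. -/
lemma level_untiltHom_le {q : ℝ} (hq : (p : ℝ)⁻¹ ≤ q) (x : ConvergentSubring p R) {n : ℕ} {M : ℝ}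
    (hM : ∀ i, q ^ max i n * digitNorm x.1 i ≤ M) {j : ℕ} (hj : j ≤ n) :
    q ^ n * ‖entry (untiltHom p R x) n j‖ ^ p ^ (n - j) ≤ M := by
  have hq0 := (PowSeq.inv_p_pos p).trans_le hq
  have hM0 : 0 ≤ M := (mul_nonneg (pow_pos hq0 _).le (digitNorm_nonneg x.1 0)).trans (hM 0)
  obtain ⟨K, hK, hKe⟩ := exists_nonneg_pow_eq (pow_ne_zero n hp.out.ne_zero)
    (div_nonneg hM0 (pow_pos hq0 n).le)
  have key : ∀ z : Warrow p R, ∀ k ≤ n,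
      q ^ n * ‖entry z n k‖ ^ p ^ (n - k) ≤ M ↔ ‖entry z n k‖ ≤ K ^ p ^ k := fun z k hk => by
    rw [← pow_le_root_iff hK (norm_nonneg _) hk, hKe, le_div_iff₀' (pow_pos hq0 n)]
  rw [key _ j hj]
  refine le_of_tendsto (tendsto_entry_sum x hj).norm (Eventually.of_forall fun N => ?_)
  have hmem : ∑ i ∈ Finset.range N, (p : Warrow p R) ^ i * teichR (digit x.1 i) ∈
      levelSubmonoid (h.ball hK) n := sum_mem fun i _ k hk =>
    (key _ k hk).mp (level_p_pow_teichR_le hq _ (hM i) hk)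
  exact hmem j hj

/-- If the entries of all digits lie in a closed subring, then so do all components of the
image. -/
lemma entry_untiltHom_mem {A : Subring R} (hA : IsClosed (A : Set R)) (x : ConvergentSubring p R)
    (hx : ∀ i m, (digit x.1 i).coeff m ∈ A) {n j : ℕ} (hj : j ≤ n) :
    entry (untiltHom p R x) n j ∈ A := by
  refine hA.mem_of_tendsto (tendsto_entry_sum x hj) (Eventually.of_forall fun N => ?_)
  have hmem : ∑ i ∈ Finset.range N, (p : Warrow p R) ^ i * teichR (digit x.1 i) ∈
      levelSubmonoid (constFiltration A) n := sum_mem fun i _ => by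
    rw [p_pow_mul_eq_nsmul]
    refine nsmul_mem (fun k hk => ?_) _
    rcases Nat.eq_zero_or_pos k with rfl | hk0
    · rw [entry_teichR_zero]
      exact hx i n
    · rw [entry_teichR_pos _ hk0 hk]
      exact zero_mem _
  exact hmem j hj

/-! ### Surjectivity of the untilting homomorphism -/

/-- For fixed `i` the `p ^ l`-th powers of the components of index `p ^ i` form a sequence whose
successive differences are small. -/
lemma norm_entry_pow_sub_le (y : Warrow p R) {B : ℕ → ℝ}
    (hB : ∀ n, ∀ i ≤ n, ‖entry y n i‖ ^ p ^ (n - i) ≤ B n) (i m l : ℕ) :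
    ‖entry y (i + m + (l + 1)) i ^ p ^ (l + 1) - entry y (i + m + l) i ^ p ^ l‖ ^ p ^ m ≤
      ((p : ℝ)⁻¹) ^ p ^ m * (((p : ℝ)⁻¹) ^ l * B (i + m + l + 1)) := by
  have h0 := PowSeq.inv_p_pos p
  have h1 := PowSeq.inv_p_lt_one p
  have hB0 : 0 ≤ B (i + m + l + 1) :=
    (pow_nonneg (norm_nonneg _) _).trans (hB _ 0 (Nat.zero_le _))
  obtain ⟨K, hK, hKe⟩ := exists_nonneg_pow_eq (pow_ne_zero (i + m + l + 1) hp.out.ne_zero) hB0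
  have hy : ∀ k ≤ i + m + l + 1, ‖entry y (i + m + l + 1) k‖ ≤ K ^ p ^ k := fun k hk => by
    rw [← pow_le_root_iff hK (norm_nonneg _) hk, hKe]
    exact hB _ k hk
  have d1 := h.norm_entry_sub_pow_le y hK hy (show i ≤ i + m + l by omega)
  have d2 := PowSeq.norm_pow_pow_sub_le h.toIsPAdicNormed (C := K ^ p ^ (i + 1)) (by
    rw [h.pow _ _ hp.out.pos, pow_succ p i, pow_mul]
    exact pow_le_pow_left₀ (norm_nonneg _) (hy i (by omega)) _) d1 l
  rw [← pow_mul, ← pow_succ', norm_sub_rev, ← pow_mul, ← pow_add] at d2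
  refine (pow_le_pow_left₀ (norm_nonneg _) d2 _).trans ?_
  rw [mul_pow, ← pow_mul K, ← pow_add, show i + 1 + l + m = i + m + l + 1 by omega, hKe, ← mul_assoc]
  refine mul_le_mul_of_nonneg_right ?_ hB0
  rw [pow_succ', mul_pow]
  exact mul_le_mul_of_nonneg_left (pow_le_of_le_one (by positivity) (pow_le_one₀ h0.le h1.le)
    (pow_ne_zero _ hp.out.ne_zero)) (by positivity)

/-- The components of index `p ^ i` of the terms of `y` are compatible under the `p`-power map modulo
`p`. The limits of their powers are the entries of the digits of an element over `PowSeq p R`. -/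
lemma exists_digits (y : Warrow p R) {B : ℕ → ℝ}
    (hB : ∀ n, ∀ i ≤ n, ‖entry y n i‖ ^ p ^ (n - i) ≤ B n)
    (hB0 : Tendsto (fun n => ((p : ℝ)⁻¹) ^ n * B n) atTop (𝓝 0)) :
    ∃ x : Warrow p (PowSeq p R), ∀ i m,
      Tendsto (fun l => entry y (i + m + l) i ^ p ^ l) atTop (𝓝 ((digit x i).coeff m)) := by
  have h0 := PowSeq.inv_p_pos p
  have hlim : ∀ i m, ∃ L, Tendsto (fun l => entry y (i + m + l) i ^ p ^ l) atTop (𝓝 L) :=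
    fun i m => by
      refine h.exists_tendsto ?_
      have hb : Tendsto (fun l => ((p : ℝ)⁻¹) ^ p ^ m * ((p : ℝ) ^ (i + m + 1) *
          (((p : ℝ)⁻¹) ^ (l + (i + m + 1)) * B (l + (i + m + 1))))) atTop (𝓝 0) := by
        have := ((hB0.comp (tendsto_add_atTop_nat (i + m + 1))).const_mul
          ((p : ℝ) ^ (i + m + 1))).const_mul (((p : ℝ)⁻¹) ^ p ^ m)
        simpa only [mul_zero, Function.comp_def] using this
      refine tendsto_zero_of_pow_le (p ^ m) (fun _ => norm_nonneg _) (fun l => ?_) hb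
      refine (norm_entry_pow_sub_le y hB i m l).trans (le_of_eq ?_)
      have hp0 : (p : ℝ) ≠ 0 := by exact_mod_cast hp.out.ne_zero
      have e : ((p : ℝ)⁻¹) ^ (l + (i + m + 1)) * (p : ℝ) ^ (i + m + 1) = ((p : ℝ)⁻¹) ^ l := by
        rw [pow_add _ l, mul_assoc, ← mul_pow, inv_mul_cancel₀ hp0, one_pow, mul_one]
      rw [show i + m + l + 1 = l + (i + m + 1) by omega, ← e]
      ring
  choose L hL using hlim
  refine ⟨ofDigits fun i => ⟨L i, fun m => ?_⟩, fun i m => by rw [digit_ofDigits]; exact hL i m⟩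
  refine tendsto_nhds_unique ((hL i (m + 1)).pow p)
    (((hL i m).comp (tendsto_add_atTop_nat 1)).congr fun l => ?_)
  rw [Function.comp_apply, ← pow_mul, ← pow_succ, show i + (m + 1) + l = i + m + (l + 1) by omega]

/-- The leading entries of the components of `x` agree with the components of `y` modulo `p`. -/
lemma norm_coeff_sub_entry_le {x : Warrow p (PowSeq p R)} {y : Warrow p R} {B : ℕ → ℝ}
    (hB : ∀ n, ∀ i ≤ n, ‖entry y n i‖ ^ p ^ (n - i) ≤ B n)
    (hxy : ∀ i m, Tendsto (fun l => entry y (i + m + l) i ^ p ^ l) atTop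
      (𝓝 ((digit x i).coeff m))) {n i : ℕ} (hi : i ≤ n) {K : ℝ} (hK : 0 ≤ K)
    (hBK : ∀ l, ((p : ℝ)⁻¹) ^ l * B (n + l + 1) ≤ K ^ p ^ n) :
    ‖(entry x n i).coeff 0 - entry y n i‖ ≤ (p : ℝ)⁻¹ * K ^ p ^ i := by
  have h0 := PowSeq.inv_p_pos p
  obtain ⟨m, rfl⟩ := Nat.exists_eq_add_of_le hi
  rw [entry_coeff x hi, Nat.add_sub_cancel_left, add_zero]
  have := h.norm_limit_sub_le (hxy i m) (N := 0) (C := (p : ℝ)⁻¹ * K ^ p ^ i) (by positivity)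
    fun l _ => by
      refine (pow_le_pow_iff_left₀ (norm_nonneg _) (by positivity)
        (pow_ne_zero m hp.out.ne_zero)).mp ((norm_entry_pow_sub_le y hB i m l).trans ?_)
      rw [mul_pow, ← pow_mul K, ← pow_add]
      exact mul_le_mul_of_nonneg_left (hBK l) (by positivity)
  simpa using this

/-- The `i`-th digit is bounded by the level norms of index `n ≥ i`. -/
lemma digitNorm_le_of_level_le {x : Warrow p (PowSeq p R)} {y : Warrow p R} {B : ℕ → ℝ}
    (hB : ∀ n, ∀ i ≤ n, ‖entry y n i‖ ^ p ^ (n - i) ≤ B n)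
    (hxy : ∀ i m, Tendsto (fun l => entry y (i + m + l) i ^ p ^ l) atTop
      (𝓝 ((digit x i).coeff m))) {q : ℝ} (hq : (p : ℝ)⁻¹ ≤ q) {M : ℝ} {i : ℕ}
    (hM : ∀ n ≥ i, q ^ n * B n ≤ M) : q ^ i * digitNorm x i ≤ M := by
  have h0 := PowSeq.inv_p_pos p
  have hq0 := h0.trans_le hq
  have hB0 : ∀ n, 0 ≤ B n := fun n => (pow_nonneg (norm_nonneg _) _).trans (hB n 0 (Nat.zero_le n))
  have hM0 : 0 ≤ M := (mul_nonneg (pow_pos hq0 i).le (hB0 i)).trans (hM i le_rfl)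
  rw [← le_div_iff₀' (pow_pos hq0 i)]
  have h1 : ‖entry y i i‖ ≤ M / q ^ i := by
    rw [le_div_iff₀' (pow_pos hq0 i)]
    refine le_trans (mul_le_mul_of_nonneg_left ?_ (pow_pos hq0 i).le) (hM i le_rfl)
    simpa using hB i i le_rfl
  have h2 := h.norm_limit_sub_le (hxy i 0) (N := 0) (C := M / q ^ i)
    (div_nonneg hM0 (pow_pos hq0 i).le) fun l _ => by
      have d := norm_entry_pow_sub_le y hB i 0 l
      rw [pow_zero, pow_one, pow_one, ← mul_assoc, ← pow_succ', add_zero] at d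
      rw [add_zero, le_div_iff₀' (pow_pos hq0 i)]
      refine le_trans (mul_le_mul_of_nonneg_left (d.trans (mul_le_mul_of_nonneg_right
        (pow_le_pow_left₀ h0.le hq (l + 1)) (hB0 _))) (pow_pos hq0 i).le)
        (le_trans (le_of_eq ?_) (hM (i + l + 1) (by omega)))
      rw [← mul_assoc, ← pow_add, add_assoc]
  rw [add_zero, add_zero, pow_zero, pow_one] at h2
  rw [digitNorm, ← sub_add_cancel ((digit x i).coeff 0) (entry y i i)]
  exact (h.ultra _ _).trans (max_le h2 h1)

/-- The element with the constructed digits is a preimage of `y`: the partial sums of its digits are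
ghost components of Witt vectors whose components agree with those of `y` modulo `p`. -/
lemma untilt_eq_entry {x : Warrow p (PowSeq p R)} (hx : DigitsVanish (p : ℝ)⁻¹ x)
    {y : Warrow p R} {B : ℕ → ℝ} (hB : ∀ n, ∀ i ≤ n, ‖entry y n i‖ ^ p ^ (n - i) ≤ B n)
    (hB0 : Tendsto (fun n => ((p : ℝ)⁻¹) ^ n * B n) atTop (𝓝 0))
    (hxy : ∀ i m, Tendsto (fun l => entry y (i + m + l) i ^ p ^ l) atTop
      (𝓝 ((digit x i).coeff m))) (m : ℕ) : untilt x m = entry y m 0 := by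
  have h0 := PowSeq.inv_p_pos p
  have h1 := PowSeq.inv_p_lt_one p
  have hp0 : (0 : ℝ) < p := by exact_mod_cast hp.out.pos
  refine sub_eq_zero.mp (eq_zero_of_pow_le (k := p ^ m) (C := (p : ℝ) ^ m)
    (pow_ne_zero m hp.out.ne_zero) fun ε hε => ?_)
  have lim := (((tendsto_untilt hx m).sub_const (entry y m 0)).norm.pow (p ^ m)).comp
    (tendsto_add_atTop_nat 1)
  obtain ⟨N, hN⟩ := eventually_atTop.mp (hB0.eventually (gt_mem_nhds hε))
  refine le_of_tendsto lim (eventually_atTop.mpr ⟨N, fun j hj => ?_⟩)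
  have hBn : ∀ n ≥ N, B n ≤ ε / ((p : ℝ)⁻¹) ^ n := fun n hn => by
    rw [le_div_iff₀' (pow_pos h0 n)]
    exact (hN n hn).le
  obtain ⟨K, hK, hKe⟩ := exists_nonneg_pow_eq (pow_ne_zero (m + j) hp.out.ne_zero)
    (div_pos hε (pow_pos h0 (m + j + 1))).le
  have hv : ∀ i < j + 1, ‖entry y (m + j) i‖ ≤ K ^ p ^ i := fun i hi => by
    rw [← pow_le_root_iff hK (norm_nonneg _) (show i ≤ m + j by omega), hKe]
    refine (hB _ i (by omega)).trans ((hBn _ (by omega)).trans ?_)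
    exact div_le_div_of_nonneg_left hε.le (pow_pos h0 _)
      (pow_le_pow_of_le_one h0.le h1.le (Nat.le_succ _))
  have huv : ∀ i < j + 1, ‖(entry x (m + j) i).coeff 0 - entry y (m + j) i‖ ≤
      (p : ℝ)⁻¹ * K ^ p ^ i := fun i hi => by
    refine norm_coeff_sub_entry_le hB hxy (by omega) hK fun l => ?_
    rw [hKe, le_div_iff₀ (pow_pos h0 _), mul_right_comm, ← pow_add,
      show l + (m + j + 1) = m + j + l + 1 by omega]
    exact (hN _ (by omega)).le
  have gh := h.norm_ghost_sub_le hK le_rfl hv huv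
  rw [← entry_zero_eq_sum, sum_entry_eq] at gh
  refine (pow_le_pow_left₀ (norm_nonneg _) gh _).trans ?_
  have hle : (((p : ℝ)⁻¹) ^ (j + 1)) ^ p ^ m ≤ ((p : ℝ)⁻¹) ^ (j + 1) :=
    pow_le_of_le_one (by positivity) (pow_le_one₀ h0.le h1.le) (pow_ne_zero _ hp.out.ne_zero)
  rw [mul_pow, ← pow_mul K, ← pow_add, add_comm j m, hKe]
  refine (mul_le_mul_of_nonneg_right hle (by positivity)).trans (le_of_eq ?_)
  rw [add_assoc, pow_add _ m (j + 1), inv_pow, inv_pow]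
  field_simp

end Bounds

end Warrow

/-! ### Comparison of the overconvergence conditions -/

section LevelNorm

open Warrow

variable {p : ℕ} [hp : Fact p.Prime] {S : Type*} [CommRing S]

lemma wittSup_pow_le_iff {ν : S → ℝ} (hν : ∀ z, 0 ≤ ν z) (x : Warrow p S) (n : ℕ) (B : ℝ) :
    wittSup ν (x.1 n) ^ p ^ n ≤ B ↔ ∀ i ≤ n, ν (entry x n i) ^ p ^ (n - i) ≤ B := by
  have key : ∀ i : Fin (n + 1), (ν ((x.1 n).coeff i) ^ (1 / (p : ℝ) ^ (i : ℕ))) ^ p ^ n =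
      ν (entry x n i) ^ p ^ (n - i) := fun i => by
    have hi := Nat.lt_succ_iff.mp i.2
    have e : 1 / (p : ℝ) ^ (i : ℕ) = ((p ^ (i : ℕ) : ℕ) : ℝ)⁻¹ := by push_cast; rw [one_div]
    rw [e, show p ^ n = p ^ (i : ℕ) * p ^ (n - i) by rw [← pow_add, Nat.add_sub_cancel' hi],
      pow_mul, Real.rpow_inv_natCast_pow (hν _) (pow_ne_zero _ hp.out.ne_zero),
      entry_eq_coeff x hi]
  constructor
  · intro hB i hi
    rw [← key ⟨i, Nat.lt_succ_of_le hi⟩]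
    exact (pow_le_pow_left₀ (Real.rpow_nonneg (hν _) _)
      (le_ciSup (f := fun i : Fin (n + 1) => ν ((x.1 n).coeff i) ^ (1 / (p : ℝ) ^ (i : ℕ)))
        (Set.finite_range _).bddAbove _) _).trans hB
  · intro hB
    obtain ⟨i, hi⟩ := exists_eq_ciSup_of_finite
      (f := fun i : Fin (n + 1) => ν ((x.1 n).coeff i) ^ (1 / (p : ℝ) ^ (i : ℕ)))
    rw [wittSup, ← hi, key]
    exact hB i (Nat.lt_succ_iff.mp i.2)

lemma levelNorm_eq (ν : S → ℝ) (b : ℝ) (x : Warrow p S) (n : ℕ) :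
    levelNorm ν b x n = ((p : ℝ) ^ (-b)) ^ n * wittSup ν (x.1 n) ^ p ^ n := by
  rw [levelNorm, ← neg_mul, Real.rpow_mul_natCast (Nat.cast_nonneg p)]

lemma levelNorm_le_iff {ν : S → ℝ} (hν : ∀ z, 0 ≤ ν z) (b : ℝ) (x : Warrow p S) (n : ℕ) (M : ℝ) :
    levelNorm ν b x n ≤ M ↔
      ∀ i ≤ n, ((p : ℝ) ^ (-b)) ^ n * ν (entry x n i) ^ p ^ (n - i) ≤ M := by
  have hq : 0 < ((p : ℝ) ^ (-b)) ^ n :=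
    pow_pos (Real.rpow_pos_of_pos (by exact_mod_cast hp.out.pos) _) n
  rw [levelNorm_eq, ← le_div_iff₀' hq, wittSup_pow_le_iff hν]
  exact forall₂_congr fun i _ => le_div_iff₀' hq

lemma levelNorm_nonneg {ν : S → ℝ} (hν : ∀ z, 0 ≤ ν z) (b : ℝ) (x : Warrow p S) (n : ℕ) :
    0 ≤ levelNorm ν b x n :=
  mul_nonneg (Real.rpow_nonneg (Nat.cast_nonneg p) _)
    (pow_nonneg (Real.iSup_nonneg fun _ => Real.rpow_nonneg (hν _) _) _)

lemma mem_overconvergent_iff {ν : S → ℝ} (hν : ∀ z, 0 ≤ ν z) (b : ℝ) (x : Warrow p S) :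
    x ∈ overconvergent ν b ↔ ∀ ε > 0, ∃ N, ∀ n ≥ N, levelNorm ν b x n ≤ ε := by
  constructor
  · intro hx ε hε
    obtain ⟨N, hN⟩ := eventually_atTop.mp (Tendsto.eventually hx (gt_mem_nhds hε))
    exact ⟨N, fun n hn => (hN n hn).le⟩
  · intro hx
    refine Metric.tendsto_atTop.mpr fun ε hε => ?_
    obtain ⟨N, hN⟩ := hx (ε / 2) (half_pos hε)
    refine ⟨N, fun n hn => ?_⟩
    rw [Real.dist_0_eq_abs, abs_of_nonneg (levelNorm_nonneg hν b x n)]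
    exact (hN n hn).trans_lt (half_lt_self hε)

lemma rpow_neg_lt_one (p : ℕ) [hp : Fact p.Prime] {b : ℝ} (hb : 0 < b) : (p : ℝ) ^ (-b) < 1 :=
  Real.rpow_lt_one_of_one_lt_of_neg (one_lt_p p) (neg_lt_zero.mpr hb)

lemma rpow_neg_pos (p : ℕ) [hp : Fact p.Prime] (b : ℝ) : 0 < (p : ℝ) ^ (-b) :=
  Real.rpow_pos_of_pos (by exact_mod_cast hp.out.pos) _

lemma inv_le_rpow_neg (p : ℕ) [hp : Fact p.Prime] {b : ℝ} (hb : b ≤ 1) :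
    (p : ℝ)⁻¹ ≤ (p : ℝ) ^ (-b) := by
  rw [← Real.rpow_neg_one]
  exact Real.rpow_le_rpow_of_exponent_le (one_lt_p p).le (neg_le_neg hb)

variable {R : Type*} [NormedCommRing R]

section Normed

variable [h : IsPAdicNormed p R]

lemma levelNorm_powSeq_le_iff (b : ℝ) (x : Warrow p (PowSeq p R)) (n : ℕ) (M : ℝ) :
    levelNorm (fun z => ‖z.coeff 0‖) b x n ≤ M ↔
      ∀ i ≤ n, ((p : ℝ) ^ (-b)) ^ n * digitNorm x i ≤ M := by
  rw [levelNorm_le_iff (fun z => norm_nonneg _)]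
  exact forall₂_congr fun i hi => by rw [norm_entry_pow x hi, digitNorm]

lemma mem_overconvergent_iff_digitsVanish {b : ℝ} (hb : 0 < b) (x : Warrow p (PowSeq p R)) :
    x ∈ overconvergent (fun z => ‖z.coeff 0‖) b ↔ DigitsVanish ((p : ℝ) ^ (-b)) x := by
  rw [mem_overconvergent_iff (fun z => norm_nonneg _)]
  constructor
  · intro hx
    refine digitsVanish_of_forall_le (rpow_neg_pos p b) fun ε hε => ?_
    obtain ⟨N, hN⟩ := hx ε hε
    exact ⟨N, fun n hn => (levelNorm_powSeq_le_iff b x n ε).mp (hN n hn) n le_rfl⟩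
  · intro hx ε hε
    obtain ⟨N, hN⟩ := hx.exists_forall_forall_le (rpow_neg_pos p b) (rpow_neg_lt_one p hb) hε
    exact ⟨N, fun n hn => (levelNorm_powSeq_le_iff b x n ε).mpr (hN n hn)⟩

end Normed

variable [h : IsPAdicBanach p R]

lemma DigitsVanish.mono {q q' : ℝ} (hq : 0 < q) (hqq : q ≤ q') {x : Warrow p (PowSeq p R)}
    (hx : DigitsVanish q' x) : DigitsVanish q x :=
  squeeze_zero (fun i => mul_nonneg (pow_pos hq i).le (digitNorm_nonneg x i))
    (fun i => mul_le_mul_of_nonneg_right (pow_le_pow_left₀ hq.le hqq i) (digitNorm_nonneg x i)) hx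

lemma untiltHom_mem_overconvergent {b : ℝ} (hb : 0 < b) (hb1 : b ≤ 1) (x : ConvergentSubring p R)
    (hx : DigitsVanish ((p : ℝ) ^ (-b)) x.1) :
    untiltHom p R x ∈ overconvergent (fun r => ‖r‖) b := by
  rw [mem_overconvergent_iff (fun r => norm_nonneg r)]
  intro ε hε
  obtain ⟨N, hN⟩ := hx.exists_forall_forall_le (rpow_neg_pos p b) (rpow_neg_lt_one p hb) hε
  refine ⟨N, fun n hn => (levelNorm_le_iff (fun r => norm_nonneg r) b _ n ε).mpr fun j hj => ?_⟩
  exact level_untiltHom_le (inv_le_rpow_neg p hb1) x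
    (fun i => hN _ (hn.trans (le_max_right _ _)) i (le_max_left _ _)) hj

/-- The `p ^ n`-th power of the norm of the `n`-th term bounds its components. -/
lemma norm_entry_pow_le_wittSup (y : Warrow p R) (n i : ℕ) (hi : i ≤ n) :
    ‖entry y n i‖ ^ p ^ (n - i) ≤ wittSup (fun r => ‖r‖) (y.1 n) ^ p ^ n :=
  (wittSup_pow_le_iff (fun r => norm_nonneg r) y n _).mp le_rfl i hi

lemma tendsto_of_mem_overconvergent {b : ℝ} (hb1 : b ≤ 1) {y : Warrow p R}
    (hy : y ∈ overconvergent (fun r => ‖r‖) b) :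
    Tendsto (fun n => ((p : ℝ)⁻¹) ^ n * wittSup (fun r => ‖r‖) (y.1 n) ^ p ^ n) atTop (𝓝 0) := by
  have h0 := PowSeq.inv_p_pos p
  have hs : ∀ n, 0 ≤ wittSup (fun r => ‖r‖) (y.1 n) ^ p ^ n := fun n =>
    (pow_nonneg (norm_nonneg _) _).trans (norm_entry_pow_le_wittSup y n 0 (Nat.zero_le n))
  refine squeeze_zero (fun n => mul_nonneg (pow_pos h0 n).le (hs n)) (fun n => ?_) hy
  rw [levelNorm_eq]
  exact mul_le_mul_of_nonneg_right (pow_le_pow_left₀ h0.le (inv_le_rpow_neg p hb1) n) (hs n)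

/-- Every overconvergent element `y` over `R` is in the image of the untilting homomorphism; the
entries of the digits of its preimage are limits of powers of components of `y`. -/
lemma exists_untiltHom_eq {b : ℝ} (hb1 : b ≤ 1) {y : Warrow p R}
    (hy : y ∈ overconvergent (fun r => ‖r‖) b) :
    ∃ x : ConvergentSubring p R, untiltHom p R x = y ∧ (∀ i m, Tendsto
      (fun l => entry y (i + m + l) i ^ p ^ l) atTop (𝓝 ((digit x.1 i).coeff m))) := by
  have hB := norm_entry_pow_le_wittSup y
  have hB0 := tendsto_of_mem_overconvergent hb1 hy
  obtain ⟨x, hxy⟩ := exists_digits y hB hB0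
  have hx : DigitsVanish (p : ℝ)⁻¹ x := by
    refine digitsVanish_of_forall_le (PowSeq.inv_p_pos p) fun ε hε => ?_
    obtain ⟨N, hN⟩ := eventually_atTop.mp (hB0.eventually (gt_mem_nhds hε))
    exact ⟨N, fun i hi => digitNorm_le_of_level_le hB hxy le_rfl fun n hn =>
      (hN n (hi.trans hn)).le⟩
  refine ⟨⟨x, hx⟩, ghost_injective h.isUnit_p (funext fun m => ?_), hxy⟩
  rw [ghost_apply, entry_untiltHom_zero, ghost_apply]
  exact untilt_eq_entry hx hB hB0 hxy m

lemma tendsto_digit_coeff {b : ℝ} (hb1 : b ≤ 1) (x : ConvergentSubring p R)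
    (hx : untiltHom p R x ∈ overconvergent (fun r => ‖r‖) b) (i m : ℕ) :
    Tendsto (fun l => entry (untiltHom p R x) (i + m + l) i ^ p ^ l) atTop
      (𝓝 ((digit x.1 i).coeff m)) := by
  obtain ⟨x', hx', hxy⟩ := exists_untiltHom_eq hb1 hx
  rw [untiltHom_injective hx'] at hxy
  exact hxy i m

lemma digit_le_of_levelNorm_le {b : ℝ} (hb1 : b ≤ 1) (x : ConvergentSubring p R)
    (hx : untiltHom p R x ∈ overconvergent (fun r => ‖r‖) b) {i : ℕ} {M : ℝ}
    (hM : ∀ n ≥ i, levelNorm (fun r => ‖r‖) b (untiltHom p R x) n ≤ M) :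
    ((p : ℝ) ^ (-b)) ^ i * digitNorm x.1 i ≤ M :=
  digitNorm_le_of_level_le (norm_entry_pow_le_wittSup _) (tendsto_digit_coeff hb1 x hx)
    (inv_le_rpow_neg p hb1) fun n hn => by
      rw [← levelNorm_eq]
      exact hM n hn

lemma digitsVanish_of_untiltHom {b : ℝ} (hb1 : b ≤ 1) (x : ConvergentSubring p R)
    (hx : untiltHom p R x ∈ overconvergent (fun r => ‖r‖) b) :
    DigitsVanish ((p : ℝ) ^ (-b)) x.1 := by
  refine digitsVanish_of_forall_le (rpow_neg_pos p b) fun ε hε => ?_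
  obtain ⟨N, hN⟩ := (mem_overconvergent_iff (fun r => norm_nonneg r) b _).mp hx ε hε
  exact ⟨N, fun i hi => digit_le_of_levelNorm_le hb1 x hx fun n hn => hN n (hi.trans hn)⟩

lemma ciSup_eq_of_forall_le_iff {u v : ℕ → ℝ} (hu : BddAbove (Set.range u))
    (hv : BddAbove (Set.range v)) (huv : ∀ M, (∀ n, u n ≤ M) ↔ ∀ n, v n ≤ M) :
    ⨆ n, u n = ⨆ n, v n :=
  le_antisymm (ciSup_le ((huv _).mpr (le_ciSup hv))) (ciSup_le ((huv _).mp (le_ciSup hu)))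

/-- Both norms have the same upper bounds: a bound on the digits bounds the level norms of the image,
and conversely. -/
lemma overconvergentNorm_untiltHom {b : ℝ} (hb : 0 < b) (hb1 : b ≤ 1) (x : ConvergentSubring p R)
    (hx : DigitsVanish ((p : ℝ) ^ (-b)) x.1) :
    overconvergentNorm (fun r => ‖r‖) b (untiltHom p R x) =
      overconvergentNorm (fun z => ‖z.coeff 0‖) b x.1 := by
  have hy := untiltHom_mem_overconvergent hb hb1 x hx
  have hx' := (mem_overconvergent_iff_digitsVanish hb x.1).mpr hx
  refine ciSup_eq_of_forall_le_iff (Tendsto.bddAbove_range hy) (Tendsto.bddAbove_range hx')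
    fun M => ⟨fun hM n => ?_, fun hM n => ?_⟩
  · refine (levelNorm_powSeq_le_iff b x.1 n M).mpr fun i hi => ?_
    refine le_trans (mul_le_mul_of_nonneg_right (pow_le_pow_of_le_one (rpow_neg_pos p b).le
      (rpow_neg_lt_one p hb).le hi) (digitNorm_nonneg x.1 i)) ?_
    exact digit_le_of_levelNorm_le hb1 x hy fun n _ => hM n
  · refine (levelNorm_le_iff (fun r => norm_nonneg r) b _ n M).mpr fun j hj => ?_
    exact level_untiltHom_le (inv_le_rpow_neg p hb1) x (fun i =>
      (levelNorm_powSeq_le_iff b x.1 (max i n) M).mp (hM _) i (le_max_left _ _)) hj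

end LevelNorm

/-! ### The tilt of an integral model -/

/-- `A` embeds into the unit ball of `R`, and its image contains the open unit ball. -/
structure IsIntegralModel {A R : Type*} [CommRing A] [NormedCommRing R] (f : A →+* R) : Prop where
  injective : Function.Injective f
  norm_le_one : ∀ a, ‖f a‖ ≤ 1
  mem_range : ∀ r, ‖r‖ < 1 → r ∈ f.range

namespace IsIntegralModel

variable {p : ℕ} [hp : Fact p.Prime] {R : Type*} [NormedCommRing R] [h : IsPAdicBanach p R]
  {A : Type*} [CommRing A] {f : A →+* R}

lemma isClosed_range (hf : IsIntegralModel f) : IsClosed (f.range : Set R) := by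
  refine isClosed_of_closure_subset fun r hr => ?_
  obtain ⟨s, hs, hrs⟩ := Metric.mem_closure_iff.mp hr 1 one_pos
  rw [dist_eq_norm] at hrs
  rw [← sub_add_cancel r s]
  exact Subring.add_mem _ (hf.mem_range _ hrs) hs

/-- Elements of `R` at distance less than `p⁻¹` from the image of `s` lie in the image of `A` and agree
with `s` modulo `p`. -/
lemma mk_eq_mk_of_norm_sub_lt (hf : IsIntegralModel f) {r : R} {s : A}
    (hrs : ‖r - f s‖ < (p : ℝ)⁻¹) :
    ∃ t, f t = r ∧ Ideal.Quotient.mk (Ideal.span {(p : A)}) t = Ideal.Quotient.mk _ s := by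
  obtain ⟨u, hu⟩ := h.isUnit_p.exists_right_inv
  have e : r - f s = p * (u * (r - f s)) := by rw [← mul_assoc, hu, one_mul]
  rw [e, h.norm_p_mul] at hrs
  obtain ⟨t, ht⟩ := hf.mem_range (u * (r - f s))
    (lt_of_mul_lt_mul_left (by rwa [mul_one]) (PowSeq.inv_p_pos p).le)
  refine ⟨s + p * t, ?_, ?_⟩
  · rw [map_add, map_mul, map_natCast, ht, ← e, add_sub_cancel]
  · rw [map_add, add_eq_left, Ideal.Quotient.eq_zero_iff_mem]
    exact Ideal.mul_mem_right _ _ (Ideal.mem_span_singleton_self _)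

lemma exists_mk_eq_of_tendsto (hf : IsIntegralModel f) {s : ℕ → A} {r : R}
    {a : A ⧸ Ideal.span {(p : A)}} (hr : Tendsto (fun l => f (s l)) atTop (𝓝 r))
    (hs : ∀ l, Ideal.Quotient.mk _ (s l) = a) : ∃ t, f t = r ∧ Ideal.Quotient.mk _ t = a := by
  obtain ⟨N, hN⟩ := Metric.tendsto_atTop.mp hr _ (PowSeq.inv_p_pos p)
  obtain ⟨t, ht, ht'⟩ := hf.mk_eq_mk_of_norm_sub_lt (p := p) (r := r) (s := s N)
    (by rw [← dist_eq_norm, dist_comm]; exact hN N le_rfl)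
  exact ⟨t, ht, ht'.trans (hs N)⟩

lemma norm_sub_le_of_mk_eq (hf : IsIntegralModel f) {s t : A}
    (hst : Ideal.Quotient.mk (Ideal.span {(p : A)}) s = Ideal.Quotient.mk _ t) :
    ‖f s - f t‖ ≤ (p : ℝ)⁻¹ := by
  rw [Ideal.Quotient.mk_eq_mk_iff_sub_mem, Ideal.mem_span_singleton] at hst
  obtain ⟨c, hc⟩ := hst
  rw [← map_sub, hc, map_mul, map_natCast, h.norm_p_mul]
  exact mul_le_of_le_one_right (PowSeq.inv_p_pos p).le (hf.norm_le_one c)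

/-- The sequence `z` has its entries in `A`, and they reduce to the entries of `a` modulo `p`. -/
def IsLift (f : A →+* R) (a : IntegralTilt p A) (z : PowSeq p R) : Prop :=
  ∀ n, ∃ r, f r = z.coeff n ∧ Ideal.Quotient.mk _ r = a.1 n

lemma coeff_add_pow (a : IntegralTilt p A) (n l : ℕ) : a.1 (n + l) ^ p ^ l = a.1 n :=
  PowSeq.coeff_add_pow (⟨a.1, a.2⟩ : PowSeq p (A ⧸ Ideal.span {(p : A)})) n l

/-- The lift has the entries `lim_l s_{n + l} ^ (p ^ l)`, where `s_n` lifts `a_n`. -/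
lemma exists_isLift (hf : IsIntegralModel f) (a : IntegralTilt p A) :
    ∃ z : PowSeq p R, IsLift f a z := by
  choose s hs using fun n => Ideal.Quotient.mk_surjective (a.1 n)
  have hmk : ∀ n l, Ideal.Quotient.mk (Ideal.span {(p : A)}) (s (n + l) ^ p ^ l) = a.1 n :=
    fun n l => by rw [map_pow, hs, coeff_add_pow]
  have hlim : ∀ n, ∃ L, Tendsto (fun l => f (s (n + l) ^ p ^ l)) atTop (𝓝 L) := fun n => by
    refine h.exists_tendsto (squeeze_zero (fun _ => norm_nonneg _) (fun l => ?_)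
      ((tendsto_pow_atTop_nhds_zero_of_lt_one (PowSeq.inv_p_pos p).le
        (PowSeq.inv_p_lt_one p)).comp (tendsto_add_atTop_nat 1)))
    have h1 : ‖f (s (n + (l + 1)) ^ p) - f (s (n + l))‖ ≤ (p : ℝ)⁻¹ * 1 := by
      rw [mul_one]
      refine hf.norm_sub_le_of_mk_eq ?_
      rw [map_pow, hs, hs]
      exact a.2 (n + l)
    have h2 := PowSeq.norm_pow_pow_sub_le h.toIsPAdicNormed (hf.norm_le_one _) h1 l
    rwa [one_pow, mul_one, ← map_pow, ← map_pow, ← pow_mul, ← pow_succ'] at h2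
  choose L hL using hlim
  refine ⟨⟨L, fun n => ?_⟩, fun n => hf.exists_mk_eq_of_tendsto (hL n) (hmk n)⟩
  refine tendsto_nhds_unique ((hL (n + 1)).pow p)
    (((hL n).comp (tendsto_add_atTop_nat 1)).congr fun l => ?_)
  rw [Function.comp_apply, ← map_pow, ← pow_mul, ← pow_succ,
    show n + 1 + l = n + (l + 1) by omega]

/-- A lift is unique, as `p`-power-compatible sequences which agree modulo `p` are equal. -/
lemma IsLift.eq (hf : IsIntegralModel f) {a : IntegralTilt p A} {z w : PowSeq p R}
    (hz : IsLift f a z) (hw : IsLift f a w) : z = w := by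
  refine PowSeq.eq_of_small h.toIsPAdicNormed ⟨fun _ => 1, fun _ => zero_le_one,
    fun _ => one_pow p, fun n => ?_⟩
  obtain ⟨r, hr, hr'⟩ := hz n
  obtain ⟨s, hs, hs'⟩ := hw n
  beta_reduce
  rw [mul_one, ← hr, ← hs]
  exact hf.norm_sub_le_of_mk_eq (hr'.trans hs'.symm)

lemma IsLift.add (hf : IsIntegralModel f) {a b : IntegralTilt p A} {z w : PowSeq p R}
    (hz : IsLift f a z) (hw : IsLift f b w) : IsLift f (a + b) (z + w) := by
  choose r hr hr' using hz
  choose s hs hs' using hw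
  intro n
  refine hf.exists_mk_eq_of_tendsto (s := fun l => (r (n + l) + s (n + l)) ^ p ^ l) ?_ fun l => ?_
  · refine (PowSeq.tendsto_addSeq h.toIsPAdicNormed z w n).congr fun l => ?_
    rw [PowSeq.addSeq, map_pow, map_add, hr, hs]
  · rw [map_pow, map_add, hr', hs']
    exact coeff_add_pow (a + b) n l

lemma IsLift.mul {a b : IntegralTilt p A} {z w : PowSeq p R}
    (hz : IsLift f a z) (hw : IsLift f b w) : IsLift f (a * b) (z * w) := by
  intro n
  obtain ⟨r, hr, hr'⟩ := hz n
  obtain ⟨s, hs, hs'⟩ := hw n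
  exact ⟨r * s, by rw [map_mul, hr, hs, PowSeq.mul_val], by rw [map_mul, hr', hs']; rfl⟩

/-- The homomorphism from the inverse limit of `A/p` under Frobenius to the inverse limit of `R`
under the `p`-power map. -/
noncomputable def tiltHom (hf : IsIntegralModel f) : IntegralTilt p A →+* PowSeq p R where
  toFun a := (hf.exists_isLift a).choose
  map_one' := (hf.exists_isLift 1).choose_spec.eq hf fun _ => ⟨1, map_one f, map_one _⟩
  map_mul' a b := (hf.exists_isLift (a * b)).choose_spec.eq hf
    ((hf.exists_isLift a).choose_spec.mul (hf.exists_isLift b).choose_spec)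
  map_zero' := (hf.exists_isLift 0).choose_spec.eq hf fun _ => ⟨0, map_zero f, map_zero _⟩
  map_add' a b := (hf.exists_isLift (a + b)).choose_spec.eq hf
    ((hf.exists_isLift a).choose_spec.add hf (hf.exists_isLift b).choose_spec)

lemma isLift_tiltHom (hf : IsIntegralModel f) (a : IntegralTilt p A) :
    IsLift f a (hf.tiltHom (p := p) a) := (hf.exists_isLift a).choose_spec

lemma tiltHom_injective (hf : IsIntegralModel f) :
    Function.Injective (hf.tiltHom (p := p)) := by
  intro a b hab
  refine Subtype.ext (funext fun n => ?_)
  obtain ⟨r, hr, hr'⟩ := hf.isLift_tiltHom a n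
  obtain ⟨s, hs, hs'⟩ := hf.isLift_tiltHom b n
  rw [hab, ← hs] at hr
  rw [← hr', ← hs', hf.injective hr]

lemma mem_range_tiltHom (hf : IsIntegralModel f) {z : PowSeq p R}
    (hz : ∀ n, z.coeff n ∈ f.range) : z ∈ (hf.tiltHom (p := p)).range := by
  choose r hr using hz
  refine ⟨⟨fun n => Ideal.Quotient.mk _ (r n), fun n => ?_⟩,
    (hf.isLift_tiltHom _).eq hf fun n => ⟨r n, hr n, rfl⟩⟩
  rw [← map_pow]
  exact congrArg _ (hf.injective (by rw [map_pow, hr, hr, z.pow_coeff]))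

lemma tiltHom_coeff_mem (hf : IsIntegralModel f) (a : IntegralTilt p A) (n : ℕ) :
    (hf.tiltHom (p := p) a).coeff n ∈ f.range := by
  obtain ⟨r, hr, -⟩ := hf.isLift_tiltHom a n
  exact ⟨r, hr⟩

end IsIntegralModel

/-! ### The isomorphisms -/

lemma exists_ringEquiv_of_range_eq {B C D : Type*} [Ring B] [Ring C] [Ring D] {g : B →+* D}
    {f : C →+* D} (hg : Function.Injective g) (hf : Function.Injective f)
    (hgf : g.range = f.range) : ∃ e : B ≃+* C, ∀ x, f (e x) = g x := by
  have h1 : ∀ x, ∃ y, f y = g x := fun x => by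
    rw [← RingHom.mem_range, ← hgf]
    exact ⟨x, rfl⟩
  choose e he using h1
  refine ⟨RingEquiv.ofBijective (⟨⟨⟨e, hf ?_⟩, fun x y => hf ?_⟩, hf ?_, fun x y => hf ?_⟩ : B →+* C)
    ⟨fun x y hxy => hg ?_, fun y => ?_⟩, he⟩
  · rw [he, map_one, map_one]
  · simp only [he, map_mul]
  · simp only [he, map_zero]
  · simp only [he, map_add]
  · rw [← he, ← he]
    exact congrArg f hxy
  · obtain ⟨x, hx⟩ : f y ∈ g.range := hgf ▸ ⟨y, rfl⟩
    exact ⟨x, hf ((he x).trans hx)⟩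

namespace IsIntegralModel

open Warrow

variable {p : ℕ} [hp : Fact p.Prime] {R : Type*} [NormedCommRing R] [h : IsPAdicBanach p R]
  {A : Type*} [CommRing A] {f : A →+* R}

lemma digitsVanish_map_tiltHom (hf : IsIntegralModel f) {q : ℝ} (hq : 0 < q) (hq1 : q < 1)
    (x : Warrow p (IntegralTilt p A)) : DigitsVanish q (Warrow.map p hf.tiltHom x) := by
  refine squeeze_zero (fun i => mul_nonneg (pow_pos hq i).le (digitNorm_nonneg _ i)) (fun i => ?_)
    (tendsto_pow_atTop_nhds_zero_of_lt_one hq.le hq1)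
  refine mul_le_of_le_one_right (pow_pos hq i).le ?_
  obtain ⟨r, hr⟩ := hf.tiltHom_coeff_mem (entry x i i) 0
  rw [digitNorm, digit, entry_map _ _ le_rfl, ← hr]
  exact hf.norm_le_one r

/-- The composition of the functorial map induced by `tiltHom` with the untilting homomorphism. -/
noncomputable def integralUntilt (hf : IsIntegralModel f) :
    Warrow p (IntegralTilt p A) →+* Warrow p R :=
  (untiltHom p R).comp ((Warrow.map p hf.tiltHom).codRestrict (ConvergentSubring p R)
    fun x => hf.digitsVanish_map_tiltHom (PowSeq.inv_p_pos p) (PowSeq.inv_p_lt_one p) x)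

lemma integralUntilt_apply (hf : IsIntegralModel f) (x : Warrow p (IntegralTilt p A)) :
    hf.integralUntilt x = untiltHom p R ⟨Warrow.map p hf.tiltHom x,
      hf.digitsVanish_map_tiltHom (PowSeq.inv_p_pos p) (PowSeq.inv_p_lt_one p) x⟩ := rfl

lemma integralUntilt_injective (hf : IsIntegralModel f) :
    Function.Injective (hf.integralUntilt (p := p)) := by
  intro x y hxy
  rw [integralUntilt_apply, integralUntilt_apply] at hxy
  exact map_injective hf.tiltHom_injective (congrArg Subtype.val (untiltHom_injective hxy))

lemma map_mem_overconvergent (hf : IsIntegralModel f) {b : ℝ} (hb : 0 < b) (y : Warrow p A) :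
    Warrow.map p f y ∈ overconvergent (fun r => ‖r‖) b := by
  refine squeeze_zero (fun n => levelNorm_nonneg (fun r => norm_nonneg r) b _ n) (fun n => ?_)
    (tendsto_pow_atTop_nhds_zero_of_lt_one (rpow_neg_pos p b).le (rpow_neg_lt_one p hb))
  refine (levelNorm_le_iff (fun r => norm_nonneg r) b _ n _).mpr fun i hi => ?_
  rw [entry_map f y hi]
  exact mul_le_of_le_one_right (pow_pos (rpow_neg_pos p b) n).le
    (pow_le_one₀ (norm_nonneg _) (hf.norm_le_one _))

/-- Both `Warrow p (IntegralTilt p A)` and `Warrow p A` are described inside the larger rings by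
integrality of the components, and the untilting homomorphism and its inverse respect integrality
because they are given by limits and `A` is closed in `R`. -/
lemma range_integralUntilt (hf : IsIntegralModel f) :
    (hf.integralUntilt (p := p)).range = (Warrow.map p f).range := by
  refine le_antisymm ?_ ?_
  · rintro _ ⟨x, rfl⟩
    refine mem_range_map hf.injective fun n i hi => ?_
    refine entry_untiltHom_mem hf.isClosed_range _ (fun j m => ?_) hi
    change (digit (Warrow.map p hf.tiltHom x) j).coeff m ∈ _
    rw [digit, entry_map _ _ le_rfl]
    exact hf.tiltHom_coeff_mem _ m
  · rintro _ ⟨y, rfl⟩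
    obtain ⟨x, hx, hxy⟩ := exists_untiltHom_eq le_rfl (hf.map_mem_overconvergent one_pos y)
    have hd : ∀ i m, (digit x.1 i).coeff m ∈ f.range := fun i m => by
      refine hf.isClosed_range.mem_of_tendsto (hxy i m) (Eventually.of_forall fun l => ?_)
      rw [entry_map f y (by omega), ← map_pow]
      exact ⟨_, rfl⟩
    obtain ⟨x', hx'⟩ := mem_range_map hf.tiltHom_injective (y := x.1) fun n i hi =>
      hf.mem_range_tiltHom fun m => by
        rw [entry_coeff x.1 hi]
        exact hd i _
    refine ⟨x', ?_⟩
    rw [integralUntilt_apply, ← hx]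
    exact congrArg _ (Subtype.ext hx')

lemma exists_map_eq_integralUntilt (hf : IsIntegralModel f) :
    ∃ e : Warrow p (IntegralTilt p A) ≃+* Warrow p A,
      ∀ x, Warrow.map p f (e x) = hf.integralUntilt x := by
  have h1 : Function.Injective (hf.integralUntilt (p := p)) := hf.integralUntilt_injective
  have h2 : Function.Injective (Warrow.map p f) := map_injective hf.injective
  exact exists_ringEquiv_of_range_eq h1 h2 hf.range_integralUntilt

/-- The isomorphism between the inverse limits along Frobenius over the integral tilt and
over `A`. -/
noncomputable def integralEquiv (hf : IsIntegralModel f) :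
    Warrow p (IntegralTilt p A) ≃+* Warrow p A :=
  (hf.exists_map_eq_integralUntilt (p := p)).choose

lemma map_integralEquiv (hf : IsIntegralModel f) (x : Warrow p (IntegralTilt p A)) :
    Warrow.map p f (hf.integralEquiv x) = hf.integralUntilt x :=
  (hf.exists_map_eq_integralUntilt (p := p)).choose_spec x

lemma mk_entry_pow (y : Warrow p A) {n i : ℕ} (hi : i ≤ n) (l : ℕ) :
    Ideal.Quotient.mk (Ideal.span {(p : A)}) (entry y (n + l) i ^ p ^ l) =
      Ideal.Quotient.mk _ (entry y n i) := by
  induction l with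
  | zero => rw [pow_zero, pow_one, add_zero]
  | succ l ih =>
    obtain ⟨c, hc⟩ := entry_frobenius y (show i ≤ n + l by omega)
    have hz : Ideal.Quotient.mk (Ideal.span {(p : A)}) (p * c) = 0 :=
      Ideal.Quotient.eq_zero_iff_mem.mpr (Ideal.mul_mem_right _ _ (Ideal.mem_span_singleton_self _))
    rw [← ih, hc, map_pow _ (_ + _), map_add, hz, add_zero, ← map_pow, ← pow_mul, ← pow_succ',
      add_assoc]

/-- The isomorphism is compatible with reduction modulo `p`: the entries of the digits
of the preimage are limits of powers of components, and these powers are constant modulo `p`. -/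
lemma map_mk_integralEquiv (hf : IsIntegralModel f) (x : Warrow p (IntegralTilt p A)) :
    Warrow.map p (Ideal.Quotient.mk (Ideal.span {(p : A)})) (hf.integralEquiv x) =
      Warrow.map p (IntegralTilt.proj p A) x := by
  refine ext_entry fun n i hi => ?_
  rw [entry_map _ _ hi, entry_map _ _ hi]
  obtain ⟨m, rfl⟩ := Nat.exists_eq_add_of_le hi
  have hmem : hf.integralUntilt x ∈ overconvergent (fun r => ‖r‖) 1 := by
    rw [← map_integralEquiv]
    exact hf.map_mem_overconvergent one_pos _
  have hlim : Tendsto (fun l => entry (hf.integralUntilt x) (i + m + l) i ^ p ^ l) atTop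
      (𝓝 ((digit (Warrow.map p hf.tiltHom x) i).coeff m)) := tendsto_digit_coeff le_rfl _ hmem i m
  rw [← map_integralEquiv] at hlim
  obtain ⟨r, hr, hr'⟩ := hf.exists_mk_eq_of_tendsto
    (s := fun l => entry (hf.integralEquiv x) (i + m + l) i ^ p ^ l)
    (hlim.congr fun l => by rw [entry_map f _ (by omega), map_pow])
    (fun l => mk_entry_pow _ hi l)
  obtain ⟨s, hs, hs'⟩ := hf.isLift_tiltHom (entry x (i + m) i) 0
  have e : (digit (Warrow.map p hf.tiltHom x) i).coeff m =
      (hf.tiltHom (entry x (i + m) i)).coeff 0 := by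
    rw [← entry_map _ _ hi, entry_coeff _ hi, Nat.add_sub_cancel_left, add_zero]
  rw [← hr', hf.injective (hr.trans (e.trans hs.symm)), hs']
  rfl

theorem exists_injective (hf : IsIntegralModel f) {b : ℝ} (hb : 0 < b) :
    ∃ S' : Subring (Warrow p (PowSeq p R)),
      (S' : Set (Warrow p (PowSeq p R))) = overconvergent (fun z => ‖z.coeff 0‖) b ∧
      ∃ j : Warrow p (IntegralTilt p A) →+* S', Function.Injective j ∧
        ∀ x, (j x : Warrow p (PowSeq p R)) = Warrow.map p hf.tiltHom x :=
  ⟨digitsVanishSubring (rpow_neg_pos p b) (rpow_neg_lt_one p hb),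
    Set.ext fun x => (mem_overconvergent_iff_digitsVanish hb x).symm,
    (Warrow.map p hf.tiltHom).codRestrict _ fun x =>
      hf.digitsVanish_map_tiltHom (rpow_neg_pos p b) (rpow_neg_lt_one p hb) x,
    fun _ _ hxy => map_injective hf.tiltHom_injective (Subtype.mk.inj hxy), fun _ => rfl⟩

/-- For `q = p ^ (-b)` with `b ≤ 1`, the untilting homomorphism restricts to an isometric isomorphism
of the overconvergent subrings. -/
theorem exists_isometry (hf : IsIntegralModel f) {b : ℝ} (hb : 0 < b) (hb1 : b ≤ 1) :
    ∃ (S' : Subring (Warrow p (PowSeq p R))) (S : Subring (Warrow p R)),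
      (S' : Set (Warrow p (PowSeq p R))) = overconvergent (fun z => ‖z.coeff 0‖) b ∧
      (S : Set (Warrow p R)) = overconvergent (fun r => ‖r‖) b ∧
      ∃ e : S' ≃+* S,
        (∀ x : S', overconvergentNorm (fun r => ‖r‖) b (e x : Warrow p R) =
          overconvergentNorm (fun z => ‖z.coeff 0‖) b (x : Warrow p (PowSeq p R))) ∧
        ∀ (x : Warrow p (IntegralTilt p A)) (hx : Warrow.map p hf.tiltHom x ∈ S'),
          (e ⟨Warrow.map p hf.tiltHom x, hx⟩ : Warrow p R) =
            Warrow.map p f (hf.integralEquiv x) := by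
  have hle : digitsVanishSubring (R := R) (rpow_neg_pos p b) (rpow_neg_lt_one p hb) ≤
      ConvergentSubring p R := fun x hx =>
    DigitsVanish.mono (PowSeq.inv_p_pos p) (inv_le_rpow_neg p hb1) hx
  -- Only the values of the restricted homomorphism matter, so its construction is hidden.
  obtain ⟨g, hg⟩ : ∃ g : digitsVanishSubring (R := R) (rpow_neg_pos p b) (rpow_neg_lt_one p hb) →+*
      Warrow p R, ∀ x, g x = untiltHom p R ⟨x.1, hle x.2⟩ :=
    ⟨(untiltHom p R).comp (Subring.inclusion hle), fun _ => rfl⟩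
  have hinj : Function.Injective g := fun x y hxy => by
    rw [hg, hg] at hxy
    exact Subtype.ext (Subtype.mk.inj (untiltHom_injective hxy))
  obtain ⟨e, he⟩ := exists_ringEquiv_of_range_eq hinj Subtype.val_injective
    (Subring.range_subtype g.range).symm
  refine ⟨digitsVanishSubring (rpow_neg_pos p b) (rpow_neg_lt_one p hb), g.range,
    Set.ext fun x => (mem_overconvergent_iff_digitsVanish hb x).symm, Set.ext fun y => ⟨?_, ?_⟩,
    e, fun x => ?_, fun x hx => ?_⟩
  · rintro ⟨x, rfl⟩
    rw [hg]
    exact untiltHom_mem_overconvergent hb hb1 _ x.2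
  · intro hy
    obtain ⟨x, rfl, -⟩ := exists_untiltHom_eq hb1 hy
    exact ⟨⟨x.1, digitsVanish_of_untiltHom hb1 x hy⟩, hg _⟩
  · have hx : (e x : Warrow p R) = untiltHom p R ⟨x.1, hle x.2⟩ := (he x).trans (hg x)
    rw [hx]
    exact overconvergentNorm_untiltHom hb hb1 ⟨x.1, hle x.2⟩ x.2
  · rw [map_integralEquiv, integralUntilt_apply]
    have hx' := (he ⟨Warrow.map p hf.tiltHom x, hx⟩).trans (hg _)
    exact hx'

end IsIntegralModel

/-! ### The localization with its `p`-adic norm -/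

section Localization

variable (p : ℕ) [hp : Fact p.Prime] (A : Type*) [CommRing A]

lemma padicSeminorm_p_mul [h : IsPNormal p A] (x : Loc p A) :
    padicSeminorm p A (p * x) = (p : ℝ)⁻¹ * padicSeminorm p A x := by
  have hp0 : (0 : ℝ) < p := by exact_mod_cast hp.out.pos
  have h1 : padicSeminorm p A (p : Loc p A) ≤ (p : ℝ)⁻¹ := by
    have := padicSeminorm_le_of_hasVal (x := (p : Loc p A)) (k := 1) (A := A) (by
      unfold HasVal
      rw [pow_one, ← pUnit_val, ← Units.val_mul]
      exact ⟨1, by simp⟩)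
    rwa [pow_one] at this
  have h2 : padicSeminorm p A ((pUnit p A)⁻¹ : (Loc p A)ˣ) ≤ p := by
    have := padicSeminorm_le (p := p) (A := A) (c := -1) (d := 1)
      (x := ((pUnit p A)⁻¹ : (Loc p A)ˣ)) one_pos (by
        unfold HasVal
        rw [pow_one, ← Units.val_mul]
        exact ⟨1, by simp⟩)
    simpa using this
  refine le_antisymm ?_ ?_
  · exact (padicSeminorm_mul h _ _).trans
      (mul_le_mul_of_nonneg_right h1 (padicSeminorm_nonneg x))
  · rw [inv_mul_le_iff₀ hp0]
    conv_lhs => rw [← Units.inv_mul_cancel_left (pUnit p A) x, pUnit_val]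
    exact (padicSeminorm_mul h _ _).trans
      (mul_le_mul_of_nonneg_right h2 (padicSeminorm_nonneg _))

variable [h : IsPNormal p A] [hc : IsAdicComplete (Ideal.span {(p : A)}) A]

lemma isPAdicBanach :
    letI := padicNormedCommRing p A
    IsPAdicBanach p (Loc p A) := by
  let _ := padicNormedCommRing p A
  have := isPAdicNormed p A
  exact ⟨⟨pUnit p A, pUnit_val p A⟩, padicSeminorm_p_mul p A⟩

lemma isIntegralModel_algebraMap :
    letI := padicNormedCommRing p A
    IsIntegralModel (algebraMap A (Loc p A)) := by
  let _ := padicNormedCommRing p A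
  refine ⟨algebraMap_injective h, fun a => ?_, fun r hr => mem_of_lt_one h hr⟩
  have := padicSeminorm_le_of_hasVal ((hasVal_algebraMap h (a := a) (k := 0)).mpr (by simp))
  rwa [pow_zero] at this

end Localization

end OverconvergentWitt

open OverconvergentWitt
theorem mainTheorem6 (p : ℕ) [Fact p.Prime] (A : Type*) [CommRing A] [IsPNormal p A]
    [IsAdicComplete (Ideal.span {(p : A)}) A] (hA : IsWittPerfect p A) :
    ∃ ι : IntegralTilt p A →+* Tilt p A,
      (∀ (a : IntegralTilt p A) (n : ℕ), ∃ r : A,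
        algebraMap A (Loc p A) r = (ι a).coeff n ∧ Ideal.Quotient.mk _ r = a.1 n) ∧
    ∃ θ : Warrow p (IntegralTilt p A) ≃+* Warrow p A,
      (∀ x, Warrow.map p (Ideal.Quotient.mk (Ideal.span {(p : A)})) (θ x) =
        Warrow.map p (IntegralTilt.proj p A) x) ∧
      (∀ b : ℝ, 0 < b → ∃ S' : Subring (Warrow p (Tilt p A)),
        (S' : Set (Warrow p (Tilt p A))) = overconvergent tiltSeminorm b ∧
        ∃ j : Warrow p (IntegralTilt p A) →+* S', Function.Injective j ∧
          ∀ x, (j x : Warrow p (Tilt p A)) = Warrow.map p ι x) ∧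
      ∀ b : ℝ, 0 < b → b ≤ 1 →
        ∃ (S' : Subring (Warrow p (Tilt p A))) (S : Subring (Warrow p (Loc p A))),
          (S' : Set (Warrow p (Tilt p A))) = overconvergent tiltSeminorm b ∧
          (S : Set (Warrow p (Loc p A))) = overconvergent (padicSeminorm p A) b ∧
          ∃ e : S' ≃+* S,
            (∀ x : S', overconvergentNorm (padicSeminorm p A) b (e x : Warrow p (Loc p A)) =
              overconvergentNorm tiltSeminorm b (x : Warrow p (Tilt p A))) ∧
            ∀ (x : Warrow p (IntegralTilt p A)) (hx : Warrow.map p ι x ∈ S'),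
              (e ⟨Warrow.map p ι x, hx⟩ : Warrow p (Loc p A)) =
                Warrow.map p (algebraMap A (Loc p A)) (θ x) := by
  let _ := padicNormedCommRing p A
  have := isPAdicBanach p A
  have hf := isIntegralModel_algebraMap p A
  refine ⟨hf.tiltHom, hf.isLift_tiltHom, hf.integralEquiv, hf.map_mk_integralEquiv, ?_, ?_⟩
  · exact fun b hb => hf.exists_injective hb
  · exact fun b hb hb1 => hf.exists_isometry hb hb1
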